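/- **Setting.** Let $\mu(v)=(2\pi)^{-3/2}e^{-|v|^2/2}$ on $\mathbb R^3$, let $$Q(F,G)(v)=\tfrac12\int_{\mathbb R^3}\int_{\mathbb S^2}|(v-v_*)\cdot\mathfrak u|\{F(v')G(v_*')+G(v')F(v_*')-F(v)G(v_*)-G(v)F(v_*)\}\,d\mathfrak u\,dv_*,$$ $v'=v-((v-v_*)\cdot\mathfrak u)\mathfrak u$, $v_*'=v_*+((v-v_*)\cdot\mathfrak u)\mathfrak u$, be the hard sphere collision operator, and put $Lf=-\frac{2}{\sqrt\mu}Q(\mu,\sqrt\mu f)$, $\Gamma(f,g)=\frac1{\sqrt\mu}Q(\sqrt\mu f,\sqrt\mu g)$. Let $\mathcal N=\mathrm{span}\{1,v_1,v_2,v_3,\frac{|v|^2-3}2\}\sqrt\mu$, let $\mathbf P$ be the $L^2_v$-orthogonal projection onto $\mathcal N$, $\langle\cdot,\cdot\rangle$ the $L^2_v$ inner product, and let $L^{-1}:\mathcal N^\perp\to\mathcal N^\perp$ be the inverse of $L$ (that is, $h=L^{-1}g$ means $h\in\mathcal N^\perp$, $\nu h\in L^2_v$ and $Lh=g$, where $\nu(v)=\int_{\mathbb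 R^3}\int_{\mathbb S^2}|(v-v_*)\cdot\mathfrak u|\mu(v_*)\,d\mathfrak u\,dv_*$). Put $A_{ij}=L^{-1}\big((v_iv_j-\frac{|v|^2}3\delta_{ij})\sqrt\mu\big)$, $B_i=L^{-1}\big(\frac{|v|^2-5}2v_i\sqrt\mu\big)$, $\eta_v=\langle A_{12},LA_{12}\rangle$, $\eta_c=\frac25\langle LB_1,B_1\rangle$. Let $\Omega\subseteq\mathbb R^3$ be open, $\varepsilon,\kappa>0$, and let $(\rho,u,\theta,p)$ be a classical solution ($\rho,u,\theta\in C^2$, $p\in C^1$) on $(0,T)\times\Omega$ of $$\partial_tu+u\cdot\nabla u-\kappa\eta_v\Delta u+\nabla p=0,\quad \nabla\cdot u=0,\quad \partial_t\theta+u\cdot\nabla\theta-\kappa\eta_c\Delta\theta=0,\quad \rho+\theta=0 .$$ Let $f_1=(\rho+u\cdot v+\theta\frac{|v|^2-3}2)\sqrt\mu$. Call a function $f(t,x,v)$ *regular* if it is $C^1$ in $(t,x)\in(0,T)\times\Omega$ for every $v$, measurable in $v$, and bounded by a polynomial in $|v|$ locally uniformly in $(t,x)$. **Proposition.** (i) $\langle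 A_{ij},LA_{kl}\rangle=\eta_v(\delta_{ik}\delta_{jl}+\delta_{il}\delta_{jk}-\frac23\delta_{ij}\delta_{kl})$ and $\langle LB_k,B_j\rangle=\frac52\eta_c\delta_{kj}$; moreover $-\kappa v\cdot\nabla_xf_1+\Gamma(f_1,f_1)\in\mathcal N^\perp$ for all $(t,x)$. (ii) Let $f_2$ be regular with $\nabla_xf_2$ also locally uniformly polynomially bounded in $v$, and suppose $$(\mathbf I-\mathbf P)f_2=L^{-1}(-\kappa v\cdot\nabla_xf_1+\Gamma(f_1,f_1)),\qquad \mathbf Pf_2=(\rho_2+u_2\cdot v+\theta_2\tfrac{|v|^2-3}2)\sqrt\mu,$$ $$\nabla\cdot u_2=-\partial_t\rho,\qquad \nabla(\rho_2+\theta_2-\tfrac13|u|^2)=\nabla p .$$ Then $Lf_1=0$, $\;v\cdot\nabla_xf_1-\frac1\kappa\Gamma(f_1,f_1)+\frac1\kappa Lf_2=0$, and $\mathbf P\{\partial_tf_1+v\cdot\nabla_xf_2-\frac2\kappa\Gamma(f_1,f_2)\}=0$. (iii) If in addition $F=\mu+\varepsilon f_1\sqrt\mu+\varepsilon^2f_2\sqrt\mu+\varepsilon^{3/2}f_R\sqrt\mu$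 with $f_R$ regular solves the scaled Boltzmann equation $\varepsilon\partial_tF+v\cdot\nabla_xF=\frac1{\kappa\varepsilon}Q(F,F)$ on $(0,T)\times\Omega\times\mathbb R^3$, then there $$\Big[\partial_t+\tfrac1\varepsilon v\cdot\nabla_x+\tfrac1{\varepsilon^2\kappa}L\Big]f_R=-\tfrac1{\varepsilon^{1/2}}\Big\{(\mathbf I-\mathbf P)(v\cdot\nabla_xf_2)-\tfrac2\kappa\Gamma(f_1,f_2)\Big\}+\varepsilon^{1/2}\Big(-\partial_tf_2+\tfrac1\kappa\Gamma(f_2,f_2)\Big)+\tfrac2{\varepsilon\kappa}\Gamma(f_1+\varepsilon f_2,f_R)+\tfrac1{\varepsilon^{1/2}\kappa}\Gamma(f_R,f_R).$$ (iv) If moreover $\partial_tf_2$ and $\partial_tf_R$ are regular and $\nabla_x\partial_tf_2$ is locally uniformly polynomially bounded in $v$, then $$\begin{aligned}\Big[\partial_t+\tfrac1\varepsilon v\cdot\nabla_x+\tfrac1{\varepsilon^2\kappa}L\Big]\partial_tf_R=&-\tfrac1{\varepsilon^{1/2}}\Big\{(\mathbf I-\mathbf P)(v\cdot\nabla_x\partial_tf_2)-\tfrac2\kappa\Gamma(\partial_tf_1,f_2)-\tfrac2\kappa\Gamma(f_1,\partial_tf_2)\Big\}\\&+\varepsilon^{1/2}\Big(-\partial_t^2f_2+\tfrac2\kappa\Gamma(\partial_tf_2,f_2)\Big)+\tfrac2{\varepsilon\kappa}\Big(\Gamma(\partial_tf_1+\varepsilon\partial_tf_2,f_R)+\Gamma(f_1+\varepsilon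 f_2,\partial_tf_R)\Big)\\&+\tfrac2{\varepsilon^{1/2}\kappa}\Gamma(\partial_tf_R,f_R).\end{aligned}$$ -/

import Mathlib

open MeasureTheory Set

noncomputable section

namespace HilbertExpansion

/-- Three dimensional Euclidean space, used for positions `x` and for velocities `v`. -/
abbrev E3 : Type := EuclideanSpace ℝ (Fin 3)

/-- Kronecker delta. -/
def kron (i j : Fin 3) : ℝ := if i = j then 1 else 0

/-! ### Collision operators (hard spheres) -/

/-- The global Maxwellian `μ(v) = (2π)^{-3/2} exp(-|v|²/2)`. -/
def maxw (v : E3) : ℝ := (2 * Real.pi) ^ (-(3 / 2) : ℝ) * Real.exp (-‖v‖ ^ 2 / 2)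

/-- `√μ`. -/
def sqrtMaxw (v : E3) : ℝ := Real.sqrt (maxw v)

/-- The surface measure of the unit sphere (total mass `4π`). -/
def sphereMeasure : Measure (Metric.sphere (0 : E3) 1) := (volume : Measure E3).toSphere

/-- Post-collisional velocity `v' = v - ((v - v_*)·𝔲) 𝔲`. -/
def vPost (v w 𝔲 : E3) : E3 := v - inner ℝ (v - w) 𝔲 • 𝔲

/-- Post-collisional velocity `v_*' = v_* + ((v - v_*)·𝔲) 𝔲`. -/
def wPost (v w 𝔲 : E3) : E3 := w + inner ℝ (v - w) 𝔲 • 𝔲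

/-- The symmetrized hard sphere collision operator `Q(F,G)`. -/
def collQ (F G : E3 → ℝ) (v : E3) : ℝ :=
  (1 / 2) * ∫ w : E3, ∫ s : Metric.sphere (0 : E3) 1,
    |inner ℝ (v - w) (s : E3)| *
      (F (vPost v w s) * G (wPost v w s) + G (vPost v w s) * F (wPost v w s)
        - F v * G w - G v * F w) ∂sphereMeasure

/-- The linearized operator `L f = -(2/√μ) Q(μ, √μ f)`. -/
def linL (f : E3 → ℝ) (v : E3) : ℝ :=
  -2 / sqrtMaxw v * collQ maxw (fun w => sqrtMaxw w * f w) v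

/-- `Γ(f,g) = (1/√μ) Q(√μ f, √μ g)`. -/
def gam (f g : E3 → ℝ) (v : E3) : ℝ :=
  1 / sqrtMaxw v * collQ (fun w => sqrtMaxw w * f w) (fun w => sqrtMaxw w * g w) v

/-- The collision frequency `ν(v)`. -/
def collFreq (v : E3) : ℝ :=
  ∫ w : E3, ∫ s : Metric.sphere (0 : E3) 1,
    |inner ℝ (v - w) (s : E3)| * maxw w ∂sphereMeasure

/-- The `L²_v` pairing. -/
def pair (f g : E3 → ℝ) : ℝ := ∫ v : E3, f v * g v

/-- The functions `φ_0 √μ, …, φ_4 √μ`, an orthogonal basis of the null space `𝒩` of `L`: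
`φ_0 = 1`, `φ_i = v_i` for `i = 1, 2, 3`, `φ_4 = (|v|² - 3)/2`. -/
def nullBasis (j : Fin 5) (v : E3) : ℝ :=
  (![1, v 0, v 1, v 2, (‖v‖ ^ 2 - 3) / 2] : Fin 5 → ℝ) j * sqrtMaxw v

/-- The `L²_v`-orthogonal projection `𝐏` onto `𝒩`. The basis is orthogonal but `φ_4 √μ` has
squared norm `3/2`, hence the normalization. -/
def projP (g : E3 → ℝ) (v : E3) : ℝ :=
  ∑ j : Fin 5, pair g (nullBasis j) / pair (nullBasis j) (nullBasis j) * nullBasis j v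

/-- `g ∈ 𝒩^⊥ ⊆ L²_v`. -/
def InNullPerp (g : E3 → ℝ) : Prop :=
  MemLp g 2 volume ∧ ∀ j : Fin 5, pair g (nullBasis j) = 0

/-- `h = L⁻¹ g`, where `L⁻¹ : 𝒩^⊥ → 𝒩^⊥`: the function `h` lies in `𝒩^⊥` and in the domain
`{h ∈ L² : ν h ∈ L²}` of `L`, and `L h = g`. -/
def IsLInv (g h : E3 → ℝ) : Prop :=
  InNullPerp h ∧ MemLp (fun v => collFreq v * h v) 2 volume ∧ ∀ v, linL h v = g v

open Classical in
/-- `L⁻¹ g` as a function. -/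
def linLInv (g : E3 → ℝ) : E3 → ℝ :=
  if h : ∃ k, IsLInv g k then h.choose else 0

/-- `A_{ij} = L⁻¹((v_i v_j - |v|² δ_{ij}/3) √μ)`. -/
def tensorA (i j : Fin 3) : E3 → ℝ :=
  linLInv fun v => (v i * v j - ‖v‖ ^ 2 / 3 * kron i j) * sqrtMaxw v

/-- `B_i = L⁻¹(((|v|² - 5)/2) v_i √μ)`. -/
def vectorB (i : Fin 3) : E3 → ℝ :=
  linLInv fun v => (‖v‖ ^ 2 - 5) / 2 * v i * sqrtMaxw v

/-- The viscosity `η_v = ⟨A_{12}, L A_{12}⟩`. -/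
def etaV : ℝ := pair (tensorA 0 1) (linL (tensorA 0 1))

/-- The heat conductivity `η_c = (2/5) ⟨L B_1, B_1⟩`. -/
def etaC : ℝ := 2 / 5 * pair (linL (vectorB 0)) (vectorB 0)

/-! ### Fluid quantities -/

/-- Divergence of a vector field on `ℝ³`. -/
def divg (w : E3 → E3) (x : E3) : ℝ :=
  ∑ i : Fin 3, fderiv ℝ w x (EuclideanSpace.single i 1) i

/-- `(ρ, u, θ, p)` is a classical solution on `(0,T) × Ω` of the Navier-Stokes-Fourier system
with viscosity `κ η_v`, heat conductivity `κ η_c` and the Boussinesq relation. -/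
structure IsNSF (T : ℝ) (Ω : Set E3) (κ : ℝ) (ρ : ℝ → E3 → ℝ) (u : ℝ → E3 → E3)
    (θ p : ℝ → E3 → ℝ) : Prop where
  contDiff_rho : ContDiffOn ℝ 2 (fun z : ℝ × E3 => ρ z.1 z.2) (Ioo 0 T ×ˢ Ω)
  contDiff_u : ContDiffOn ℝ 2 (fun z : ℝ × E3 => u z.1 z.2) (Ioo 0 T ×ˢ Ω)
  contDiff_theta : ContDiffOn ℝ 2 (fun z : ℝ × E3 => θ z.1 z.2) (Ioo 0 T ×ˢ Ω)
  contDiff_p : ContDiffOn ℝ 1 (fun z : ℝ × E3 => p z.1 z.2) (Ioo 0 T ×ˢ Ω)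
  momentum : ∀ t ∈ Ioo 0 T, ∀ x ∈ Ω,
    deriv (fun s => u s x) t + fderiv ℝ (u t) x (u t x)
      - (κ * etaV) • Laplacian.laplacian (u t) x + gradient (p t) x = 0
  incompressible : ∀ t ∈ Ioo 0 T, ∀ x ∈ Ω, divg (u t) x = 0
  heat : ∀ t ∈ Ioo 0 T, ∀ x ∈ Ω,
    deriv (fun s => θ s x) t + fderiv ℝ (θ t) x (u t x)
      - κ * etaC * Laplacian.laplacian (θ t) x = 0
  boussinesq : ∀ t ∈ Ioo 0 T, ∀ x ∈ Ω, ρ t x + θ t x = 0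

/-! ### Kinetic quantities, functions of `(t, x, v)` -/

/-- `∂_t f`. -/
def dt (f : ℝ → E3 → E3 → ℝ) (t : ℝ) (x v : E3) : ℝ := deriv (fun s => f s x v) t

/-- `v · ∇_x f`. -/
def transport (f : ℝ → E3 → E3 → ℝ) (t : ℝ) (x v : E3) : ℝ :=
  fderiv ℝ (fun y => f t y v) x v

/-- `(ρ + u·v + θ (|v|² - 3)/2) √μ`. -/
def hydro (ρ : ℝ → E3 → ℝ) (u : ℝ → E3 → E3) (θ : ℝ → E3 → ℝ) (t : ℝ) (x v : E3) : ℝ :=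
  (ρ t x + inner ℝ (u t x) v + θ t x * ((‖v‖ ^ 2 - 3) / 2)) * sqrtMaxw v

/-- At most polynomial growth in `v`, locally uniformly in `(t,x) ∈ (0,T) × Ω`. -/
def PolyGrowth {G : Type*} [Norm G] (T : ℝ) (Ω : Set E3) (f : ℝ → E3 → E3 → G) : Prop :=
  ∀ K : Set (ℝ × E3), IsCompact K → K ⊆ Ioo 0 T ×ˢ Ω →
    ∃ (C : ℝ) (N : ℕ), ∀ z ∈ K, ∀ v : E3, ‖f z.1 z.2 v‖ ≤ C * (1 + ‖v‖) ^ N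

/-- The regularity under which the equations are read pointwise: `f` is `C¹` in `(t,x)`,
measurable in `v`, and of at most polynomial growth in `v`. -/
structure KinRegular (T : ℝ) (Ω : Set E3) (f : ℝ → E3 → E3 → ℝ) : Prop where
  measurable : ∀ t ∈ Ioo 0 T, ∀ x ∈ Ω, Measurable (f t x)
  contDiff : ∀ v, ContDiffOn ℝ 1 (fun z : ℝ × E3 => f z.1 z.2 v) (Ioo 0 T ×ˢ Ω)
  growth : PolyGrowth T Ω f

/-- `KinRegular`, and `∇_x f` is also of at most polynomial growth in `v`. -/
structure KinRegularGrad (T : ℝ) (Ω : Set E3) (f : ℝ → E3 → E3 → ℝ) : Prop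
    extends KinRegular T Ω f where
  growth_grad : PolyGrowth T Ω fun t x v => fderiv ℝ (fun y => f t y v) x

/-- The scaled Boltzmann equation `St ∂_t F + v·∇_x F = (1/Kn) Q(F,F)` on `(0,T) × Ω × ℝ³`. -/
def SolvesBoltzmann (T : ℝ) (Ω : Set E3) (St Kn : ℝ) (F : ℝ → E3 → E3 → ℝ) : Prop :=
  ∀ t ∈ Ioo 0 T, ∀ x ∈ Ω, ∀ v : E3,
    St * dt F t x v + transport F t x v = 1 / Kn * collQ (F t x) (F t x) v

/-- The argument `-κ v·∇_x f₁ + Γ(f₁,f₁)` of `L⁻¹` in the definition of `(𝐈-𝐏) f₂`. -/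
def microSource (κ : ℝ) (f₁ : ℝ → E3 → E3 → ℝ) (t : ℝ) (x v : E3) : ℝ :=
  -κ * transport f₁ t x v + gam (f₁ t x) (f₁ t x) v

/-- The choice of `f₂`. -/
structure IsSecondCorrector (T : ℝ) (Ω : Set E3) (κ : ℝ) (ρ : ℝ → E3 → ℝ) (u : ℝ → E3 → E3)
    (p : ℝ → E3 → ℝ) (f₁ : ℝ → E3 → E3 → ℝ) (ρ₂ : ℝ → E3 → ℝ) (u₂ : ℝ → E3 → E3)
    (θ₂ : ℝ → E3 → ℝ) (f₂ : ℝ → E3 → E3 → ℝ) : Prop where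
  micro : ∀ t ∈ Ioo 0 T, ∀ x ∈ Ω,
    IsLInv (microSource κ f₁ t x) (fun v => f₂ t x v - projP (f₂ t x) v)
  macro_part : ∀ t ∈ Ioo 0 T, ∀ x ∈ Ω, ∀ v, projP (f₂ t x) v = hydro ρ₂ u₂ θ₂ t x v
  div_u₂ : ∀ t ∈ Ioo 0 T, ∀ x ∈ Ω, divg (u₂ t) x = -deriv (fun s => ρ s x) t
  grad_pressure : ∀ t ∈ Ioo 0 T, ∀ x ∈ Ω,
    gradient (fun y => ρ₂ t y + θ₂ t y - 1 / 3 * ‖u t y‖ ^ 2) x = gradient (p t) x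

/-- The reduced equation for `f_R`. -/
def RemainderEq (T : ℝ) (Ω : Set E3) (ε κ : ℝ) (f₁ f₂ fR : ℝ → E3 → E3 → ℝ) : Prop :=
  ∀ t ∈ Ioo 0 T, ∀ x ∈ Ω, ∀ v : E3,
    dt fR t x v + 1 / ε * transport fR t x v + 1 / (ε ^ 2 * κ) * linL (fR t x) v
      = -(1 / ε ^ (1 / 2 : ℝ)) *
          (transport f₂ t x v - projP (transport f₂ t x) v
            - 2 / κ * gam (f₁ t x) (f₂ t x) v)
        + ε ^ (1 / 2 : ℝ) * (-dt f₂ t x v + 1 / κ * gam (f₂ t x) (f₂ t x) v)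
        + 2 / (ε * κ) * gam (fun w => f₁ t x w + ε * f₂ t x w) (fR t x) v
        + 1 / (ε ^ (1 / 2 : ℝ) * κ) * gam (fR t x) (fR t x) v

/-- The reduced equation for `∂_t f_R`. -/
def RemainderEqDt (T : ℝ) (Ω : Set E3) (ε κ : ℝ) (f₁ f₂ fR : ℝ → E3 → E3 → ℝ) : Prop :=
  ∀ t ∈ Ioo 0 T, ∀ x ∈ Ω, ∀ v : E3,
    dt (dt fR) t x v + 1 / ε * transport (dt fR) t x v
        + 1 / (ε ^ 2 * κ) * linL (dt fR t x) v
      = -(1 / ε ^ (1 / 2 : ℝ)) *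
          (transport (dt f₂) t x v - projP (transport (dt f₂) t x) v
            - 2 / κ * gam (dt f₁ t x) (f₂ t x) v - 2 / κ * gam (f₁ t x) (dt f₂ t x) v)
        + ε ^ (1 / 2 : ℝ) * (-dt (dt f₂) t x v + 2 / κ * gam (dt f₂ t x) (f₂ t x) v)
        + 2 / (ε * κ) *
            (gam (fun w => dt f₁ t x w + ε * dt f₂ t x w) (fR t x) v
              + gam (fun w => f₁ t x w + ε * f₂ t x w) (dt fR t x) v)
        + 2 / (ε ^ (1 / 2 : ℝ) * κ) * gam (dt fR t x) (fR t x) v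

end HilbertExpansion

end

open HilbertExpansion

open MeasureTheory Set

noncomputable section

namespace HilbertExpansion

/-! Inserting the expansion into the Boltzmann equation and dividing by `√μ` gives an identity in
powers of `√ε`. Since `L f₁ = 0`, the terms of order `ε` cancel exactly when `L f₂ = -κ v·∇f₁ +
Γ(f₁,f₁)`, which is the choice of the microscopic part of `f₂`. At order `ε²` the only obstacle is
`∂_t f₁ + 𝐏(v·∇f₂) = 0`: once it holds, `∂_t f₁ + v·∇f₂` becomes `(𝐈-𝐏)(v·∇f₂)` and the remainder
equation follows by algebra (`gam_expand`, `remainderEq`). So the core is a set of conservation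
laws, `pair_transport_nullBasis`.

The moments of `v·∇f₂` against `1`, `v_j`, `(|v|²-3)/2` are divergences of moments of `f₂`, and
these reduce to the macroscopic part and to the pairings of `L⁻¹ g` with the stress `devSrc` and the
heat flux `heatSrc`, where `g = -κ v·∇f₁ + Γ(f₁,f₁)`. Incompressibility and the Boussinesq relation
make `v·∇f₁` a combination of these same stresses and fluxes (`IsNSF.transport_eq`). For a collision
invariant `φ` one has `Γ(φ√μ,φ√μ) = ½ L(φ²√μ)`, so the quadratic term has an explicit inverse.
Self-adjointness and rotation covariance of `L` force `⟨L⁻¹ devSrc, devSrc⟩` and `⟨L⁻¹ heatSrc,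
heatSrc⟩` to be isotropic (`invForm_devSrc`, `invForm_heatSrc`), with one constant each. The outcome
is a Newtonian stress plus `u ⊗ u` and a Fourier flux plus `θ u`, and the fluid system closes the
conservation laws.

The Fredholm theory of `L` is avoided: neither the existence of `L⁻¹` on `𝒩^⊥` nor the identity `ker
L = 𝒩` is proved. Three facts replace it. (a) The range of `L` is a subspace stable under
isometries. Hence either all stresses lie in it, or no nonzero combination of them does; in the
second case `linLInv` takes its default value `0`, the coefficient vanishes and the formulas hold
trivially (`devSum_dichotomy`, `heatSum_dichotomy`). (b) Two preimages of one `g` need not be shown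
equal, only to have the same stress and heat flux. A kernel element has zero Dirichlet form, so it
satisfies the collision invariance almost everywhere; testing this without the weight `|(v-w)·s|`
turns polynomials into explicit eigenfunctions, namely stress and heat flux with nonzero eigenvalue
(`pair_kernel_stress`, `pair_kernel_heat`). (c) Since `L h = g` is required at every `v`, linearity
of `L` on `L²` needs absolute convergence of the collision integral at every `v`
(`gamInt_sqrtMaxw_of_memLp`). Averaging over the orthogonal group turns each gain term into an
integral of `h` against `|y|⁻¹` times a Gaussian, a weight that is square integrable in dimension
three.

The equation for `∂_t f_R` is the time derivative of the remainder equation: differentiation under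
the collision integrals is dominated by polynomial times Gaussian bounds, and `∂_t` commutes with
`∇_x` because `f` and `∂_t f` are both `C¹`. -/

/-- The unit sphere of `E3`. -/
abbrev S2 : Type := Metric.sphere (0 : E3) 1

instance : IsFiniteMeasure sphereMeasure := by unfold sphereMeasure; infer_instance

/-! ### The Maxwellian -/

lemma maxw_pos (v : E3) : 0 < maxw v := by unfold maxw; positivity

lemma sqrtMaxw_pos (v : E3) : 0 < sqrtMaxw v := Real.sqrt_pos.2 (maxw_pos v)

lemma sqrtMaxw_mul_self (v : E3) : sqrtMaxw v * sqrtMaxw v = maxw v :=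
  Real.mul_self_sqrt (maxw_pos v).le

lemma sqrtMaxw_eq (v : E3) :
    sqrtMaxw v = Real.sqrt ((2 * Real.pi) ^ (-(3 / 2) : ℝ)) * Real.exp (-(1 / 4) * ‖v‖ ^ 2) := by
  unfold sqrtMaxw maxw
  rw [Real.sqrt_mul (by positivity)]
  congr 1
  rw [Real.sqrt_eq_iff_mul_self_eq (by positivity) (by positivity), ← Real.exp_add]
  congr 1; ring

@[fun_prop]
lemma continuous_maxw : Continuous maxw := by unfold maxw; fun_prop

@[fun_prop]
lemma continuous_sqrtMaxw : Continuous sqrtMaxw := by unfold sqrtMaxw; fun_prop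

lemma maxw_congr {v w : E3} (h : ‖v‖ = ‖w‖) : maxw v = maxw w := by simp [maxw, h]

lemma sqrtMaxw_congr {v w : E3} (h : ‖v‖ = ‖w‖) : sqrtMaxw v = sqrtMaxw w := by
  simp [sqrtMaxw, maxw_congr h]

lemma sqrtMaxw_le_one (v : E3) : sqrtMaxw v ≤ 1 := by
  rw [sqrtMaxw_eq]
  have h1 : Real.sqrt ((2 * Real.pi) ^ (-(3 / 2) : ℝ)) ≤ 1 := by
    rw [Real.sqrt_le_one]
    apply Real.rpow_le_one_of_one_le_of_nonpos
    · linarith [Real.pi_gt_three]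
    · norm_num
  have h2 : Real.exp (-(1 / 4) * ‖v‖ ^ 2) ≤ 1 := Real.exp_le_one_iff.2 (by nlinarith [sq_nonneg ‖v‖])
  exact mul_le_one₀ h1 (by positivity) h2

/-! ### Collision kinematics -/

lemma sphere_inner_self (s : S2) : inner ℝ (s : E3) (s : E3) = (1 : ℝ) := by
  rw [real_inner_self_eq_norm_sq, norm_eq_of_mem_sphere]; norm_num

lemma norm_sq_post (v w : E3) (s : S2) :
    ‖vPost v w s‖ ^ 2 + ‖wPost v w s‖ ^ 2 = ‖v‖ ^ 2 + ‖w‖ ^ 2 := by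
  unfold vPost wPost
  rw [norm_sub_sq_real, norm_add_sq_real, norm_smul, norm_eq_of_mem_sphere, inner_smul_right,
    inner_smul_right, inner_sub_left]
  simp only [Real.norm_eq_abs, mul_one, sq_abs]
  ring

lemma vPost_add_wPost (v w u : E3) : vPost v w u + wPost v w u = v + w := by
  unfold vPost wPost; abel

lemma vPost_apply_add (v w u : E3) (i : Fin 3) :
    vPost v w u i + wPost v w u i = v i + w i := by
  have := congrArg (fun z : E3 => z i) (vPost_add_wPost v w u)
  simpa using this

lemma vPost_sub_wPost (v w u : E3) :
    vPost v w u - wPost v w u = (v - w) - (2 * inner ℝ (v - w) u) • u := by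
  unfold vPost wPost; module

/-- For fixed `s` a collision reflects the relative velocity in the plane orthogonal to `s`. The
sign change makes the collision map an involution and leaves the hard sphere weight invariant. -/
lemma inner_post (v w : E3) (s : S2) :
    inner ℝ (vPost v w s - wPost v w s) (s : E3) = - inner ℝ (v - w) (s : E3) := by
  rw [vPost_sub_wPost, inner_sub_left, inner_smul_left, sphere_inner_self]
  simp; ring

lemma vPost_post (v w : E3) (s : S2) : vPost (vPost v w s) (wPost v w s) s = v := by
  rw [vPost, inner_post, vPost]; module

lemma wPost_post (v w : E3) (s : S2) : wPost (vPost v w s) (wPost v w s) s = w := by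
  rw [wPost, inner_post, wPost]; module

lemma vPost_swap (v w u : E3) : vPost w v u = wPost v w u := by
  unfold vPost wPost
  rw [← neg_sub v w, inner_neg_left]; module

lemma wPost_swap (v w u : E3) : wPost w v u = vPost v w u := by
  unfold vPost wPost
  rw [← neg_sub v w, inner_neg_left]; module

lemma maxw_post (v w : E3) (s : S2) :
    maxw (vPost v w s) * maxw (wPost v w s) = maxw v * maxw w := by
  unfold maxw
  have h := norm_sq_post v w s
  rw [mul_mul_mul_comm, mul_mul_mul_comm _ (Real.exp (-‖v‖ ^ 2 / 2)), ← Real.exp_add, ← Real.exp_add]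
  congr 2
  linarith

lemma sqrtMaxw_post (v w : E3) (s : S2) :
    sqrtMaxw (vPost v w s) * sqrtMaxw (wPost v w s) = sqrtMaxw v * sqrtMaxw w := by
  unfold sqrtMaxw
  rw [← Real.sqrt_mul (maxw_pos _).le, maxw_post, Real.sqrt_mul (maxw_pos _).le]

lemma abs_inner_sphere_le (z : E3) (s : S2) : |inner ℝ z (s : E3)| ≤ ‖z‖ := by
  simpa [norm_eq_of_mem_sphere] using abs_real_inner_le_norm z (s : E3)

lemma one_add_norm_sub_le (v w : E3) : ‖v - w‖ ≤ (1 + ‖v‖) * (1 + ‖w‖) := by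
  nlinarith [norm_sub_le v w, norm_nonneg v, norm_nonneg w, mul_nonneg (norm_nonneg v) (norm_nonneg w)]

/-- The product form separates `v` from `w`: polynomial growth at a post-collisional velocity is
dominated by a power of `1 + |v|` times a power of `1 + |w|`, and `√μ(w)` absorbs the latter. -/
lemma one_add_norm_vPost_le (v w : E3) (s : S2) :
    1 + ‖vPost v w s‖ ≤ (1 + ‖v‖) * (1 + ‖w‖) := by
  have h : ‖vPost v w s‖ ≤ ‖v‖ + ‖w‖ := by
    apply abs_le_of_sq_le_sq' _ (by positivity) |>.2
    nlinarith [norm_sq_post v w s, sq_nonneg ‖wPost v w s‖, mul_nonneg (norm_nonneg v) (norm_nonneg w)]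
  nlinarith [mul_nonneg (norm_nonneg v) (norm_nonneg w)]

lemma one_add_norm_wPost_le (v w : E3) (s : S2) :
    1 + ‖wPost v w s‖ ≤ (1 + ‖v‖) * (1 + ‖w‖) := by
  rw [← vPost_swap, mul_comm]; exact one_add_norm_vPost_le w v s

@[fun_prop]
lemma continuous_vPost {X : Type*} [TopologicalSpace X] {f g h : X → E3} (hf : Continuous f)
    (hg : Continuous g) (hh : Continuous h) : Continuous fun x => vPost (f x) (g x) (h x) := by
  unfold vPost; fun_prop

@[fun_prop]
lemma continuous_wPost {X : Type*} [TopologicalSpace X] {f g h : X → E3} (hf : Continuous f)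
    (hg : Continuous g) (hh : Continuous h) : Continuous fun x => wPost (f x) (g x) (h x) := by
  unfold wPost; fun_prop

/-! ### Functions of moderate growth -/

/-- Measurable functions of the velocity with at most polynomial growth. -/
def ModGrowth (a : E3 → ℝ) : Prop :=
  Measurable a ∧ ∃ (C : ℝ) (N : ℕ), ∀ v, |a v| ≤ C * (1 + ‖v‖) ^ N

namespace ModGrowth

lemma of_bound {a : E3 → ℝ} (ha : Measurable a) (C : ℝ) (N : ℕ)
    (h : ∀ v, |a v| ≤ C * (1 + ‖v‖) ^ N) : ModGrowth a := ⟨ha, C, N, h⟩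

lemma exists_nonneg {a : E3 → ℝ} (ha : ModGrowth a) :
    ∃ (C : ℝ) (N : ℕ), 0 ≤ C ∧ ∀ v, |a v| ≤ C * (1 + ‖v‖) ^ N := by
  obtain ⟨_, C, N, h⟩ := ha
  exact ⟨|C|, N, abs_nonneg _, fun v => (h v).trans (by gcongr; exact le_abs_self C)⟩

lemma add {a b : E3 → ℝ} (ha : ModGrowth a) (hb : ModGrowth b) :
    ModGrowth fun v => a v + b v := by
  obtain ⟨C, N, hC, h⟩ := ha.exists_nonneg
  obtain ⟨D, K, hD, k⟩ := hb.exists_nonneg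
  refine ⟨ha.1.add hb.1, C + D, max N K, fun v => ?_⟩
  have h1 : (1 : ℝ) ≤ 1 + ‖v‖ := by linarith [norm_nonneg v]
  calc |a v + b v| ≤ |a v| + |b v| := abs_add_le _ _
    _ ≤ C * (1 + ‖v‖) ^ N + D * (1 + ‖v‖) ^ K := add_le_add (h v) (k v)
    _ ≤ C * (1 + ‖v‖) ^ max N K + D * (1 + ‖v‖) ^ max N K := by
        gcongr
        · exact le_max_left _ _
        · exact le_max_right _ _
    _ = _ := by ring

lemma mul {a b : E3 → ℝ} (ha : ModGrowth a) (hb : ModGrowth b) :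
    ModGrowth fun v => a v * b v := by
  obtain ⟨C, N, hC, h⟩ := ha.exists_nonneg
  obtain ⟨D, K, hD, k⟩ := hb.exists_nonneg
  refine ⟨ha.1.mul hb.1, C * D, N + K, fun v => ?_⟩
  rw [abs_mul]
  calc |a v| * |b v| ≤ (C * (1 + ‖v‖) ^ N) * (D * (1 + ‖v‖) ^ K) :=
        mul_le_mul (h v) (k v) (abs_nonneg _) (by positivity)
    _ = _ := by ring

lemma const (c : ℝ) : ModGrowth fun _ => c := ⟨measurable_const, |c|, 0, fun v => by simp⟩

lemma const_mul {a : E3 → ℝ} (c : ℝ) (ha : ModGrowth a) : ModGrowth fun v => c * a v :=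
  (const c).mul ha

lemma neg {a : E3 → ℝ} (ha : ModGrowth a) : ModGrowth fun v => - a v := by
  simpa using ha.const_mul (-1)

lemma sub {a b : E3 → ℝ} (ha : ModGrowth a) (hb : ModGrowth b) :
    ModGrowth fun v => a v - b v := by
  simpa [sub_eq_add_neg] using ha.add hb.neg

lemma sum {ι : Type*} {t : Finset ι} {a : ι → E3 → ℝ} (h : ∀ i ∈ t, ModGrowth (a i)) :
    ModGrowth fun v => ∑ i ∈ t, a i v := by
  classical
  induction t using Finset.induction_on with
  | empty => simpa using const 0
  | insert i t hi ih =>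
    simp only [Finset.sum_insert hi]
    exact (h i (by simp)).add (ih fun j hj => h j (by simp [hj]))

lemma coord (i : Fin 3) : ModGrowth fun v => v i := by
  refine ⟨by fun_prop, 1, 1, fun v => ?_⟩
  have := PiLp.norm_apply_le v i
  rw [Real.norm_eq_abs] at this
  simpa using this.trans (by linarith)

lemma norm : ModGrowth fun v => ‖v‖ :=
  ⟨by fun_prop, 1, 1, fun v => by simp⟩

lemma norm_sq : ModGrowth fun v => ‖v‖ ^ 2 := by simpa [sq] using norm.mul norm

lemma inner_left (a : E3) : ModGrowth fun v => inner ℝ a v := by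
  refine ⟨by fun_prop, ‖a‖, 1, fun v => (abs_real_inner_le_norm a v).trans ?_⟩
  nlinarith [norm_nonneg a, norm_nonneg v]

lemma sqrtMaxw' : ModGrowth sqrtMaxw :=
  ⟨continuous_sqrtMaxw.measurable, 1, 0, fun v => by
    rw [abs_of_pos (sqrtMaxw_pos v)]; simpa using sqrtMaxw_le_one v⟩

end ModGrowth

lemma integrable_one_add_norm_pow_mul_exp (N : ℕ) {c : ℝ} (hc : 0 < c) :
    Integrable fun v : E3 => (1 + ‖v‖) ^ N * Real.exp (-c * ‖v‖ ^ 2) := by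
  have h : Integrable ((fun r : ℝ => (1 + r) ^ N * Real.exp (-c * r ^ 2)) ∘ fun v : E3 => ‖v‖) := by
    refine (integrable_fun_norm_addHaar (volume : Measure E3)
      (f := fun r : ℝ => (1 + r) ^ N * Real.exp (-c * r ^ 2))).2 ?_
    have h2 : Integrable fun x : ℝ => (2 : ℝ) ^ (N - 1) * (x ^ (2 : ℝ) * Real.exp (-c * x ^ 2)
        + x ^ ((2 + N : ℕ) : ℝ) * Real.exp (-c * x ^ 2)) :=
      ((integrable_rpow_mul_exp_neg_mul_sq hc (by norm_num)).add
        (integrable_rpow_mul_exp_neg_mul_sq hc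
          (by have := Nat.cast_nonneg (α := ℝ) (2 + N); linarith))).const_mul _
    refine h2.integrableOn.mono' (by fun_prop) ?_
    filter_upwards [ae_restrict_mem measurableSet_Ioi] with x hx
    have hx : 0 < x := hx
    have h3 := add_pow_le zero_le_one hx.le N
    have hd : Module.finrank ℝ E3 - 1 = 2 := by simp
    rw [hd, Real.norm_of_nonneg (by positivity), smul_eq_mul, Real.rpow_natCast, Real.rpow_two]
    calc x ^ 2 * ((1 + x) ^ N * Real.exp (-c * x ^ 2))
        ≤ x ^ 2 * ((2 ^ (N - 1) * (1 ^ N + x ^ N)) * Real.exp (-c * x ^ 2)) := by gcongr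
      _ = _ := by rw [pow_add]; ring
  exact h

lemma ModGrowth.integrable_mul_sqrtMaxw {a : E3 → ℝ} (ha : ModGrowth a) :
    Integrable fun v => a v * sqrtMaxw v := by
  obtain ⟨C, N, hC, h⟩ := ha.exists_nonneg
  refine ((integrable_one_add_norm_pow_mul_exp N (c := 1 / 4) (by norm_num)).const_mul
    (C * Real.sqrt ((2 * Real.pi) ^ (-(3 / 2) : ℝ)))).mono'
    (ha.1.mul continuous_sqrtMaxw.measurable).aestronglyMeasurable (.of_forall fun v => ?_)
  rw [norm_mul, Real.norm_eq_abs, Real.norm_eq_abs, abs_of_pos (sqrtMaxw_pos v), sqrtMaxw_eq]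
  calc _ ≤ C * (1 + ‖v‖) ^ N * (Real.sqrt ((2 * Real.pi) ^ (-(3 / 2) : ℝ))
        * Real.exp (-(1 / 4) * ‖v‖ ^ 2)) := by gcongr; exact h v
    _ = _ := by ring

lemma ModGrowth.integrable_mul_maxw {a : E3 → ℝ} (ha : ModGrowth a) :
    Integrable fun v => a v * maxw v := by
  simpa only [mul_assoc, sqrtMaxw_mul_self] using (ha.mul .sqrtMaxw').integrable_mul_sqrtMaxw

lemma ModGrowth.memLp_mul_sqrtMaxw {a : E3 → ℝ} (ha : ModGrowth a) :
    MemLp (fun v => a v * sqrtMaxw v) 2 := by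
  refine (memLp_two_iff_integrable_sq
    (ha.1.mul continuous_sqrtMaxw.measurable).aestronglyMeasurable).2 ?_
  refine ((ha.mul ha).integrable_mul_maxw).congr (.of_forall fun v => ?_)
  simp only [Pi.mul_apply]
  rw [← sqrtMaxw_mul_self]; ring

/-! ### The collision integrals as integrals over `(w, s)` -/

/-- The integrand of `2 Γ(a,b)(v)`. -/
def gamKer (a b : E3 → ℝ) (v : E3) (p : E3 × S2) : ℝ :=
  |inner ℝ (v - p.1) (p.2 : E3)| * sqrtMaxw p.1 *
    (a (vPost v p.1 p.2) * b (wPost v p.1 p.2) + b (vPost v p.1 p.2) * a (wPost v p.1 p.2)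
      - a v * b p.1 - b v * a p.1)

/-- The measure `dw ds`. -/
def velSphere : Measure (E3 × S2) := (volume : Measure E3).prod sphereMeasure

instance : SFinite velSphere := by unfold velSphere; infer_instance

/-- Energy conservation gives `√μ(v')√μ(w') = √μ(v)√μ(w)`, so the prefactor `1/√μ(v)` cancels and
only `√μ(w)` remains. The identity holds for the integrands, hence for arbitrary `a` and `b`. -/
lemma gam_eq_iterated (a b : E3 → ℝ) (v : E3) :
    gam a b v = 1 / 2 * ∫ w : E3, ∫ s : S2, gamKer a b v (w, s) ∂sphereMeasure := by
  unfold gam collQ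
  rw [mul_left_comm, ← integral_const_mul]
  congr 2
  ext w
  rw [← integral_const_mul]
  congr 1
  ext s
  have h := sqrtMaxw_post v w s
  have hv := (sqrtMaxw_pos v).ne'
  have h1 : sqrtMaxw (vPost v w s) * a (vPost v w s) * (sqrtMaxw (wPost v w s) * b (wPost v w s))
      = sqrtMaxw v * sqrtMaxw w * (a (vPost v w s) * b (wPost v w s)) := by rw [← h]; ring
  have h2 : sqrtMaxw (vPost v w s) * b (vPost v w s) * (sqrtMaxw (wPost v w s) * a (wPost v w s))
      = sqrtMaxw v * sqrtMaxw w * (b (vPost v w s) * a (wPost v w s)) := by rw [← h]; ring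
  rw [h1, h2, gamKer]
  field_simp

lemma collQ_eq_gam (a b : E3 → ℝ) (v : E3) :
    collQ (fun w => sqrtMaxw w * a w) (fun w => sqrtMaxw w * b w) v = sqrtMaxw v * gam a b v := by
  have := (sqrtMaxw_pos v).ne'
  unfold gam; field_simp

/-- Because `μ = √μ · √μ`, the operator `L` is a slice of `Γ`; its linearity, covariance and
differentiability are inherited from `Γ`. -/
lemma linL_eq_gam (h : E3 → ℝ) (v : E3) : linL h v = -2 * gam sqrtMaxw h v := by
  have : maxw = fun w => sqrtMaxw w * sqrtMaxw w := by ext w; rw [sqrtMaxw_mul_self]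
  unfold linL gam
  rw [this]; ring

lemma gam_comm (a b : E3 → ℝ) (v : E3) : gam a b v = gam b a v := by
  rw [gam_eq_iterated, gam_eq_iterated]
  congr 3 with w
  congr 1 with s
  unfold gamKer; ring

/-- Absolute convergence of the integral defining `Γ(a,b)(v)`. -/
def GamInt (a b : E3 → ℝ) (v : E3) : Prop := Integrable (gamKer a b v) velSphere

lemma GamInt.gam_eq {a b : E3 → ℝ} {v : E3} (h : GamInt a b v) :
    gam a b v = 1 / 2 * ∫ p, gamKer a b v p ∂velSphere := by
  rw [gam_eq_iterated, velSphere, integral_prod _ h]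

lemma gamKer_comm (a b : E3 → ℝ) (v : E3) : gamKer a b v = gamKer b a v := by
  ext p; unfold gamKer; ring

lemma GamInt.symm {a b : E3 → ℝ} {v : E3} (h : GamInt a b v) : GamInt b a v := by
  unfold GamInt; rwa [gamKer_comm]

lemma gamKer_add_right (a b c : E3 → ℝ) (v : E3) :
    gamKer a (fun w => b w + c w) v = gamKer a b v + gamKer a c v := by
  ext p; simp only [gamKer, Pi.add_apply]; ring

lemma gamKer_const_mul_right (a b : E3 → ℝ) (c : ℝ) (v : E3) :
    gamKer a (fun w => c * b w) v = fun p => c * gamKer a b v p := by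
  ext p; simp only [gamKer]; ring

lemma GamInt.add_right {a b c : E3 → ℝ} {v : E3} (h : GamInt a b v) (k : GamInt a c v) :
    GamInt a (fun w => b w + c w) v := by
  unfold GamInt; rw [gamKer_add_right]; exact Integrable.add h k

lemma gam_add_right {a b c : E3 → ℝ} {v : E3} (h : GamInt a b v) (k : GamInt a c v) :
    gam a (fun w => b w + c w) v = gam a b v + gam a c v := by
  rw [(h.add_right k).gam_eq, h.gam_eq, k.gam_eq, gamKer_add_right]
  simp only [Pi.add_apply]
  rw [integral_add h k]; ring

lemma gam_const_mul_right (a b : E3 → ℝ) (c : ℝ) (v : E3) :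
    gam a (fun w => c * b w) v = c * gam a b v := by
  rw [gam_eq_iterated, gam_eq_iterated, gamKer_const_mul_right]
  simp only [integral_const_mul]; ring

lemma gam_add_left {a b c : E3 → ℝ} {v : E3} (h : GamInt b a v) (k : GamInt c a v) :
    gam (fun w => b w + c w) a v = gam b a v + gam c a v := by
  rw [gam_comm, gam_add_right h.symm k.symm, gam_comm a b, gam_comm a c]

lemma gam_const_mul_left (a b : E3 → ℝ) (c : ℝ) (v : E3) :
    gam (fun w => c * b w) a v = c * gam b a v := by
  rw [gam_comm, gam_const_mul_right, gam_comm]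

lemma linL_const_mul (h : E3 → ℝ) (c : ℝ) (v : E3) :
    linL (fun w => c * h w) v = c * linL h v := by
  rw [linL_eq_gam, linL_eq_gam, gam_const_mul_right]; ring

lemma linL_add {h k : E3 → ℝ} {v : E3} (hh : GamInt sqrtMaxw h v) (hk : GamInt sqrtMaxw k v) :
    linL (fun w => h w + k w) v = linL h v + linL k v := by
  rw [linL_eq_gam, linL_eq_gam, linL_eq_gam, gam_add_right hh hk]; ring

/-! ### Bounds for functions of moderate growth -/

lemma measurable_gamKer {a b : E3 → ℝ} (ha : Measurable a) (hb : Measurable b) :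
    Measurable fun q : E3 × (E3 × S2) => gamKer a b q.1 q.2 := by
  have h1 : Measurable fun q : E3 × (E3 × S2) => vPost q.1 q.2.1 q.2.2 :=
    (by fun_prop : Continuous _).measurable
  have h2 : Measurable fun q : E3 × (E3 × S2) => wPost q.1 q.2.1 q.2.2 :=
    (by fun_prop : Continuous _).measurable
  have h3 : Measurable fun q : E3 × (E3 × S2) =>
      |inner ℝ (q.1 - q.2.1) (q.2.2 : E3)| * sqrtMaxw q.2.1 :=
    (by fun_prop : Continuous _).measurable
  have h4 : Measurable fun q : E3 × (E3 × S2) => q.2.1 := by fun_prop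
  have h5 : Measurable fun q : E3 × (E3 × S2) => q.1 := by fun_prop
  unfold gamKer
  exact h3.mul (((((ha.comp h1).mul (hb.comp h2)).add ((hb.comp h1).mul (ha.comp h2))).sub
    ((ha.comp h5).mul (hb.comp h4))).sub ((hb.comp h5).mul (ha.comp h4)))

/-- All four velocities satisfy `1 + |·| ≤ R = (1 + |v|)(1 + |w|)`. The factor `4` counts the
products in the bracket, and the extra power in `N + K + 1` comes from `|(v-w)·s| ≤ R`. -/
lemma abs_gamKer_le {a b : E3 → ℝ} {C D : ℝ} {N K : ℕ} (hC : 0 ≤ C) (hD : 0 ≤ D)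
    (ha : ∀ v, |a v| ≤ C * (1 + ‖v‖) ^ N) (hb : ∀ v, |b v| ≤ D * (1 + ‖v‖) ^ K)
    (v : E3) (p : E3 × S2) :
    |gamKer a b v p| ≤ 4 * C * D * (1 + ‖v‖) ^ (N + K + 1)
      * ((1 + ‖p.1‖) ^ (N + K + 1) * sqrtMaxw p.1) := by
  obtain ⟨w, s⟩ := p
  set R := (1 + ‖v‖) * (1 + ‖w‖) with hR
  have hR1 : 0 ≤ R := by positivity
  have key : ∀ x y : E3, 1 + ‖x‖ ≤ R → 1 + ‖y‖ ≤ R → |a x * b y| ≤ C * D * R ^ (N + K) := by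
    intro x y hx hy
    rw [abs_mul]
    calc |a x| * |b y| ≤ (C * (1 + ‖x‖) ^ N) * (D * (1 + ‖y‖) ^ K) :=
          mul_le_mul (ha x) (hb y) (abs_nonneg _) (by positivity)
      _ ≤ (C * R ^ N) * (D * R ^ K) := by gcongr
      _ = _ := by ring
  have hv : 1 + ‖v‖ ≤ R := by nlinarith [norm_nonneg v, norm_nonneg w, mul_nonneg (norm_nonneg v) (norm_nonneg w)]
  have hw : 1 + ‖w‖ ≤ R := by nlinarith [norm_nonneg v, norm_nonneg w, mul_nonneg (norm_nonneg v) (norm_nonneg w)]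
  have e1 := key _ _ (one_add_norm_vPost_le v w s) (one_add_norm_wPost_le v w s)
  have e2 := key _ _ (one_add_norm_wPost_le v w s) (one_add_norm_vPost_le v w s)
  have e3 := key _ _ hv hw
  have e4 := key _ _ hw hv
  rw [abs_le] at e1 e2 e3 e4
  have e5 : |a (vPost v w s) * b (wPost v w s) + b (vPost v w s) * a (wPost v w s)
      - a v * b w - b v * a w| ≤ 4 * (C * D * R ^ (N + K)) := by
    rw [abs_le]; constructor <;> linarith [e1.1, e1.2, e2.1, e2.2, e3.1, e3.2, e4.1, e4.2]
  have e6 : |inner ℝ (v - w) (s : E3)| ≤ R :=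
    (abs_inner_sphere_le _ _).trans (one_add_norm_sub_le v w)
  rw [gamKer, abs_mul, abs_mul, abs_abs, abs_of_pos (sqrtMaxw_pos w)]
  calc _ ≤ R * sqrtMaxw w * (4 * (C * D * R ^ (N + K))) := by
        have := (sqrtMaxw_pos w).le
        gcongr
    _ = 4 * C * D * (R ^ (N + K + 1) * sqrtMaxw w) := by ring
    _ = _ := by simp only [hR, mul_pow]; ring

lemma integrable_weight (N : ℕ) :
    Integrable (fun p : E3 × S2 => (1 + ‖p.1‖) ^ N * sqrtMaxw p.1) velSphere := by
  have h : ModGrowth fun v => (1 + ‖v‖) ^ N :=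
    .of_bound (by fun_prop) 1 N fun v => by rw [abs_of_nonneg (by positivity), one_mul]
  exact h.integrable_mul_sqrtMaxw.comp_fst _

lemma ModGrowth.gamInt {a b : E3 → ℝ} (ha : ModGrowth a) (hb : ModGrowth b) (v : E3) :
    GamInt a b v := by
  obtain ⟨C, N, hC, h⟩ := ha.exists_nonneg
  obtain ⟨D, K, hD, k⟩ := hb.exists_nonneg
  exact ((integrable_weight (N + K + 1)).const_mul _).mono'
    ((measurable_gamKer ha.1 hb.1).comp measurable_prodMk_left).aestronglyMeasurable
    (.of_forall fun p => abs_gamKer_le hC hD h k v p)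

lemma ModGrowth.gam {a b : E3 → ℝ} (ha : ModGrowth a) (hb : ModGrowth b) :
    ModGrowth (gam a b) := by
  obtain ⟨C, N, hC, h⟩ := ha.exists_nonneg
  obtain ⟨D, K, hD, k⟩ := hb.exists_nonneg
  have e : HilbertExpansion.gam a b = fun v => 1 / 2 * ∫ p, gamKer a b v p ∂velSphere :=
    funext fun v => (ha.gamInt hb v).gam_eq
  rw [e]
  refine .const_mul _ (.of_bound ?_ (4 * C * D *
    ∫ p : E3 × S2, (1 + ‖p.1‖) ^ (N + K + 1) * sqrtMaxw p.1 ∂velSphere) (N + K + 1) fun v => ?_)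
  · exact ((measurable_gamKer ha.1 hb.1).stronglyMeasurable.integral_prod_right').measurable
  · calc |∫ p, gamKer a b v p ∂velSphere| ≤ ∫ p, 4 * C * D * (1 + ‖v‖) ^ (N + K + 1)
          * ((1 + ‖p.1‖) ^ (N + K + 1) * sqrtMaxw p.1) ∂velSphere :=
          norm_integral_le_of_norm_le (f := gamKer a b v)
            ((integrable_weight (N + K + 1)).const_mul _)
            (.of_forall fun p => abs_gamKer_le hC hD h k v p)
      _ = _ := by rw [integral_const_mul]; ring

/-! ### The collision measure and its symmetries -/

/-- The phase space of the triples `(v, w, s)`. -/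
abbrev Coll : Type := E3 × (E3 × S2)

/-- The measure `dv dw ds`. -/
def phaseMeasure : Measure Coll := (volume : Measure E3).prod velSphere

/-- The measure `|(v - w)·s| dv dw ds`. -/
def collMeasure : Measure Coll :=
  phaseMeasure.withDensity fun q => ENNReal.ofReal |inner ℝ (q.1 - q.2.1) (q.2.2 : E3)|

/-- The involution `(v, w, s) ↦ (v', w', s)`. -/
def collEquiv : Coll ≃ᵐ Coll where
  toFun q := (vPost q.1 q.2.1 q.2.2, wPost q.1 q.2.1 q.2.2, q.2.2)
  invFun q := (vPost q.1 q.2.1 q.2.2, wPost q.1 q.2.1 q.2.2, q.2.2)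
  left_inv q := by simp [vPost_post, wPost_post]
  right_inv q := by simp [vPost_post, wPost_post]
  measurable_toFun := (by simp only [Equiv.coe_fn_mk]; fun_prop : Continuous _).measurable
  measurable_invFun := (by
    simp only [Equiv.coe_fn_symm_mk]; fun_prop : Continuous _).measurable

/-- The involution `(v, w, s) ↦ (w, v, s)`. -/
def swapEquiv : Coll ≃ᵐ Coll where
  toFun q := (q.2.1, q.1, q.2.2)
  invFun q := (q.2.1, q.1, q.2.2)
  left_inv _ := rfl
  right_inv _ := rfl
  measurable_toFun := (by simp only [Equiv.coe_fn_mk]; fun_prop : Continuous _).measurable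
  measurable_invFun := (by
    simp only [Equiv.coe_fn_symm_mk]; fun_prop : Continuous _).measurable

lemma collEquiv_apply (q : Coll) :
    collEquiv q = (vPost q.1 q.2.1 q.2.2, wPost q.1 q.2.1 q.2.2, q.2.2) := rfl

lemma swapEquiv_apply (q : Coll) : swapEquiv q = (q.2.1, q.1, q.2.2) := rfl

lemma collEquiv_collEquiv (q : Coll) : collEquiv (collEquiv q) = q := collEquiv.left_inv q

lemma collEquiv_swapEquiv (q : Coll) : collEquiv (swapEquiv q) = swapEquiv (collEquiv q) := by
  rw [collEquiv_apply, swapEquiv_apply, swapEquiv_apply, collEquiv_apply]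
  simp only
  rw [vPost_swap q.1, wPost_swap q.1]

lemma measurePreserving_reflection (s : S2) :
    MeasurePreserving fun z : E3 => z - (2 * inner ℝ z (s : E3)) • (s : E3) := by
  -- The reflection in the plane orthogonal to `s` is minus the reflection in the line spanned by
  -- `s`.
  have h := ((Submodule.reflection (ℝ ∙ (s : E3))).trans
    (LinearIsometryEquiv.neg ℝ)).measurePreserving
  convert h using 1
  ext1 z
  simp only [LinearIsometryEquiv.coe_trans, Function.comp_apply, Submodule.reflection_singleton_apply,
    norm_eq_of_mem_sphere, LinearIsometryEquiv.coe_neg, real_inner_comm]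
  simp
  module

/-- With `z = v - w` as first variable, the collision is a shear `w ↦ w + (z·s)s` followed by a
reflection of `z`. Each factor preserves volume, so no Jacobian is computed. -/
lemma measurePreserving_post (s : S2) :
    MeasurePreserving (fun q : E3 × E3 => (vPost q.1 q.2 s, wPost q.1 q.2 s))
      ((volume : Measure E3).prod volume) ((volume : Measure E3).prod volume) := by
  have h1 := measurePreserving_sub_prod (volume : Measure E3) (volume : Measure E3)
  have h2 : MeasurePreserving (fun q : E3 × E3 => (q.1, q.2 + inner ℝ q.1 (s : E3) • (s : E3)))
      ((volume : Measure E3).prod volume) ((volume : Measure E3).prod volume) := by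
    refine (MeasurePreserving.id (volume : Measure E3)).skew_product
      (g := fun z w => w + inner ℝ z (s : E3) • (s : E3)) ?_ (.of_forall fun z => ?_)
    · exact (by unfold Function.uncurry; fun_prop : Continuous _).measurable
    · exact (measurePreserving_add_right _ _).map_eq
  have h3 := (measurePreserving_reflection s).prod (MeasurePreserving.id (volume : Measure E3))
  have h4 := measurePreserving_add_prod (volume : Measure E3) (volume : Measure E3)
  convert h4.comp (h3.comp (h2.comp h1)) using 1
  ext1 q
  simp only [Function.comp_apply, Prod.map_apply, id_eq, vPost, wPost, Prod.mk.injEq]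
  exact ⟨by module, trivial⟩

/-- With the sphere variable in front, a map of `(v, w)` that depends on `s` is a skew product over
the sphere. -/
lemma measurePreserving_rotate :
    MeasurePreserving (fun q : S2 × (E3 × E3) => ((q.2.1, q.2.2, q.1) : Coll))
      (sphereMeasure.prod ((volume : Measure E3).prod volume)) phaseMeasure := by
  unfold phaseMeasure velSphere
  exact (measurePreserving_prodAssoc _ _ _).comp Measure.measurePreserving_swap

lemma measurePreserving_rotate_symm :
    MeasurePreserving (fun q : Coll => ((q.2.2, q.1, q.2.1) : S2 × (E3 × E3)))
      phaseMeasure (sphereMeasure.prod ((volume : Measure E3).prod volume)) := by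
  unfold phaseMeasure velSphere
  exact Measure.measurePreserving_swap.comp
    ((measurePreserving_prodAssoc (volume : Measure E3) (volume : Measure E3)
      sphereMeasure).symm MeasurableEquiv.prodAssoc)

lemma measurePreserving_collEquiv_phase : MeasurePreserving collEquiv phaseMeasure phaseMeasure := by
  have h := (MeasurePreserving.id sphereMeasure).skew_product
    (g := fun (s : S2) (q : E3 × E3) => (vPost q.1 q.2 s, wPost q.1 q.2 s))
    (μc := (volume : Measure E3).prod volume) (μd := (volume : Measure E3).prod volume)
    (by exact (by unfold Function.uncurry; fun_prop : Continuous _).measurable)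
    (.of_forall fun s => (measurePreserving_post s).map_eq)
  exact measurePreserving_rotate.comp (h.comp measurePreserving_rotate_symm)

lemma measurePreserving_swapEquiv_phase : MeasurePreserving swapEquiv phaseMeasure phaseMeasure := by
  have h := (MeasurePreserving.id sphereMeasure).prod (Measure.measurePreserving_swap
    (μ := (volume : Measure E3)) (ν := (volume : Measure E3)))
  exact measurePreserving_rotate.comp (h.comp measurePreserving_rotate_symm)

lemma measurePreserving_withDensity {X : Type*} [MeasurableSpace X] {μ : Measure X} {T : X ≃ᵐ X}
    (hT : MeasurePreserving T μ μ) {f : X → ENNReal} (hf : Measurable f) (h : ∀ x, f (T x) = f x) :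
    MeasurePreserving T (μ.withDensity f) (μ.withDensity f) := by
  refine ⟨T.measurable, Measure.ext fun s hs => ?_⟩
  rw [Measure.map_apply T.measurable hs, withDensity_apply _ hs,
    withDensity_apply _ (T.measurable hs), ← hT.setLIntegral_comp_preimage hs hf]
  simp only [h]

lemma measurable_collWeight :
    Measurable fun q : Coll => ENNReal.ofReal |inner ℝ (q.1 - q.2.1) (q.2.2 : E3)| :=
  ENNReal.measurable_ofReal.comp (by fun_prop : Continuous fun q : Coll =>
    |inner ℝ (q.1 - q.2.1) (q.2.2 : E3)|).measurable

lemma measurePreserving_collEquiv : MeasurePreserving collEquiv collMeasure collMeasure := by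
  refine measurePreserving_withDensity measurePreserving_collEquiv_phase measurable_collWeight ?_
  intro q
  rw [collEquiv_apply, inner_post, abs_neg]

lemma measurePreserving_swapEquiv : MeasurePreserving swapEquiv collMeasure collMeasure := by
  refine measurePreserving_withDensity measurePreserving_swapEquiv_phase measurable_collWeight ?_
  intro q
  rw [swapEquiv_apply]
  simp only
  rw [← neg_sub, inner_neg_left, abs_neg]

lemma integrable_collMeasure_iff {g : Coll → ℝ} :
    Integrable g collMeasure ↔
      Integrable (fun q => |inner ℝ (q.1 - q.2.1) (q.2.2 : E3)| * g q) phaseMeasure := by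
  unfold collMeasure
  rw [integrable_withDensity_iff_integrable_smul' measurable_collWeight (by simp)]
  simp only [smul_eq_mul, ENNReal.toReal_ofReal (abs_nonneg _)]

lemma integral_collMeasure (g : Coll → ℝ) :
    ∫ q, g q ∂collMeasure = ∫ q, |inner ℝ (q.1 - q.2.1) (q.2.2 : E3)| * g q ∂phaseMeasure := by
  unfold collMeasure
  rw [integral_withDensity_eq_integral_toReal_smul measurable_collWeight (by simp)]
  simp only [smul_eq_mul, ENNReal.toReal_ofReal (abs_nonneg _)]

lemma integral_comp_collEquiv (g : Coll → ℝ) :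
    ∫ q, g (collEquiv q) ∂collMeasure = ∫ q, g q ∂collMeasure :=
  measurePreserving_collEquiv.integral_comp' g

lemma integral_comp_swapEquiv (g : Coll → ℝ) :
    ∫ q, g (swapEquiv q) ∂collMeasure = ∫ q, g q ∂collMeasure :=
  measurePreserving_swapEquiv.integral_comp' g

lemma integrable_comp_collEquiv {g : Coll → ℝ} (h : Integrable g collMeasure) :
    Integrable (fun q => g (collEquiv q)) collMeasure :=
  measurePreserving_collEquiv.integrable_comp_of_integrable h

/-- Fubini for the iterated integrals in the definition of `Γ`. -/
lemma integral_gam_mul {a b k : E3 → ℝ} {g : Coll → ℝ}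
    (hg : ∀ q : Coll, gamKer a b q.1 q.2 * k q.1
      = |inner ℝ (q.1 - q.2.1) (q.2.2 : E3)| * g q)
    (hi : Integrable g collMeasure) :
    ∫ v, gam a b v * k v = 1 / 2 * ∫ q, g q ∂collMeasure := by
  rw [integral_collMeasure]
  rw [integrable_collMeasure_iff] at hi
  simp only [← hg] at hi ⊢
  unfold phaseMeasure at hi ⊢
  rw [integral_prod _ hi, ← integral_const_mul]
  apply integral_congr_ae
  filter_upwards [hi.prod_right_ae] with v hv
  -- The slice is kept multiplied by `k v`: where `k v = 0` nothing is known about integrability of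
  -- `gamKer a b v` itself.
  have hv' : Integrable (fun p : E3 × S2 => gamKer a b v p * k v)
    ((volume : Measure E3).prod sphereMeasure) := hv
  rw [gam_eq_iterated, velSphere, integral_prod _ hv', mul_assoc, ← integral_mul_const]
  simp only [integral_mul_const]

/-! ### Collision invariants -/

lemma integrable_coll_of_bound {g : Coll → ℝ} (hg : Measurable g) (C : ℝ) (N : ℕ)
    (h : ∀ q, |g q| ≤ C * ((1 + ‖q.1‖) * (1 + ‖q.2.1‖)) ^ N * (sqrtMaxw q.1 * sqrtMaxw q.2.1)) :
    Integrable g collMeasure := by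
  rw [integrable_collMeasure_iff]
  have hw : Continuous fun q : Coll => |inner ℝ (q.1 - q.2.1) (q.2.2 : E3)| := by fun_prop
  have h1 : ModGrowth fun v => (1 + ‖v‖) ^ (N + 1) :=
    .of_bound (by fun_prop) 1 (N + 1) fun v => by rw [abs_of_nonneg (by positivity), one_mul]
  refine ((h1.integrable_mul_sqrtMaxw.mul_prod (integrable_weight (N + 1))).const_mul C).mono'
    (hw.measurable.mul hg).aestronglyMeasurable (.of_forall fun q => ?_)
  rw [norm_mul, Real.norm_eq_abs, Real.norm_eq_abs, abs_abs]
  calc _ ≤ ((1 + ‖q.1‖) * (1 + ‖q.2.1‖)) *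
        (C * ((1 + ‖q.1‖) * (1 + ‖q.2.1‖)) ^ N * (sqrtMaxw q.1 * sqrtMaxw q.2.1)) := by
        gcongr
        · exact (abs_inner_sphere_le _ _).trans (one_add_norm_sub_le _ _)
        · exact h q
    _ = _ := by simp only [mul_pow]; ring

/-- `ψ` is a collision invariant. -/
def CollInvariant (ψ : E3 → ℝ) : Prop :=
  ∀ (v w : E3) (s : S2), ψ (vPost v w s) + ψ (wPost v w s) = ψ v + ψ w

/-- Weak form of the collision operator. The collisional change of variables moves the gain term
onto `ψ(v')`, and the exchange of `v` and `w` symmetrizes the integral into one of `ψ(v') + ψ(w') -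
ψ(v) - ψ(w)`, which is zero. -/
lemma integral_gam_mul_collInvariant {a b ψ : E3 → ℝ} (ha : ModGrowth a) (hb : ModGrowth b)
    (hψ : ModGrowth ψ) (hinv : CollInvariant ψ) :
    ∫ v, gam a b v * (ψ v * sqrtMaxw v) = 0 := by
  set k : Coll → ℝ := fun q =>
    sqrtMaxw q.1 * sqrtMaxw q.2.1 * (a q.1 * b q.2.1 + b q.1 * a q.2.1) with hk
  have m1 : Measurable fun q : Coll => q.1 := by fun_prop
  have m2 : Measurable fun q : Coll => q.2.1 := by fun_prop
  have hkm : Measurable k :=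
    ((continuous_sqrtMaxw.measurable.comp m1).mul (continuous_sqrtMaxw.measurable.comp m2)).mul
      (((ha.1.comp m1).mul (hb.1.comp m2)).add ((hb.1.comp m1).mul (ha.1.comp m2)))
  have key : ∀ T : Coll → E3, Measurable T →
      (∀ q, 1 + ‖T q‖ ≤ (1 + ‖q.1‖) * (1 + ‖q.2.1‖)) →
      Integrable (fun q => k q * ψ (T q)) collMeasure := by
    intro T hT hle
    obtain ⟨A, N, hA, ha'⟩ := ha.exists_nonneg
    obtain ⟨B, K, hB, hb'⟩ := hb.exists_nonneg
    obtain ⟨D, J, hD, hψ'⟩ := hψ.exists_nonneg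
    refine integrable_coll_of_bound (hkm.mul (hψ.1.comp hT)) (2 * A * B * D) (N + K + J) fun q => ?_
    set R := (1 + ‖q.1‖) * (1 + ‖q.2.1‖) with hR
    have hv : 1 + ‖q.1‖ ≤ R := by
      nlinarith [norm_nonneg q.1, norm_nonneg q.2.1, mul_nonneg (norm_nonneg q.1) (norm_nonneg q.2.1)]
    have hw : 1 + ‖q.2.1‖ ≤ R := by
      nlinarith [norm_nonneg q.1, norm_nonneg q.2.1, mul_nonneg (norm_nonneg q.1) (norm_nonneg q.2.1)]
    have e : ∀ x y : E3, 1 + ‖x‖ ≤ R → 1 + ‖y‖ ≤ R → |a x * b y| ≤ A * B * R ^ (N + K) := by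
      intro x y hx hy
      rw [abs_mul]
      calc |a x| * |b y| ≤ (A * (1 + ‖x‖) ^ N) * (B * (1 + ‖y‖) ^ K) :=
            mul_le_mul (ha' x) (hb' y) (abs_nonneg _) (by positivity)
        _ ≤ (A * R ^ N) * (B * R ^ K) := by gcongr
        _ = _ := by ring
    have e1 : |a q.1 * b q.2.1 + b q.1 * a q.2.1| ≤ 2 * (A * B * R ^ (N + K)) := by
      have := abs_add_le (a q.1 * b q.2.1) (b q.1 * a q.2.1)
      have h2 := e _ _ hw hv
      rw [mul_comm (a q.2.1)] at h2
      linarith [e _ _ hv hw]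
    have e2 : |ψ (T q)| ≤ D * R ^ J := (hψ' _).trans (by gcongr; exact hle q)
    have hs1 := (sqrtMaxw_pos q.1).le
    have hs2 := (sqrtMaxw_pos q.2.1).le
    simp only [hk]
    rw [abs_mul, abs_mul, abs_of_nonneg (mul_nonneg hs1 hs2)]
    calc _ ≤ sqrtMaxw q.1 * sqrtMaxw q.2.1 * (2 * (A * B * R ^ (N + K))) * (D * R ^ J) := by gcongr
      _ = _ := by ring
  have mC : Measurable collEquiv := collEquiv.measurable
  have i1 := key (fun q => q.1) m1 fun q => by
    nlinarith [norm_nonneg q.1, norm_nonneg q.2.1, mul_nonneg (norm_nonneg q.1) (norm_nonneg q.2.1)]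
  have i2 := key (fun q => q.2.1) m2 fun q => by
    nlinarith [norm_nonneg q.1, norm_nonneg q.2.1, mul_nonneg (norm_nonneg q.1) (norm_nonneg q.2.1)]
  have i3 := key (fun q => (collEquiv q).1) (m1.comp mC) fun q => one_add_norm_vPost_le _ _ _
  have i4 := key (fun q => (collEquiv q).2.1) (m2.comp mC) fun q => one_add_norm_wPost_le _ _ _
  have i5 : Integrable (fun q => k (collEquiv q) * ψ q.1) collMeasure := by
    simpa only [collEquiv_collEquiv] using integrable_comp_collEquiv i3
  have hkS : ∀ q, k (swapEquiv q) = k q := fun q => by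
    simp only [hk, swapEquiv_apply]; ring
  have e1 : ∫ q, k (collEquiv q) * ψ q.1 ∂collMeasure
      = ∫ q, k q * ψ (collEquiv q).1 ∂collMeasure := by
    rw [← integral_comp_collEquiv]; simp only [collEquiv_collEquiv]
  have e2 : ∫ q, k q * ψ q.2.1 ∂collMeasure = ∫ q, k q * ψ q.1 ∂collMeasure := by
    rw [← integral_comp_swapEquiv]; simp only [hkS]; rfl
  have e3 : ∫ q, k q * ψ (collEquiv q).2.1 ∂collMeasure
      = ∫ q, k q * ψ (collEquiv q).1 ∂collMeasure := by
    rw [← integral_comp_swapEquiv]; simp only [hkS, collEquiv_swapEquiv]; rfl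
  have e4 : ∫ q, k q * ψ (collEquiv q).1 ∂collMeasure + ∫ q, k q * ψ (collEquiv q).2.1 ∂collMeasure
      = ∫ q, k q * ψ q.1 ∂collMeasure + ∫ q, k q * ψ q.2.1 ∂collMeasure := by
    rw [← integral_add i3 i4, ← integral_add i1 i2]
    congr 1 with q
    rw [← mul_add, ← mul_add, collEquiv_apply, hinv]
  rw [integral_gam_mul (g := fun q => k (collEquiv q) * ψ q.1 - k q * ψ q.1) _ (i5.sub i1),
    integral_sub i5 i1]
  · linarith
  · intro q
    simp only [hk, gamKer, collEquiv_apply, sqrtMaxw_post]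
    ring

/-! ### Self-adjointness of `L` -/

/-- The domain `{h ∈ L² : ν h ∈ L²}` of `L`. -/
def DomL (h : E3 → ℝ) : Prop := MemLp h 2 ∧ MemLp (fun v => collFreq v * h v) 2

lemma integrable_collFreq (v : E3) :
    Integrable (fun p : E3 × S2 => |inner ℝ (v - p.1) (p.2 : E3)| * maxw p.1) velSphere := by
  refine ((integrable_weight 1).const_mul (1 + ‖v‖)).mono'
    (by fun_prop : Continuous _).aestronglyMeasurable (.of_forall fun p => ?_)
  rw [norm_mul, Real.norm_eq_abs, Real.norm_eq_abs, abs_abs, abs_of_pos (maxw_pos _),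
    ← sqrtMaxw_mul_self]
  have h1 : |inner ℝ (v - p.1) (p.2 : E3)| ≤ (1 + ‖v‖) * (1 + ‖p.1‖) :=
    (abs_inner_sphere_le _ _).trans (one_add_norm_sub_le _ _)
  have h2 := (sqrtMaxw_pos p.1).le
  have h3 := sqrtMaxw_le_one p.1
  calc _ ≤ ((1 + ‖v‖) * (1 + ‖p.1‖)) * (sqrtMaxw p.1 * 1) := by gcongr
    _ = _ := by ring

lemma collFreq_eq (v : E3) :
    collFreq v = ∫ p, |inner ℝ (v - p.1) (p.2 : E3)| * maxw p.1 ∂velSphere := by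
  rw [collFreq, velSphere, integral_prod _ (integrable_collFreq v)]

lemma collFreq_nonneg (v : E3) : 0 ≤ collFreq v := by
  rw [collFreq_eq]
  exact integral_nonneg fun p => mul_nonneg (abs_nonneg _) (maxw_pos _).le

lemma collFreq_le (v : E3) :
    collFreq v ≤ (∫ p : E3 × S2, (1 + ‖p.1‖) ^ 1 * sqrtMaxw p.1 ∂velSphere) * (1 + ‖v‖) ^ 1 := by
  rw [collFreq_eq, ← integral_mul_const]
  refine integral_mono (integrable_collFreq v) ((integrable_weight 1).mul_const _) fun p => ?_
  have h1 : |inner ℝ (v - p.1) (p.2 : E3)| ≤ (1 + ‖v‖) * (1 + ‖p.1‖) :=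
    (abs_inner_sphere_le _ _).trans (one_add_norm_sub_le _ _)
  have h2 := (sqrtMaxw_pos p.1).le
  have h3 := sqrtMaxw_le_one p.1
  simp only [← sqrtMaxw_mul_self]
  calc _ ≤ ((1 + ‖v‖) * (1 + ‖p.1‖)) * (sqrtMaxw p.1 * 1) := by gcongr
    _ = _ := by ring

lemma ModGrowth.collFreq' : ModGrowth collFreq := by
  refine .of_bound ?_ _ 1 fun v => by rw [abs_of_nonneg (collFreq_nonneg v)]; exact collFreq_le v
  have e : collFreq = fun v => ∫ p, |inner ℝ (v - p.1) (p.2 : E3)| * HilbertExpansion.maxw p.1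
    ∂velSphere := funext collFreq_eq
  rw [e]
  have : Continuous fun q : Coll =>
    |inner ℝ (q.1 - q.2.1) (q.2.2 : E3)| * HilbertExpansion.maxw q.2.1 := by fun_prop
  exact this.stronglyMeasurable.integral_prod_right'.measurable

lemma ModGrowth.domL_mul_sqrtMaxw {a : E3 → ℝ} (ha : ModGrowth a) :
    DomL fun v => a v * HilbertExpansion.sqrtMaxw v := by
  refine ⟨ha.memLp_mul_sqrtMaxw, ?_⟩
  simpa only [mul_assoc] using (ModGrowth.collFreq'.mul ha).memLp_mul_sqrtMaxw

lemma aesm_comp_fst {h : E3 → ℝ} (hh : AEStronglyMeasurable h) :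
    AEStronglyMeasurable (fun q : Coll => h q.1) collMeasure := by
  have : AEStronglyMeasurable (fun q : Coll => h q.1) phaseMeasure := hh.comp_fst
  exact this.mono_ac (withDensity_absolutelyContinuous _ _)

/-- Integrating out `(w, s)` turns the squared norm into `∫ ν h²`, finite as the pairing of `ν h`
with `h`. This is where the condition `ν h ∈ L²` enters. -/
lemma DomL.memLp_coll {h : E3 → ℝ} (hh : DomL h) :
    MemLp (fun q : Coll => sqrtMaxw q.2.1 * h q.1) 2 collMeasure := by
  have m : AEStronglyMeasurable (fun q : Coll => sqrtMaxw q.2.1 * h q.1) collMeasure :=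
    (by fun_prop : Continuous fun q : Coll => sqrtMaxw q.2.1).aestronglyMeasurable.mul
      (aesm_comp_fst hh.1.1)
  rw [memLp_two_iff_integrable_sq m, integrable_collMeasure_iff]
  have e : (fun q : Coll => |inner ℝ (q.1 - q.2.1) (q.2.2 : E3)| * (sqrtMaxw q.2.1 * h q.1) ^ 2)
      = fun q : Coll => (|inner ℝ (q.1 - q.2.1) (q.2.2 : E3)| * maxw q.2.1) * h q.1 ^ 2 := by
    ext q; rw [← sqrtMaxw_mul_self]; ring
  rw [e, phaseMeasure, integrable_prod_iff]
  · refine ⟨.of_forall fun v => (integrable_collFreq v).mul_const (h v ^ 2), ?_⟩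
    have e2 : (fun v => ∫ p : E3 × S2, ‖|inner ℝ (v - p.1) (p.2 : E3)| * maxw p.1 * h v ^ 2‖
        ∂velSphere) = fun v => (collFreq v * h v) * h v := by
      ext v
      simp only [norm_mul, Real.norm_eq_abs, abs_abs, abs_of_pos (maxw_pos _), abs_pow, sq_abs]
      rw [integral_mul_const, ← collFreq_eq]; ring
    rw [e2]
    exact hh.2.integrable_mul hh.1
  · have h1 : AEStronglyMeasurable (fun q : Coll => h q.1)
      ((volume : Measure E3).prod velSphere) := hh.1.1.comp_fst
    exact (by fun_prop : Continuous fun q : Coll =>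
      |inner ℝ (q.1 - q.2.1) (q.2.2 : E3)| * maxw q.2.1).aestronglyMeasurable.mul (h1.pow 2)

/-- `√μ(v) h(w) + √μ(w) h(v)`. -/
def symTensor (h : E3 → ℝ) (q : Coll) : ℝ := sqrtMaxw q.2.1 * h q.1 + sqrtMaxw q.1 * h q.2.1

lemma DomL.memLp_symTensor {h : E3 → ℝ} (hh : DomL h) : MemLp (symTensor h) 2 collMeasure := by
  have h2 : MemLp (fun q : Coll => sqrtMaxw q.1 * h q.2.1) 2 collMeasure := by
    have := hh.memLp_coll.comp_measurePreserving measurePreserving_swapEquiv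
    simpa only [Function.comp_def, swapEquiv_apply] using this
  exact hh.memLp_coll.add h2

/-- The Dirichlet form of `L`. -/
lemma DomL.pair_linL {h k : E3 → ℝ} (hh : DomL h) (hk : DomL k) :
    pair (linL h) k = 1 / 2 * (∫ q, symTensor h q * symTensor k q ∂collMeasure
      - ∫ q, symTensor h (collEquiv q) * symTensor k q ∂collMeasure) := by
  set r : Coll → ℝ := fun q => sqrtMaxw q.2.1 * k q.1 with hr
  have hC : MemLp (fun q => symTensor h (collEquiv q)) 2 collMeasure :=
    hh.memLp_symTensor.comp_measurePreserving measurePreserving_collEquiv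
  have hrL : MemLp r 2 collMeasure := hk.memLp_coll
  have hrS : MemLp (fun q => r (swapEquiv q)) 2 collMeasure :=
    hrL.comp_measurePreserving measurePreserving_swapEquiv
  have i1 : Integrable (fun q => symTensor h q * r q) collMeasure :=
    hh.memLp_symTensor.integrable_mul hrL
  have i2 : Integrable (fun q => symTensor h (collEquiv q) * r q) collMeasure :=
    hC.integrable_mul hrL
  have i3 : Integrable (fun q => symTensor h q * r (swapEquiv q)) collMeasure :=
    hh.memLp_symTensor.integrable_mul hrS
  have i4 : Integrable (fun q => symTensor h (collEquiv q) * r (swapEquiv q)) collMeasure :=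
    hC.integrable_mul hrS
  have hS : ∀ q, symTensor h (swapEquiv q) = symTensor h q := fun q => by
    simp only [symTensor, swapEquiv_apply]; ring
  have hSk : ∀ q, symTensor k q = r q + r (swapEquiv q) := fun q => by
    simp only [symTensor, hr, swapEquiv_apply]
  have e1 : ∫ q, symTensor h q * r (swapEquiv q) ∂collMeasure
      = ∫ q, symTensor h q * r q ∂collMeasure := by
    rw [← integral_comp_swapEquiv]; simp only [hS]; rfl
  have e2 : ∫ q, symTensor h (collEquiv q) * r (swapEquiv q) ∂collMeasure
      = ∫ q, symTensor h (collEquiv q) * r q ∂collMeasure := by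
    rw [← integral_comp_swapEquiv]; simp only [collEquiv_swapEquiv, hS]; rfl
  have e3 : pair (linL h) k = -2 * ∫ v, gam sqrtMaxw h v * k v := by
    rw [pair, ← integral_const_mul]; congr 1 with v; rw [linL_eq_gam]; ring
  rw [e3, integral_gam_mul (g := fun q => symTensor h (collEquiv q) * r q - symTensor h q * r q)
    _ (i2.sub i1), integral_sub i2 i1]
  -- By the exchange symmetry the integrals against `r` and against `r ∘ swapEquiv` agree, so each
  -- is half of the integral against `symTensor k`.
  · simp only [hSk, mul_add]
    rw [integral_add i1 i3, integral_add i2 i4, e1, e2]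
    ring
  · intro q
    simp only [hr, gamKer, symTensor, collEquiv_apply]
    ring

lemma pair_comm (f g : E3 → ℝ) : pair f g = pair g f := by
  unfold pair; congr 1 with v; ring

/-- In the Dirichlet form only the mixed term is not visibly symmetric; it is, because the collision
map is a measure preserving involution. -/
lemma DomL.pair_linL_comm {h k : E3 → ℝ} (hh : DomL h) (hk : DomL k) :
    pair (linL h) k = pair h (linL k) := by
  rw [pair_comm h, hh.pair_linL hk, hk.pair_linL hh]
  have : ∫ q, symTensor h (collEquiv q) * symTensor k q ∂collMeasure
      = ∫ q, symTensor k (collEquiv q) * symTensor h q ∂collMeasure := by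
    rw [← integral_comp_collEquiv]
    simp only [collEquiv_collEquiv, mul_comm]
  rw [this]
  simp only [mul_comm]

section

open scoped Pointwise

/-! ### Isometries acting on the sphere -/

/-- The action of a linear isometry on the unit sphere. -/
def sphereEquiv (R : E3 ≃ₗᵢ[ℝ] E3) : S2 ≃ᵐ S2 where
  toFun s := ⟨R s, by simp⟩
  invFun s := ⟨R.symm s, by simp⟩
  left_inv s := by simp
  right_inv s := by simp
  measurable_toFun := by
    simp only [Equiv.coe_fn_mk]
    exact (Continuous.subtype_mk (by fun_prop) _).measurable
  measurable_invFun := by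
    simp only [Equiv.coe_fn_symm_mk]
    exact (Continuous.subtype_mk (by fun_prop) _).measurable

lemma coe_sphereEquiv (R : E3 ≃ₗᵢ[ℝ] E3) (s : S2) : (sphereEquiv R s : E3) = R s := rfl

/-- The surface measure of `t` is a multiple of the volume of the cone over `t`, and a linear
isometry carries cones to cones and preserves volume. -/
lemma measurePreserving_sphereEquiv (R : E3 ≃ₗᵢ[ℝ] E3) :
    MeasurePreserving (sphereEquiv R) sphereMeasure sphereMeasure := by
  refine ⟨(sphereEquiv R).measurable, Measure.ext fun t ht => ?_⟩
  rw [Measure.map_apply (sphereEquiv R).measurable ht, sphereMeasure, Measure.toSphere_apply' _ ht,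
    Measure.toSphere_apply' _ ((sphereEquiv R).measurable ht)]
  congr 1
  have e : Ioo (0 : ℝ) 1 • ((↑) '' (sphereEquiv R ⁻¹' t) : Set E3)
      = R ⁻¹' (Ioo (0 : ℝ) 1 • ((↑) '' t : Set E3)) := by
    ext x
    simp only [Set.mem_smul, mem_image, mem_preimage]
    constructor
    · rintro ⟨r, hr, _, ⟨s, hs, rfl⟩, rfl⟩
      exact ⟨r, hr, _, ⟨_, hs, rfl⟩, by simp [coe_sphereEquiv]⟩
    · rintro ⟨r, hr, _, ⟨s, hs, rfl⟩, h⟩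
      refine ⟨r, hr, _, ⟨(sphereEquiv R).symm s, by simpa using hs, rfl⟩, ?_⟩
      apply R.injective
      rw [← h, map_smul]
      congr 1
      exact congrArg Subtype.val ((sphereEquiv R).apply_symm_apply s)
  rw [e]
  have := R.measurePreserving.measure_preimage_equiv (f := R.toMeasurableEquiv)
    (Ioo (0 : ℝ) 1 • ((↑) '' t : Set E3))
  exact this

/-! ### Averaging over the orthogonal group -/

/-- The orthogonal group of `E3`. -/
abbrev O3 : Type := unitary (E3 →L[ℝ] E3)

instance : ContinuousStar (E3 →L[ℝ] E3) :=
  ⟨(ContinuousLinearMap.adjoint (𝕜 := ℝ) (E := E3) (F := E3)).continuous⟩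

instance : MeasurableSpace O3 := borel O3

instance : BorelSpace O3 := ⟨rfl⟩

/-- The isometry of `E3` given by an element of the orthogonal group. -/
abbrev O3.iso (R : O3) : E3 ≃ₗᵢ[ℝ] E3 := Unitary.linearIsometryEquiv R

instance : CompactSpace O3 := by
  refine isCompact_iff_compactSpace.1 ?_
  refine Metric.isCompact_of_isClosed_isBounded isClosed_unitary ?_
  refine (Metric.isBounded_iff_subset_closedBall 0).2 ⟨1, fun R hR => ?_⟩
  rw [mem_closedBall_zero_iff]
  refine ContinuousLinearMap.opNorm_le_bound _ zero_le_one fun x => ?_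
  have := (Unitary.linearIsometryEquiv (⟨R, hR⟩ : O3)).norm_map x
  rw [one_mul]
  exact this.le

instance : SecondCountableTopology O3 := inferInstanceAs (SecondCountableTopology (Subtype _))

/-- A right-invariant measure on the orthogonal group. -/
def haarO3 : Measure O3 := (Measure.haar : Measure O3).inv

instance : haarO3.IsMulRightInvariant := by unfold haarO3; infer_instance

instance : IsFiniteMeasure haarO3 := by
  unfold haarO3 Measure.inv; infer_instance

lemma haarO3_univ_ne_zero : haarO3 univ ≠ 0 := by
  rw [haarO3, Measure.inv_apply, Set.inv_univ]
  exact isOpen_univ.measure_ne_zero _ univ_nonempty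

lemma exists_iso_apply_eq {x y : E3} (h : ‖x‖ = ‖y‖) : ∃ R : O3, R.iso x = y := by
  refine ⟨Unitary.linearIsometryEquiv.symm (Submodule.reflection (ℝ ∙ (x - y))ᗮ), ?_⟩
  simp only [O3.iso, MulEquiv.apply_symm_apply]
  exact Submodule.reflection_sub h

lemma continuous_iso_apply : Continuous fun q : O3 × E3 => q.1.iso q.2 := by
  show Continuous fun q : O3 × E3 => (q.1 : E3 →L[ℝ] E3) q.2
  fun_prop

/-- If `Q x = y`, the right translation `R ↦ R Q` turns `R x` into `R y`. This is why the measure on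
the group is taken right-invariant. -/
lemma lintegral_iso_eq {F : E3 → ENNReal} {x y : E3} (h : ‖x‖ = ‖y‖) :
    ∫⁻ R : O3, F (R.iso x) ∂haarO3 = ∫⁻ R : O3, F (R.iso y) ∂haarO3 := by
  obtain ⟨Q, hQ⟩ := exists_iso_apply_eq h
  rw [← lintegral_mul_right_eq_self (fun R : O3 => F (R.iso x)) Q]
  congr 1 with R
  congr 1
  simp only [O3.iso, map_mul] at hQ ⊢
  rw [← hQ]; rfl

/-- The surface measure is the image of Haar measure under `R ↦ R e`. -/
lemma lintegral_sphere_eq {F : E3 → ENNReal} (hF : Measurable F) {e : E3} (he : ‖e‖ = 1) :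
    haarO3 univ * ∫⁻ s : S2, F s ∂sphereMeasure
      = sphereMeasure univ * ∫⁻ R : O3, F (R.iso e) ∂haarO3 := by
  -- The rotation invariance of the surface measure is averaged over the group. After exchanging the
  -- integrals, transitivity makes the group integral independent of `s`.
  have h1 : ∀ R : O3, ∫⁻ s : S2, F s ∂sphereMeasure = ∫⁻ s : S2, F (R.iso s) ∂sphereMeasure := by
    intro R
    exact ((measurePreserving_sphereEquiv R.iso).lintegral_comp
      (hF.comp measurable_subtype_coe)).symm
  have h2 : ∫⁻ R : O3, ∫⁻ s : S2, F (R.iso s) ∂sphereMeasure ∂haarO3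
      = ∫⁻ s : S2, ∫⁻ R : O3, F (R.iso s) ∂haarO3 ∂sphereMeasure := by
    refine lintegral_lintegral_swap ?_
    have : Continuous fun q : O3 × S2 => q.1.iso (q.2 : E3) :=
      continuous_iso_apply.comp (by fun_prop : Continuous fun q : O3 × S2 => (q.1, (q.2 : E3)))
    exact (hF.comp this.measurable).aemeasurable
  have h3 : ∀ s : S2, ∫⁻ R : O3, F (R.iso s) ∂haarO3 = ∫⁻ R : O3, F (R.iso e) ∂haarO3 :=
    fun s => lintegral_iso_eq (by rw [he, norm_eq_of_mem_sphere])
  simp only [← h1, h3, lintegral_const] at h2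
  rw [mul_comm, h2, mul_comm]

/-- Integration over the sphere of an equivariant configuration. -/
lemma lintegral_sphere_equivariant {Φ : E3 → E3 → ENNReal} {τ : E3 → E3 → E3}
    (hΦ : Measurable fun q : E3 × E3 => Φ q.1 q.2) (hτ : Measurable fun q : E3 × E3 => τ q.1 q.2)
    (hΦR : ∀ (R : E3 ≃ₗᵢ[ℝ] E3) z s, Φ (R z) (R s) = Φ z s)
    (hτR : ∀ (R : E3 ≃ₗᵢ[ℝ] E3) z s, τ (R z) (R s) = R (τ z s))
    {H : E3 → ENNReal} (hH : Measurable H) {e : E3} (he : ‖e‖ = 1) :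
    ∫⁻ s : S2, (∫⁻ z, Φ z s * H (τ z s)) ∂sphereMeasure
      = ∫⁻ z, Φ z e * ∫⁻ s : S2, H (‖τ z e‖ • (s : E3)) ∂sphereMeasure := by
  have h0 : haarO3 univ ≠ 0 := haarO3_univ_ne_zero
  have ht : haarO3 univ ≠ ⊤ := measure_ne_top _ _
  have hF : Measurable fun s : E3 => ∫⁻ z, Φ z s * H (τ z s) :=
    Measurable.lintegral_prod_left' (f := fun q : E3 × E3 => Φ q.1 q.2 * H (τ q.1 q.2))
      (hΦ.mul (hH.comp hτ))
  have h1 := lintegral_sphere_eq hF he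
  -- The substitution `z ↦ R z` moves the rotation from the pole into the argument of `H`; the group
  -- average of `H (R y)` is then read back (`h4`) as an average over the sphere of radius `‖y‖`.
  have h2 : ∀ R : O3, ∫⁻ z, Φ z (R.iso e) * H (τ z (R.iso e))
      = ∫⁻ z, Φ z e * H (R.iso (τ z e)) := by
    intro R
    rw [← R.iso.measurePreserving.lintegral_comp]
    · simp only [hΦR, hτR]
    · exact (hΦ.mul (hH.comp hτ)).comp measurable_prodMk_right
  have h3 : ∫⁻ R : O3, (∫⁻ z, Φ z e * H (R.iso (τ z e))) ∂haarO3
      = ∫⁻ z, Φ z e * ∫⁻ R : O3, H (R.iso (τ z e)) ∂haarO3 := by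
    rw [lintegral_lintegral_swap]
    · refine lintegral_congr fun z => ?_
      rw [lintegral_const_mul]
      exact hH.comp ((continuous_iso_apply.comp
        (by fun_prop : Continuous fun R : O3 => (R, τ z e))).measurable)
    · refine ((hΦ.comp (by fun_prop : Measurable fun q : O3 × E3 => (q.2, e))).mul
        (hH.comp (continuous_iso_apply.measurable.comp (?_ : Measurable
          fun q : O3 × E3 => (q.1, τ q.2 e))))).aemeasurable
      exact measurable_fst.prodMk (hτ.comp (by fun_prop : Measurable fun q : O3 × E3 => (q.2, e)))
  have h4 : ∀ y : E3, sphereMeasure univ * ∫⁻ R : O3, H (R.iso y) ∂haarO3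
      = haarO3 univ * ∫⁻ s : S2, H (‖y‖ • (s : E3)) ∂sphereMeasure := by
    intro y
    rw [lintegral_sphere_eq (F := fun x => H (‖y‖ • x))
      (hH.comp (by fun_prop : Measurable fun x : E3 => ‖y‖ • x)) he]
    congr 1
    rw [lintegral_iso_eq (x := y) (y := ‖y‖ • e) (by simp [norm_smul, he])]
    simp only [map_smul]
  simp only [h2] at h1
  rw [h3, ← lintegral_const_mul' _ _ (measure_ne_top sphereMeasure univ)] at h1
  simp only [mul_left_comm (sphereMeasure univ), h4] at h1
  simp only [mul_left_comm _ (haarO3 univ)] at h1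
  rw [lintegral_const_mul' _ _ ht] at h1
  exact (ENNReal.mul_right_inj h0 ht).1 h1

/-! ### Polar coordinates -/

lemma lintegral_polar {H : E3 → ENNReal} (hH : Measurable H) :
    ∫⁻ y, H y = ∫⁻ r in Ioi (0 : ℝ), ENNReal.ofReal (r ^ 2)
      * ∫⁻ s : S2, H (r • (s : E3)) ∂sphereMeasure := by
  have h := (volume : Measure E3).measurePreserving_homeomorphUnitSphereProd
  have hd : Module.finrank ℝ E3 - 1 = 2 := by simp
  rw [hd] at h
  have hG : Measurable fun p : S2 × Ioi (0 : ℝ) => H ((p.2 : ℝ) • (p.1 : E3)) :=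
    hH.comp (by fun_prop)
  have h1 := h.lintegral_comp hG
  have h2 : ∀ y : ({0}ᶜ : Set E3), H (((homeomorphUnitSphereProd E3 y).2 : ℝ) •
      ((homeomorphUnitSphereProd E3 y).1 : E3)) = H y := by
    intro y
    congr 1
    exact congrArg Subtype.val ((homeomorphUnitSphereProd E3).symm_apply_apply y)
  simp only [h2] at h1
  rw [lintegral_subtype_comap (measurableSet_singleton _).compl H,
    restrict_compl_singleton] at h1
  rw [h1, lintegral_prod_symm _ hG.aemeasurable, Measure.volumeIoiPow,
    lintegral_withDensity_eq_lintegral_mul]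
  · rw [← lintegral_subtype_comap measurableSet_Ioi]
    rfl
  · exact (by fun_prop)
  · exact hG.lintegral_prod_left'

lemma lintegral_E3_coord {f : E3 → ENNReal} (hf : Measurable f) :
    ∫⁻ z, f z = ∫⁻ a : ℝ, ∫⁻ p : ℝ × ℝ, f !₂[a, p.1, p.2] := by
  have h1 := (EuclideanSpace.volume_preserving_symm_measurableEquiv_toLp (Fin 3)).symm
  have h2 := (volume_preserving_piFinSuccAbove (fun _ : Fin 3 => ℝ) 0).symm
  have h3 := (MeasurePreserving.id (volume : Measure ℝ)).prod (volume_preserving_finTwoArrow ℝ).symm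
  have h := h1.comp (h2.comp h3)
  rw [← h.lintegral_comp hf, lintegral_prod]
  · refine lintegral_congr fun a => lintegral_congr fun p => ?_
    congr 1
    ext i
    fin_cases i <;> rfl
  · exact (hf.comp h.measurable).aemeasurable

lemma lintegral_radial_plane {q : ℝ → ENNReal} (hq : Measurable q) :
    ∫⁻ p : ℝ × ℝ, q (Real.sqrt (p.1 ^ 2 + p.2 ^ 2))
      = ENNReal.ofReal (2 * Real.pi) * ∫⁻ r in Ioi (0 : ℝ), ENNReal.ofReal r * q r := by
  rw [← lintegral_comp_polarCoord_symm]
  have h : ∀ p ∈ polarCoord.target, ENNReal.ofReal p.1 • q (Real.sqrt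
      ((polarCoord.symm p).1 ^ 2 + (polarCoord.symm p).2 ^ 2)) = ENNReal.ofReal p.1 * q p.1 := by
    intro p hp
    have hp1 : 0 < p.1 := hp.1
    rw [smul_eq_mul, polarCoord_symm_apply]
    congr 2
    rw [show (p.1 * Real.cos p.2) ^ 2 + (p.1 * Real.sin p.2) ^ 2 = p.1 ^ 2 by
      rw [mul_pow, mul_pow, ← mul_add, Real.cos_sq_add_sin_sq, mul_one]]
    exact Real.sqrt_sq hp1.le
  rw [setLIntegral_congr_fun polarCoord.open_target.measurableSet h, polarCoord_target,
    Measure.volume_eq_prod, ← Measure.prod_restrict, lintegral_prod _ ?_]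
  · simp only [lintegral_const, Measure.restrict_apply MeasurableSet.univ, univ_inter,
      Real.volume_Ioo]
    rw [lintegral_mul_const' _ _ ENNReal.ofReal_ne_top, mul_comm]
    congr 2; ring
  · exact ((ENNReal.measurable_ofReal.comp measurable_fst).mul (hq.comp measurable_fst)).aemeasurable

end

/-! ### Pointwise convergence of the gain term for square integrable functions -/

/-- The mean of `H` over the sphere of radius `r`, up to the factor `4π`. -/
def sphereSum (H : E3 → ENNReal) (r : ℝ) : ENNReal := ∫⁻ s : S2, H (r • (s : E3)) ∂sphereMeasure

lemma measurable_sphereSum {H : E3 → ENNReal} (hH : Measurable H) : Measurable (sphereSum H) :=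
  Measurable.lintegral_prod_right' (f := fun q : ℝ × S2 => H (q.1 • (q.2 : E3)))
    (hH.comp (by fun_prop))

lemma lintegral_inv_norm_exp {H : E3 → ENNReal} (hH : Measurable H) (c : ℝ) :
    ∫⁻ y, ENNReal.ofReal (‖y‖⁻¹ * Real.exp (-c * ‖y‖ ^ 2)) * H y
      = ∫⁻ r in Ioi (0 : ℝ), ENNReal.ofReal (r * Real.exp (-c * r ^ 2)) * sphereSum H r := by
  rw [lintegral_polar (by fun_prop)]
  refine setLIntegral_congr_fun measurableSet_Ioi fun r hr => ?_
  have hr : 0 < r := hr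
  simp only [norm_smul, norm_eq_of_mem_sphere, Real.norm_eq_abs, abs_of_pos hr, mul_one]
  rw [lintegral_const_mul' _ _ ENNReal.ofReal_ne_top, ← mul_assoc,
    ← ENNReal.ofReal_mul (by positivity), sphereSum]
  congr 2
  field_simp

/-- The unit vector used as a pole. -/
def pole : E3 := EuclideanSpace.single 0 1

lemma norm_pole : ‖pole‖ = 1 := by simp [pole]

lemma inner_pole (z : E3) : inner ℝ z pole = z 0 := by simp [pole, EuclideanSpace.inner_single_right]

lemma norm_sq_coord (a b c : ℝ) : ‖(!₂[a, b, c] : E3)‖ ^ 2 = a ^ 2 + (b ^ 2 + c ^ 2) := by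
  rw [EuclideanSpace.norm_sq_eq, Fin.sum_univ_three]
  simp [add_assoc]

lemma measurable_orthPart : Measurable fun q : E3 × E3 => q.1 - inner ℝ q.1 q.2 • q.2 :=
  (by fun_prop : Continuous _).measurable

lemma measurable_parPart : Measurable fun q : E3 × E3 => inner ℝ q.1 q.2 • q.2 :=
  (by fun_prop : Continuous fun q : E3 × E3 => inner ℝ q.1 q.2 • q.2).measurable

lemma measurable_gaussWeight (c : ℝ) : Measurable fun q : E3 × E3 =>
    ENNReal.ofReal (|inner ℝ q.1 q.2| * Real.exp (-c * ‖q.1‖ ^ 2)) :=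
  ENNReal.measurable_ofReal.comp
    (by fun_prop : Continuous fun q : E3 × E3 =>
      |inner ℝ q.1 q.2| * Real.exp (-c * ‖q.1‖ ^ 2)).measurable

lemma lintegral_abs_mul_exp_lt_top {c : ℝ} (hc : 0 < c) :
    ∫⁻ a : ℝ, ENNReal.ofReal (|a| * Real.exp (-c * a ^ 2)) < ⊤ := by
  have h := (integrable_mul_exp_neg_mul_sq hc).hasFiniteIntegral
  refine lt_of_eq_of_lt (lintegral_congr fun a => ?_) h
  rw [← ofReal_norm, norm_mul, Real.norm_eq_abs, Real.norm_eq_abs, Real.abs_exp]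

lemma lintegral_exp_plane_lt_top {c : ℝ} (hc : 0 < c) :
    ∫⁻ p : ℝ × ℝ, ENNReal.ofReal (Real.exp (-c * (p.1 ^ 2 + p.2 ^ 2))) < ⊤ := by
  have h := ((integrable_exp_neg_mul_sq hc).mul_prod (integrable_exp_neg_mul_sq hc)).hasFiniteIntegral
  refine lt_of_eq_of_lt (lintegral_congr fun p => ?_) h
  rw [← ofReal_norm]
  simp only [← Real.exp_add, Real.norm_eq_abs, Real.abs_exp, mul_add]

/-- With `s` moved to the pole, the component of `z` along `s` integrates out with weight `|a|
exp(-c a²)`, and the orthogonal part ranges over a plane. Comparing the planar `r dr` with the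
spatial `r² dr` produces the weight `|y|⁻¹`. -/
lemma lintegral_gain_orth {H : E3 → ENNReal} (hH : Measurable H) {c : ℝ} (hc : 0 < c) :
    ∃ K : ENNReal, K ≠ ⊤ ∧
      ∫⁻ s : S2, (∫⁻ z : E3, ENNReal.ofReal (|inner ℝ z (s : E3)| * Real.exp (-c * ‖z‖ ^ 2))
        * H (z - inner ℝ z (s : E3) • (s : E3))) ∂sphereMeasure
      = K * ∫⁻ y, ENNReal.ofReal (‖y‖⁻¹ * Real.exp (-c * ‖y‖ ^ 2)) * H y := by
  refine ⟨(∫⁻ a : ℝ, ENNReal.ofReal (|a| * Real.exp (-c * a ^ 2))) * ENNReal.ofReal (2 * Real.pi),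
    ENNReal.mul_ne_top (lintegral_abs_mul_exp_lt_top hc).ne ENNReal.ofReal_ne_top, ?_⟩
  have hm := measurable_sphereSum hH
  have hq : Measurable fun r : ℝ => ENNReal.ofReal (Real.exp (-c * r ^ 2)) * sphereSum H r :=
    (by fun_prop : Measurable fun r : ℝ => ENNReal.ofReal (Real.exp (-c * r ^ 2))).mul hm
  rw [lintegral_sphere_equivariant (τ := fun z s => z - inner ℝ z s • s)
    (Φ := fun z s => ENNReal.ofReal (|inner ℝ z s| * Real.exp (-c * ‖z‖ ^ 2)))
    (measurable_gaussWeight c) measurable_orthPart (by simp) (by simp) hH norm_pole]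
  simp only [inner_pole]
  change ∫⁻ z : E3, ENNReal.ofReal (|z 0| * Real.exp (-c * ‖z‖ ^ 2))
    * sphereSum H ‖z - z 0 • pole‖ = _
  rw [lintegral_E3_coord]
  · have e : ∀ (a : ℝ) (p : ℝ × ℝ), ENNReal.ofReal (|(!₂[a, p.1, p.2] : E3) 0| *
        Real.exp (-c * ‖(!₂[a, p.1, p.2] : E3)‖ ^ 2)) * sphereSum H
          ‖(!₂[a, p.1, p.2] : E3) - (!₂[a, p.1, p.2] : E3) 0 • pole‖
        = ENNReal.ofReal (|a| * Real.exp (-c * a ^ 2)) *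
          (ENNReal.ofReal (Real.exp (-c * (Real.sqrt (p.1 ^ 2 + p.2 ^ 2)) ^ 2)) *
            sphereSum H (Real.sqrt (p.1 ^ 2 + p.2 ^ 2))) := by
      intro a p
      have e1 : ‖(!₂[a, p.1, p.2] : E3) - (!₂[a, p.1, p.2] : E3) 0 • pole‖
          = Real.sqrt (p.1 ^ 2 + p.2 ^ 2) := by
        rw [EuclideanSpace.norm_eq, Fin.sum_univ_three]
        simp [pole]
      rw [e1, ← mul_assoc, ← ENNReal.ofReal_mul (by positivity), norm_sq_coord,
        Real.sq_sqrt (by positivity), mul_add, Real.exp_add]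
      simp [mul_assoc]
    simp only [e]
    have e2 : ∀ a : ℝ, ∫⁻ p : ℝ × ℝ, ENNReal.ofReal (|a| * Real.exp (-c * a ^ 2)) *
          (ENNReal.ofReal (Real.exp (-c * (Real.sqrt (p.1 ^ 2 + p.2 ^ 2)) ^ 2)) *
            sphereSum H (Real.sqrt (p.1 ^ 2 + p.2 ^ 2)))
        = ENNReal.ofReal (|a| * Real.exp (-c * a ^ 2)) *
          (ENNReal.ofReal (2 * Real.pi) * ∫⁻ r in Ioi (0 : ℝ), ENNReal.ofReal r *
            (ENNReal.ofReal (Real.exp (-c * r ^ 2)) * sphereSum H r)) := by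
      intro a
      rw [lintegral_const_mul' _ _ ENNReal.ofReal_ne_top, ← lintegral_radial_plane hq]
    simp only [e2]
    rw [lintegral_mul_const _ (by fun_prop), mul_assoc, lintegral_inv_norm_exp hH]
    congr 2
    refine setLIntegral_congr_fun measurableSet_Ioi fun r hr => ?_
    have hr : 0 < r := hr
    rw [← mul_assoc, ← ENNReal.ofReal_mul hr.le]
  · exact (by fun_prop : Measurable fun z : E3 =>
      ENNReal.ofReal (|z 0| * Real.exp (-c * ‖z‖ ^ 2))).mul (hm.comp (by fun_prop))

/-- Now the planar Gaussian integrates out and the component `a` along the pole remains. Its weight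
`|a|` again supplies `r dr` where the space has `r² dr`; the factor `2` counts both signs of `a`. -/
lemma lintegral_gain_par {H : E3 → ENNReal} (hH : Measurable H) {c : ℝ} (hc : 0 < c) :
    ∃ K : ENNReal, K ≠ ⊤ ∧
      ∫⁻ s : S2, (∫⁻ z : E3, ENNReal.ofReal (|inner ℝ z (s : E3)| * Real.exp (-c * ‖z‖ ^ 2))
        * H (inner ℝ z (s : E3) • (s : E3))) ∂sphereMeasure
      = K * ∫⁻ y, ENNReal.ofReal (‖y‖⁻¹ * Real.exp (-c * ‖y‖ ^ 2)) * H y := by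
  refine ⟨(∫⁻ p : ℝ × ℝ, ENNReal.ofReal (Real.exp (-c * (p.1 ^ 2 + p.2 ^ 2)))) * 2,
    ENNReal.mul_ne_top (lintegral_exp_plane_lt_top hc).ne ENNReal.ofNat_ne_top, ?_⟩
  have hm := measurable_sphereSum hH
  have hq : Measurable fun r : ℝ => ENNReal.ofReal (|r| * Real.exp (-c * r ^ 2)) *
      sphereSum H |r| :=
    (by fun_prop : Measurable fun r : ℝ => ENNReal.ofReal (|r| * Real.exp (-c * r ^ 2))).mul
      (hm.comp (by fun_prop))
  rw [lintegral_sphere_equivariant (τ := fun z s => inner ℝ z s • s)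
    (Φ := fun z s => ENNReal.ofReal (|inner ℝ z s| * Real.exp (-c * ‖z‖ ^ 2)))
    (measurable_gaussWeight c) measurable_parPart (by simp) (by simp) hH norm_pole]
  simp only [inner_pole, norm_smul, norm_pole, mul_one, Real.norm_eq_abs]
  change ∫⁻ z : E3, ENNReal.ofReal (|z 0| * Real.exp (-c * ‖z‖ ^ 2))
    * sphereSum H |z 0| = _
  rw [lintegral_E3_coord]
  · have e : ∀ (a : ℝ) (p : ℝ × ℝ), ENNReal.ofReal (|(!₂[a, p.1, p.2] : E3) 0| *
        Real.exp (-c * ‖(!₂[a, p.1, p.2] : E3)‖ ^ 2)) * sphereSum H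
          |(!₂[a, p.1, p.2] : E3) 0|
        = (ENNReal.ofReal (|a| * Real.exp (-c * a ^ 2)) * sphereSum H |a|) *
          ENNReal.ofReal (Real.exp (-c * (p.1 ^ 2 + p.2 ^ 2))) := by
      intro a p
      rw [mul_right_comm, ← ENNReal.ofReal_mul (by positivity), norm_sq_coord, mul_add,
        Real.exp_add]
      simp [mul_assoc]
    simp only [e]
    have e2 : ∀ a : ℝ, ∫⁻ p : ℝ × ℝ, (ENNReal.ofReal (|a| * Real.exp (-c * a ^ 2)) *
          sphereSum H |a|) * ENNReal.ofReal (Real.exp (-c * (p.1 ^ 2 + p.2 ^ 2)))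
        = (ENNReal.ofReal (|a| * Real.exp (-c * a ^ 2)) * sphereSum H |a|) *
          ∫⁻ p : ℝ × ℝ, ENNReal.ofReal (Real.exp (-c * (p.1 ^ 2 + p.2 ^ 2))) :=
      fun a => lintegral_const_mul _ (by fun_prop)
    simp only [e2]
    rw [lintegral_mul_const _ hq, mul_comm, mul_assoc, lintegral_inv_norm_exp hH]
    congr 1
    have e3 : ∫⁻ r in Ioi (0 : ℝ), ENNReal.ofReal (|r| * Real.exp (-c * r ^ 2)) * sphereSum H |r|
        = ∫⁻ r in Ioi (0 : ℝ), ENNReal.ofReal (r * Real.exp (-c * r ^ 2)) * sphereSum H r :=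
      setLIntegral_congr_fun measurableSet_Ioi fun r hr => by
        simp only [abs_of_pos (show 0 < r from hr)]
    have e4 : ∫⁻ r in Iio (0 : ℝ), ENNReal.ofReal (|r| * Real.exp (-c * r ^ 2)) * sphereSum H |r|
        = ∫⁻ r in Ioi (0 : ℝ), ENNReal.ofReal (|r| * Real.exp (-c * r ^ 2)) * sphereSum H |r| := by
      have := (Measure.measurePreserving_neg (volume : Measure ℝ)).setLIntegral_comp_preimage
        (measurableSet_Ioi (a := (0 : ℝ))) hq
      simpa using this
    rw [← lintegral_add_compl _ (measurableSet_Ioi (a := (0 : ℝ))), compl_Ioi,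
      setLIntegral_congr Iio_ae_eq_Iic.symm, e4, e3, two_mul]
  · exact (by fun_prop : Measurable fun z : E3 =>
      ENNReal.ofReal (|z 0| * Real.exp (-c * ‖z‖ ^ 2))).mul (hm.comp (by fun_prop))

/-- By `ab ≤ a² + b²` it suffices that the weight be square integrable: in dimension three the
Jacobian `r²` cancels `|y|⁻²`, leaving a Gaussian. -/
lemma lintegral_inv_norm_mul_lt_top {H : E3 → ENNReal} (hH : Measurable H)
    (h2 : ∫⁻ y, H y ^ 2 < ⊤) {c : ℝ} (hc : 0 < c) :
    ∫⁻ y, ENNReal.ofReal (‖y‖⁻¹ * Real.exp (-c * ‖y‖ ^ 2)) * H y < ⊤ := by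
  have hab : ∀ a b : ENNReal, a * b ≤ a ^ 2 + b ^ 2 := by
    intro a b
    rcases le_total a b with h | h
    · calc a * b ≤ b * b := by gcongr
        _ ≤ _ := by rw [sq b]; exact le_add_self
    · calc a * b ≤ a * a := by gcongr
        _ ≤ _ := by rw [sq a]; exact le_self_add
  refine (lintegral_mono fun y => hab _ _).trans_lt ?_
  rw [lintegral_add_right _ (hH.pow_const 2)]
  refine ENNReal.add_lt_top.2 ⟨?_, h2⟩
  rw [lintegral_polar (by fun_prop)]
  have e : ∀ r ∈ Ioi (0 : ℝ), ENNReal.ofReal (r ^ 2) * ∫⁻ s : S2, ENNReal.ofReal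
      (‖r • (s : E3)‖⁻¹ * Real.exp (-c * ‖r • (s : E3)‖ ^ 2)) ^ 2 ∂sphereMeasure
      = ENNReal.ofReal (Real.exp (-(2 * c) * r ^ 2)) * sphereMeasure univ := by
    intro r hr
    have hr : 0 < r := hr
    simp only [norm_smul, norm_eq_of_mem_sphere, Real.norm_eq_abs, abs_of_pos hr, mul_one,
      lintegral_const]
    rw [← ENNReal.ofReal_pow (by positivity), ← mul_assoc, ← ENNReal.ofReal_mul (by positivity),
      mul_pow, ← Real.exp_nat_mul]
    congr 2
    rw [← mul_assoc, inv_pow, mul_inv_cancel₀ (by positivity), one_mul]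
    congr 1; push_cast; ring
  rw [setLIntegral_congr_fun measurableSet_Ioi e, lintegral_mul_const _ (by fun_prop)]
  refine ENNReal.mul_lt_top ?_ (measure_lt_top _ _)
  refine (setLIntegral_le_lintegral _ _).trans_lt ?_
  have h := (integrable_exp_neg_mul_sq (b := 2 * c) (by positivity)).hasFiniteIntegral
  refine lt_of_eq_of_lt (lintegral_congr fun a => ?_) h
  rw [← ofReal_norm, Real.norm_eq_abs, Real.abs_exp]

/-- Recentring the Gaussian at the relative velocity by `|z|² ≤ 2|v|² + 2|v-z|²` halves the exponent
`1/4` to `1/8`; the factor depending on `v` is harmless since `v` is fixed. -/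
lemma sqrtMaxw_sub_le (v z : E3) :
    sqrtMaxw (v - z) ≤ Real.exp (‖v‖ ^ 2 / 4) * Real.exp (-(1 / 8) * ‖z‖ ^ 2) := by
  have h1 : Real.sqrt ((2 * Real.pi) ^ (-(3 / 2) : ℝ)) ≤ 1 := by
    rw [Real.sqrt_le_one]
    apply Real.rpow_le_one_of_one_le_of_nonpos
    · linarith [Real.pi_gt_three]
    · norm_num
  rw [sqrtMaxw_eq, ← Real.exp_add]
  have h2 : ‖z‖ ≤ ‖v‖ + ‖v - z‖ := by
    simpa using norm_sub_le v (v - z)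
  have h3 : ‖z‖ ^ 2 ≤ 2 * ‖v‖ ^ 2 + 2 * ‖v - z‖ ^ 2 := by
    nlinarith [sq_nonneg (‖v‖ - ‖v - z‖), norm_nonneg z, norm_nonneg v, norm_nonneg (v - z)]
  calc _ ≤ 1 * Real.exp (-(1 / 4) * ‖v - z‖ ^ 2) := by gcongr
    _ ≤ _ := by rw [one_mul]; apply Real.exp_le_exp.2; linarith

/-- A gain term evaluated at a fixed velocity `v` converges absolutely for `h ∈ L²`. -/
lemma integrable_gain_of_lintegral {τ : E3 → E3 → E3}
    (hτ : Measurable fun q : E3 × E3 => τ q.1 q.2)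
    (key : ∀ {H : E3 → ENNReal}, Measurable H → ∃ K : ENNReal, K ≠ ⊤ ∧
      ∫⁻ s : S2, (∫⁻ z : E3, ENNReal.ofReal (|inner ℝ z (s : E3)| *
        Real.exp (-(1 / 8) * ‖z‖ ^ 2)) * H (τ z s)) ∂sphereMeasure
      = K * ∫⁻ y, ENNReal.ofReal (‖y‖⁻¹ * Real.exp (-(1 / 8) * ‖y‖ ^ 2)) * H y)
    {h : E3 → ℝ} (hh : MemLp h 2) (v : E3) :
    Integrable (fun p : E3 × S2 =>
      |inner ℝ (v - p.1) (p.2 : E3)| * sqrtMaxw p.1 * h (v - τ (v - p.1) p.2)) velSphere := by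
  have hT : Measurable fun p : E3 × S2 => v - τ (v - p.1) p.2 :=
    measurable_const.sub (hτ.comp (by fun_prop : Measurable
      fun p : E3 × S2 => (v - p.1, (p.2 : E3))))
  have hW : Continuous fun p : E3 × S2 => |inner ℝ (v - p.1) (p.2 : E3)| * sqrtMaxw p.1 := by
    fun_prop
  have bound : ∀ {g : E3 → ENNReal}, Measurable g → ∃ K : ENNReal, K ≠ ⊤ ∧
      ∫⁻ p : E3 × S2, ENNReal.ofReal (|inner ℝ (v - p.1) (p.2 : E3)| * sqrtMaxw p.1) *
        g (v - τ (v - p.1) p.2) ∂velSphere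
      ≤ K * ∫⁻ y, ENNReal.ofReal (‖y‖⁻¹ * Real.exp (-(1 / 8) * ‖y‖ ^ 2)) * g (v - y) := by
    intro g hg
    have hH : Measurable fun y => g (v - y) := hg.comp (by fun_prop)
    obtain ⟨K, hK, hKe⟩ := key hH
    refine ⟨ENNReal.ofReal (Real.exp (‖v‖ ^ 2 / 4)) * K, ENNReal.mul_ne_top ENNReal.ofReal_ne_top hK, ?_⟩
    have hm : Measurable fun p : E3 × S2 =>
        ENNReal.ofReal (|inner ℝ (v - p.1) (p.2 : E3)| * sqrtMaxw p.1) *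
        g (v - τ (v - p.1) p.2) :=
      (ENNReal.measurable_ofReal.comp hW.measurable).mul (hg.comp hT)
    rw [velSphere, lintegral_prod_symm _ hm.aemeasurable, mul_assoc, ← hKe,
      ← lintegral_const_mul' _ _ ENNReal.ofReal_ne_top]
    refine lintegral_mono fun s => ?_
    have hs := (Measure.measurePreserving_sub_left (volume : Measure E3) v).lintegral_comp
      (hm.comp (measurable_prodMk_right (y := s)))
    simp only [Function.comp_def, sub_sub_cancel] at hs
    rw [← hs, ← lintegral_const_mul' _ _ ENNReal.ofReal_ne_top]
    refine lintegral_mono fun z => ?_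
    rw [← mul_assoc, ← ENNReal.ofReal_mul (by positivity)]
    refine mul_le_mul_left (ENNReal.ofReal_le_ofReal ?_) _
    calc _ ≤ |inner ℝ z (s : E3)| * (Real.exp (‖v‖ ^ 2 / 4) * Real.exp (-(1 / 8) * ‖z‖ ^ 2)) := by
          gcongr; exact sqrtMaxw_sub_le v z
      _ = _ := by ring
  -- `h` is only almost everywhere measurable, yet it is evaluated at collisional velocities with
  -- `v` frozen. Integrability is first shown for a measurable representative.
  set k := hh.1.mk h with hk
  have hkm : Measurable k := hh.1.measurable_mk
  have hkL : MemLp k 2 := hh.ae_eq hh.1.ae_eq_mk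
  have ik : Integrable (fun p : E3 × S2 =>
      |inner ℝ (v - p.1) (p.2 : E3)| * sqrtMaxw p.1 * k (v - τ (v - p.1) p.2)) velSphere := by
    refine ⟨(hW.measurable.mul (hkm.comp hT)).aestronglyMeasurable, ?_⟩
    obtain ⟨K, hK, hle⟩ := bound (g := fun y => ‖k y‖ₑ) hkm.enorm
    have e : ∀ p : E3 × S2, ‖|inner ℝ (v - p.1) (p.2 : E3)| * sqrtMaxw p.1 *
        k (v - τ (v - p.1) p.2)‖ₑ = ENNReal.ofReal (|inner ℝ (v - p.1) (p.2 : E3)| *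
          sqrtMaxw p.1) * ‖k (v - τ (v - p.1) p.2)‖ₑ := by
      intro p
      rw [enorm_mul, Real.enorm_of_nonneg (mul_nonneg (abs_nonneg _) (sqrtMaxw_pos _).le)]
    rw [HasFiniteIntegral]
    simp only [e]
    refine hle.trans_lt (ENNReal.mul_lt_top hK.lt_top ?_)
    refine lintegral_inv_norm_mul_lt_top (hkm.enorm.comp (by fun_prop)) ?_ (by norm_num)
    have := (Measure.measurePreserving_sub_left (volume : Measure E3) v).lintegral_comp
      (hkm.enorm.pow_const 2)
    simp only [Function.comp_def]
    rw [this]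
    have h2 := (memLp_two_iff_integrable_sq hkL.1).1 hkL
    refine lt_of_eq_of_lt (lintegral_congr fun y => ?_) h2.hasFiniteIntegral
    rw [enorm_pow]
  refine ik.congr ?_
  -- The same bound, applied to the indicator of a measurable null set containing `{h ≠ k}`, shows
  -- that post-collisional velocities meet this set only where the weight vanishes or on a null set
  -- of `(w, s)`. So the representative may be exchanged for `h`.
  set N := toMeasurable volume {y | h y ≠ k y} with hN
  have hN0 : volume N = 0 := by
    rw [hN, measure_toMeasurable]; exact hh.1.ae_eq_mk
  obtain ⟨K, hK, hle⟩ := bound (g := N.indicator 1)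
    (measurable_one.indicator (measurableSet_toMeasurable _ _))
  have hz : ∫⁻ y, ENNReal.ofReal (‖y‖⁻¹ * Real.exp (-(1 / 8) * ‖y‖ ^ 2)) *
      N.indicator 1 (v - y) = 0 := by
    refine lintegral_eq_zero_of_ae_eq_zero ?_
    have : ∀ᵐ y : E3, v - y ∉ N :=
      (Measure.measurePreserving_sub_left (volume : Measure E3) v).quasiMeasurePreserving.ae
        (p := fun y => y ∉ N) (by rw [ae_iff]; simpa using hN0)
    filter_upwards [this] with y hy
    simp [indicator_of_notMem hy]
  rw [hz, mul_zero, nonpos_iff_eq_zero, lintegral_eq_zero_iff] at hle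
  · filter_upwards [hle] with p hp
    simp only [Pi.zero_apply, mul_eq_zero, ENNReal.ofReal_eq_zero] at hp
    rcases hp with hp | hp
    · have : |inner ℝ (v - p.1) (p.2 : E3)| * sqrtMaxw p.1 = 0 :=
        le_antisymm hp (mul_nonneg (abs_nonneg _) (sqrtMaxw_pos _).le)
      rw [this]; ring
    · have hmem : v - τ (v - p.1) p.2 ∉ N := by
        intro hmem
        simp [indicator_of_mem hmem] at hp
      have : h (v - τ (v - p.1) p.2) = k (v - τ (v - p.1) p.2) := by
        by_contra hne
        exact hmem (subset_toMeasurable _ _ hne)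
      rw [this]
  · exact (ENNReal.measurable_ofReal.comp hW.measurable).mul
      ((measurable_one.indicator (measurableSet_toMeasurable _ _)).comp hT)

/-- Convergence at every single `v`, not merely almost every one, because `IsLInv` prescribes `L h`
pointwise and sums of preimages must again be preimages. -/
lemma gamInt_sqrtMaxw_of_memLp {h : E3 → ℝ} (hh : MemLp h 2) (v : E3) : GamInt sqrtMaxw h v := by
  have g1 : Integrable (fun p : E3 × S2 =>
      |inner ℝ (v - p.1) (p.2 : E3)| * sqrtMaxw p.1 * h (wPost v p.1 p.2)) velSphere := by
    have := integrable_gain_of_lintegral (τ := fun z s => z - inner ℝ z s • s)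
      measurable_orthPart
      (fun hH => lintegral_gain_orth hH (c := 1 / 8) (by norm_num)) hh v
    convert this using 4 with p
    rw [wPost]; module
  have g2 : Integrable (fun p : E3 × S2 =>
      |inner ℝ (v - p.1) (p.2 : E3)| * sqrtMaxw p.1 * h (vPost v p.1 p.2)) velSphere :=
    integrable_gain_of_lintegral (τ := fun z s => inner ℝ z s • s) measurable_parPart
      (fun hH => lintegral_gain_par hH (c := 1 / 8) (by norm_num)) hh v
  have hb : ∀ x : E3, ‖sqrtMaxw x‖ ≤ 1 := fun x => by
    rw [Real.norm_of_nonneg (sqrtMaxw_pos x).le]; exact sqrtMaxw_le_one x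
  have t1 : Integrable (fun p : E3 × S2 => sqrtMaxw (vPost v p.1 p.2) *
      (|inner ℝ (v - p.1) (p.2 : E3)| * sqrtMaxw p.1 * h (wPost v p.1 p.2))) velSphere :=
    g1.bdd_mul (by fun_prop : Continuous fun p : E3 × S2 =>
      sqrtMaxw (vPost v p.1 p.2)).aestronglyMeasurable (.of_forall fun p => hb _)
  have t2 : Integrable (fun p : E3 × S2 => sqrtMaxw (wPost v p.1 p.2) *
      (|inner ℝ (v - p.1) (p.2 : E3)| * sqrtMaxw p.1 * h (vPost v p.1 p.2))) velSphere :=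
    g2.bdd_mul (by fun_prop : Continuous fun p : E3 × S2 =>
      sqrtMaxw (wPost v p.1 p.2)).aestronglyMeasurable (.of_forall fun p => hb _)
  have t3 : Integrable (fun p : E3 × S2 =>
      |inner ℝ (v - p.1) (p.2 : E3)| * sqrtMaxw p.1 * h p.1) velSphere := by
    have hw : ModGrowth fun w => 1 + ‖w‖ := (ModGrowth.const 1).add .norm
    have i1 : Integrable fun w => (1 + ‖w‖) * sqrtMaxw w * h w :=
      hw.memLp_mul_sqrtMaxw.integrable_mul hh
    have i2 : Integrable (fun p : E3 × S2 => (1 + ‖v‖) * ‖(1 + ‖p.1‖) * sqrtMaxw p.1 * h p.1‖)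
      velSphere := (i1.norm.comp_fst sphereMeasure).const_mul _
    refine i2.mono' ?_ (.of_forall fun p => ?_)
    · have hm : AEStronglyMeasurable (fun p : E3 × S2 => h p.1) velSphere := hh.1.comp_fst
      exact (by fun_prop : Continuous fun p : E3 × S2 =>
        |inner ℝ (v - p.1) (p.2 : E3)| * sqrtMaxw p.1).aestronglyMeasurable.mul hm
    · have h1 : |inner ℝ (v - p.1) (p.2 : E3)| ≤ (1 + ‖v‖) * (1 + ‖p.1‖) :=
        (abs_inner_sphere_le _ _).trans (one_add_norm_sub_le _ _)
      rw [norm_mul, norm_mul, norm_mul, norm_mul, Real.norm_of_nonneg (sqrtMaxw_pos p.1).le,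
        Real.norm_of_nonneg (abs_nonneg _), Real.norm_of_nonneg (by positivity : 0 ≤ 1 + ‖p.1‖),
        ← mul_assoc, ← mul_assoc]
      have := (sqrtMaxw_pos p.1).le
      gcongr
  have t4 := (integrable_collFreq v).mul_const (h v)
  refine (((t1.add t2).sub (t3.const_mul (sqrtMaxw v))).sub t4).congr (.of_forall fun p => ?_)
  simp only [Pi.add_apply, Pi.sub_apply, gamKer, ← sqrtMaxw_mul_self]
  ring

lemma linL_add_of_memLp {h k : E3 → ℝ} (hh : MemLp h 2) (hk : MemLp k 2) (v : E3) :
    linL (fun w => h w + k w) v = linL h v + linL k v :=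
  linL_add (gamInt_sqrtMaxw_of_memLp hh v) (gamInt_sqrtMaxw_of_memLp hk v)

/-! ### Rotation covariance -/

lemma vPost_map (R : E3 ≃ₗᵢ[ℝ] E3) (v w u : E3) : vPost (R v) (R w) (R u) = R (vPost v w u) := by
  simp only [vPost, ← map_sub R v w, LinearIsometryEquiv.inner_map_map]
  rw [map_sub R v, map_smul]

lemma wPost_map (R : E3 ≃ₗᵢ[ℝ] E3) (v w u : E3) : wPost (R v) (R w) (R u) = R (wPost v w u) := by
  simp only [wPost, ← map_sub, LinearIsometryEquiv.inner_map_map, map_smul, map_add]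

lemma sqrtMaxw_map (R : E3 ≃ₗᵢ[ℝ] E3) (v : E3) : sqrtMaxw (R v) = sqrtMaxw v :=
  sqrtMaxw_congr (R.norm_map v)

lemma gamKer_comp (R : E3 ≃ₗᵢ[ℝ] E3) (a b : E3 → ℝ) (v w : E3) (s : S2) :
    gamKer (fun x => a (R x)) (fun x => b (R x)) v (w, s)
      = gamKer a b (R v) (R w, sphereEquiv R s) := by
  simp only [gamKer, coe_sphereEquiv, vPost_map, wPost_map, sqrtMaxw_map, ← map_sub,
    LinearIsometryEquiv.inner_map_map]

lemma gam_comp (R : E3 ≃ₗᵢ[ℝ] E3) (a b : E3 → ℝ) (v : E3) :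
    gam (fun x => a (R x)) (fun x => b (R x)) v = gam a b (R v) := by
  rw [gam_eq_iterated, gam_eq_iterated]
  simp only [gamKer_comp]
  congr 1
  have h1 : ∀ w : E3, ∫ s : S2, gamKer a b (R v) (R w, sphereEquiv R s) ∂sphereMeasure
      = ∫ s : S2, gamKer a b (R v) (R w, s) ∂sphereMeasure := fun w =>
    (measurePreserving_sphereEquiv R).integral_comp' (f := sphereEquiv R)
      fun s => gamKer a b (R v) (R w, s)
  simp only [h1]
  exact R.measurePreserving.integral_comp R.toMeasurableEquiv.measurableEmbedding
    fun w => ∫ s : S2, gamKer a b (R v) (w, s) ∂sphereMeasure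

lemma linL_comp (R : E3 ≃ₗᵢ[ℝ] E3) (h : E3 → ℝ) (v : E3) :
    linL (fun x => h (R x)) v = linL h (R v) := by
  rw [linL_eq_gam, linL_eq_gam, ← gam_comp]
  simp only [sqrtMaxw_map]

lemma collFreq_comp (R : E3 ≃ₗᵢ[ℝ] E3) (v : E3) : collFreq (R v) = collFreq v := by
  unfold collFreq
  symm
  have h0 : ∀ (w : E3) (s : S2), |inner ℝ (v - w) (s : E3)| * maxw w
      = |inner ℝ (R v - R w) (sphereEquiv R s : E3)| * maxw (R w) := by
    intro w s
    rw [coe_sphereEquiv, ← map_sub, LinearIsometryEquiv.inner_map_map, maxw_congr (R.norm_map w)]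
  simp only [h0]
  have h1 : ∀ w : E3, ∫ s : S2, |inner ℝ (R v - R w) (sphereEquiv R s : E3)| * maxw (R w)
      ∂sphereMeasure = ∫ s : S2, |inner ℝ (R v - R w) (s : E3)| * maxw (R w) ∂sphereMeasure :=
    fun w => (measurePreserving_sphereEquiv R).integral_comp' (f := sphereEquiv R)
      fun s : S2 => |inner ℝ (R v - R w) (s : E3)| * maxw (R w)
  simp only [h1]
  exact R.measurePreserving.integral_comp R.toMeasurableEquiv.measurableEmbedding
    fun w => ∫ s : S2, |inner ℝ (R v - w) (s : E3)| * maxw w ∂sphereMeasure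

lemma pair_comp (R : E3 ≃ₗᵢ[ℝ] E3) (f g : E3 → ℝ) :
    pair (fun x => f (R x)) (fun x => g (R x)) = pair f g :=
  R.measurePreserving.integral_comp R.toMeasurableEquiv.measurableEmbedding fun v => f v * g v

lemma DomL.comp {h : E3 → ℝ} (hh : DomL h) (R : E3 ≃ₗᵢ[ℝ] E3) : DomL fun x => h (R x) := by
  refine ⟨hh.1.comp_measurePreserving R.measurePreserving, ?_⟩
  have := hh.2.comp_measurePreserving R.measurePreserving
  simpa only [Function.comp_def, collFreq_comp] using this

lemma DomL.add {h k : E3 → ℝ} (hh : DomL h) (hk : DomL k) : DomL fun x => h x + k x := by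
  refine ⟨hh.1.add hk.1, ?_⟩
  simp only [mul_add]
  exact hh.2.add hk.2

lemma DomL.const_mul {h : E3 → ℝ} (hh : DomL h) (c : ℝ) : DomL fun x => c * h x := by
  refine ⟨hh.1.const_mul c, ?_⟩
  have := hh.2.const_mul c
  simpa only [mul_left_comm c] using this

/-! ### Gaussian moments -/

/-- `P` has moderate growth and mean `I` with respect to the Maxwellian. -/
def HasMean (P : E3 → ℝ) (I : ℝ) : Prop := ModGrowth P ∧ ∫ v, P v * maxw v = I

namespace HasMean

lemma add {P Q : E3 → ℝ} {I J : ℝ} (hP : HasMean P I) (hQ : HasMean Q J) :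
    HasMean (fun v => P v + Q v) (I + J) := by
  refine ⟨hP.1.add hQ.1, ?_⟩
  simp only [add_mul]
  rw [integral_add hP.1.integrable_mul_maxw hQ.1.integrable_mul_maxw, hP.2, hQ.2]

lemma const_mul {P : E3 → ℝ} {I : ℝ} (c : ℝ) (hP : HasMean P I) :
    HasMean (fun v => c * P v) (c * I) := by
  refine ⟨hP.1.const_mul c, ?_⟩
  simp only [mul_assoc]
  rw [integral_const_mul, hP.2]

lemma sub {P Q : E3 → ℝ} {I J : ℝ} (hP : HasMean P I) (hQ : HasMean Q J) :
    HasMean (fun v => P v - Q v) (I - J) := by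
  have := hP.add (hQ.const_mul (-1))
  simpa [sub_eq_add_neg] using this

lemma sum {ι : Type*} (t : Finset ι) {P : ι → E3 → ℝ} {I : ι → ℝ}
    (h : ∀ i ∈ t, HasMean (P i) (I i)) :
    HasMean (fun v => ∑ i ∈ t, P i v) (∑ i ∈ t, I i) := by
  refine ⟨.sum fun i hi => (h i hi).1, ?_⟩
  simp only [Finset.sum_mul]
  rw [integral_finsetSum _ fun i hi => (h i hi).1.integrable_mul_maxw]
  exact Finset.sum_congr rfl fun i hi => (h i hi).2

lemma congr {P Q : E3 → ℝ} {I J : ℝ} (hP : HasMean P I) (h : ∀ v, Q v = P v) (hIJ : J = I) :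
    HasMean Q J := by
  obtain rfl : Q = P := funext h
  rwa [hIJ]

lemma of_odd {P : E3 → ℝ} (hP : ModGrowth P) (h : ∀ v, P (-v) = -P v) : HasMean P 0 := by
  refine ⟨hP, ?_⟩
  have := integral_neg_eq_self (fun v => P v * maxw v) (volume : Measure E3)
  simp only [h, maxw_congr (norm_neg _), neg_mul] at this
  rw [integral_neg] at this
  linarith

end HasMean

lemma hasMean_one : HasMean (fun _ => 1) 1 := by
  refine ⟨.const 1, ?_⟩
  have h := GaussianFourier.integral_rexp_neg_mul_sq_norm (V := E3) (b := 1 / 2) (by norm_num)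
  have e : ∀ v : E3, 1 * maxw v = (2 * Real.pi) ^ (-(3 / 2) : ℝ) * Real.exp (-(1 / 2) * ‖v‖ ^ 2) := by
    intro v
    rw [one_mul, maxw]; congr 2; ring
  simp only [e]
  rw [integral_const_mul, h]
  have e2 : Real.pi / (1 / 2) = 2 * Real.pi := by ring
  rw [e2, ← Real.rpow_add (by positivity)]
  simp

lemma hasFDerivAt_maxw (v : E3) : HasFDerivAt maxw (-(maxw v) • innerSL ℝ v) v := by
  have h1 : HasFDerivAt (fun v : E3 => ‖v‖ ^ 2) (2 • innerSL ℝ v) v :=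
    (hasStrictFDerivAt_norm_sq v).hasFDerivAt
  have h2 := ((h1.const_mul (-(1 / 2) : ℝ)).exp).const_mul ((2 * Real.pi) ^ (-(3 / 2) : ℝ))
  have e : maxw = fun v : E3 => (2 * Real.pi) ^ (-(3 / 2) : ℝ) * Real.exp (-(1 / 2) * ‖v‖ ^ 2) := by
    ext v; rw [maxw]; congr 2; ring
  rw [e]
  refine h2.congr_fderiv ?_
  ext w
  simp only [smul_apply, smul_eq_mul, innerSL_apply_apply, nsmul_eq_mul]
  push_cast
  ring

/-- Gaussian integration by parts. -/
lemma HasMean.coord_mul {P : E3 → ℝ} {P' : E3 → E3 →L[ℝ] ℝ} (hP : ModGrowth P)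
    (hd : ∀ v, HasFDerivAt P (P' v) v) {i : Fin 3} {I : ℝ}
    (h : HasMean (fun v => P' v (EuclideanSpace.single i 1)) I) :
    HasMean (fun v => v i * P v) I := by
  refine ⟨(ModGrowth.coord i).mul hP, ?_⟩
  have hm : ∀ v, fderiv ℝ maxw v (EuclideanSpace.single i 1) = -(maxw v) * v i := by
    intro v
    rw [(hasFDerivAt_maxw v).fderiv]
    simp [EuclideanSpace.inner_single_right]
  have key := integral_mul_fderiv_eq_neg_fderiv_mul_of_integrable (μ := (volume : Measure E3))
    (f := P) (g := maxw) (v := EuclideanSpace.single i 1) ?_ ?_ ?_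
    (fun v _ => (hd v).differentiableAt) (fun v _ => (hasFDerivAt_maxw v).differentiableAt)
  · simp only [hm, (hd _).fderiv] at key
    rw [h.2] at key
    have e : ∀ v : E3, v i * P v * maxw v = -(P v * (-(maxw v) * v i)) := fun v => by ring
    simp only [e]
    rw [integral_neg, key, neg_neg]
  · simp only [(hd _).fderiv]
    exact h.1.integrable_mul_maxw
  · simp only [hm]
    refine (((ModGrowth.coord i).mul hP).neg.integrable_mul_maxw).congr (.of_forall fun v => ?_)
    simp only; ring
  · exact hP.integrable_mul_maxw

lemma hasFDerivAt_coord (j : Fin 3) (v : E3) :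
    HasFDerivAt (fun v : E3 => v j) (EuclideanSpace.proj j : E3 →L[ℝ] ℝ) v :=
  (EuclideanSpace.proj j : E3 →L[ℝ] ℝ).hasFDerivAt

lemma hasFDerivAt_norm_sq (v : E3) :
    HasFDerivAt (fun v : E3 => ‖v‖ ^ 2) (2 • innerSL ℝ v) v :=
  (hasStrictFDerivAt_norm_sq v).hasFDerivAt

lemma single_apply_eq_kron (i j : Fin 3) : (EuclideanSpace.single i (1 : ℝ) : E3) j = kron i j := by
  simp [kron, eq_comm]

lemma norm_sq_eq_sum (v : E3) : ‖v‖ ^ 2 = ∑ i, v i * v i := by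
  rw [EuclideanSpace.norm_sq_eq]
  refine Finset.sum_congr rfl fun i _ => ?_
  rw [Real.norm_eq_abs, sq_abs, sq]

lemma kron_comm (i j : Fin 3) : kron i j = kron j i := by simp [kron, eq_comm]

lemma sum_kron_self : ∑ i, kron i i = 3 := by simp [kron]

lemma hasMean_coord (i : Fin 3) : HasMean (fun v => v i) 0 :=
  .of_odd (.coord i) fun v => by simp

lemma hasMean_coord_coord (i j : Fin 3) : HasMean (fun v => v i * v j) (kron i j) := by
  refine HasMean.coord_mul (.coord j) (hasFDerivAt_coord j) ?_
  refine (hasMean_one.const_mul (kron i j)).congr (fun v => ?_) (by ring)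
  simp [← single_apply_eq_kron]

/-- Isserlis' formula: integration by parts in `v_i` differentiates the remaining cubic and leaves
second moments. -/
lemma hasMean_coord_four (i j k l : Fin 3) : HasMean (fun v => v i * (v j * (v k * v l)))
    (kron i j * kron k l + kron i k * kron j l + kron i l * kron j k) := by
  refine HasMean.coord_mul ((ModGrowth.coord j).mul ((ModGrowth.coord k).mul (.coord l)))
    (fun v => (hasFDerivAt_coord j v).mul ((hasFDerivAt_coord k v).mul (hasFDerivAt_coord l v))) ?_
  refine ((((hasMean_coord_coord k l).const_mul (kron i j)).add
    ((hasMean_coord_coord j l).const_mul (kron i k))).add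
    ((hasMean_coord_coord j k).const_mul (kron i l))).congr (fun v => ?_) rfl
  simp [← single_apply_eq_kron]
  ring

lemma hasMean_norm_sq : HasMean (fun v => ‖v‖ ^ 2) 3 :=
  (HasMean.sum Finset.univ fun i _ => hasMean_coord_coord i i).congr norm_sq_eq_sum
    sum_kron_self.symm

lemma hasMean_norm_sq_coord_coord (i j : Fin 3) :
    HasMean (fun v => v i * (‖v‖ ^ 2 * v j)) (5 * kron i j) := by
  refine HasMean.coord_mul (ModGrowth.norm_sq.mul (.coord j))
    (fun v => (hasFDerivAt_norm_sq v).mul (hasFDerivAt_coord j v)) ?_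
  refine ((hasMean_norm_sq.const_mul (kron i j)).add
    ((hasMean_coord_coord i j).const_mul 2)).congr (fun v => ?_) (by ring)
  simp [← single_apply_eq_kron, EuclideanSpace.inner_single_right]
  ring

lemma hasMean_norm_four : HasMean (fun v => ‖v‖ ^ 4) 15 := by
  refine (HasMean.sum Finset.univ fun i _ => hasMean_norm_sq_coord_coord i i).congr (fun v => ?_) ?_
  · have : ∀ i, v i * (‖v‖ ^ 2 * v i) = ‖v‖ ^ 2 * (v i * v i) := fun i => by ring
    simp only [this]
    rw [← Finset.mul_sum, ← norm_sq_eq_sum]; ring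
  · rw [← Finset.mul_sum, sum_kron_self]; norm_num

lemma hasMean_norm_four_coord_coord (i j : Fin 3) :
    HasMean (fun v => v i * (‖v‖ ^ 2 * ‖v‖ ^ 2 * v j)) (35 * kron i j) := by
  refine HasMean.coord_mul ((ModGrowth.norm_sq.mul .norm_sq).mul (.coord j))
    (fun v => ((hasFDerivAt_norm_sq v).mul (hasFDerivAt_norm_sq v)).mul (hasFDerivAt_coord j v)) ?_
  refine ((hasMean_norm_four.const_mul (kron i j)).add
    ((hasMean_norm_sq_coord_coord i j).const_mul 4)).congr (fun v => ?_) (by ring)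
  simp [← single_apply_eq_kron, EuclideanSpace.inner_single_right]
  ring_nf

lemma hasMean_norm_six : HasMean (fun v => ‖v‖ ^ 6) 105 := by
  refine (HasMean.sum Finset.univ fun i _ => hasMean_norm_four_coord_coord i i).congr
    (fun v => ?_) ?_
  · have : ∀ i, v i * (‖v‖ ^ 2 * ‖v‖ ^ 2 * v i) = ‖v‖ ^ 4 * (v i * v i) := fun i => by ring
    simp only [this]
    rw [← Finset.mul_sum, ← norm_sq_eq_sum]; ring
  · rw [← Finset.mul_sum, sum_kron_self]; norm_num

/-! ### Moments of the surface measure -/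

/-- The total mass of the surface measure. -/
def sphereArea : ℝ := sphereMeasure.real univ

/-- The radial factor of a Gaussian moment of degree `n`. -/
def radialMoment (n : ℕ) : ℝ :=
  ∫ r : Ioi (0 : ℝ), (r : ℝ) ^ n * ((2 * Real.pi) ^ (-(3 / 2) : ℝ) * Real.exp (-(r : ℝ) ^ 2 / 2))
    ∂(Measure.volumeIoiPow 2)

/-- Polar coordinates split a homogeneous Gaussian integral into a spherical and a radial factor. It
is used backwards: known Gaussian moments yield the moments of the sphere, with the radial factor
eliminated by taking `p = |v|^n`. -/
lemma integral_homogeneous {p : E3 → ℝ} {n : ℕ}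
    (hp : ∀ (r : ℝ) (x : E3), 0 < r → p (r • x) = r ^ n * p x) :
    ∫ v, p v * maxw v = (∫ s : S2, p s ∂sphereMeasure) * radialMoment n := by
  have h := (volume : Measure E3).measurePreserving_homeomorphUnitSphereProd
  have hd : Module.finrank ℝ E3 - 1 = 2 := by simp
  rw [hd] at h
  rw [radialMoment, ← integral_prod_mul]
  have e := h.integral_comp (homeomorphUnitSphereProd E3).measurableEmbedding
    (fun z : S2 × Ioi (0 : ℝ) => p z.1 * ((z.2 : ℝ) ^ n *
      ((2 * Real.pi) ^ (-(3 / 2) : ℝ) * Real.exp (-(z.2 : ℝ) ^ 2 / 2))))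
  have e2 : ∫ v, p v * maxw v = ∫ y : ({0}ᶜ : Set E3), p y * maxw y
      ∂(Measure.comap (Subtype.val) (volume : Measure E3)) := by
    rw [integral_subtype_comap (measurableSet_singleton (0 : E3)).compl fun v : E3 => p v * maxw v,
      restrict_compl_singleton]
  rw [e2]
  refine Eq.trans ?_ e
  refine integral_congr_ae (.of_forall fun y => ?_)
  have hy : (y : E3) = ((homeomorphUnitSphereProd E3 y).2 : ℝ) •
      ((homeomorphUnitSphereProd E3 y).1 : E3) :=
    (congrArg Subtype.val ((homeomorphUnitSphereProd E3).symm_apply_apply y)).symm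
  have hr : 0 < ((homeomorphUnitSphereProd E3 y).2 : ℝ) := (homeomorphUnitSphereProd E3 y).2.2
  have hn : ‖(y : E3)‖ = ((homeomorphUnitSphereProd E3 y).2 : ℝ) := by simp
  simp only
  rw [maxw, hn]
  nth_rewrite 1 [hy]
  rw [hp _ _ hr]
  ring

lemma sphereArea_mul_radialMoment_two : sphereArea * radialMoment 2 = 3 := by
  have h := integral_homogeneous (p := fun v => ‖v‖ ^ 2) (n := 2) fun r x hr => by
    rw [norm_smul, mul_pow, Real.norm_of_nonneg hr.le]
  rw [hasMean_norm_sq.2] at h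
  simpa [sphereArea] using h.symm

lemma sphereArea_mul_radialMoment_four : sphereArea * radialMoment 4 = 15 := by
  have h := integral_homogeneous (p := fun v => ‖v‖ ^ 4) (n := 4) fun r x hr => by
    rw [norm_smul, mul_pow, Real.norm_of_nonneg hr.le]
  rw [hasMean_norm_four.2] at h
  simpa [sphereArea] using h.symm

lemma sphereArea_ne_zero : sphereArea ≠ 0 := by
  intro h
  have := sphereArea_mul_radialMoment_two
  rw [h] at this
  norm_num at this

lemma integral_sphere_coord_coord (i j : Fin 3) :
    ∫ s : S2, (s : E3) i * (s : E3) j ∂sphereMeasure = sphereArea / 3 * kron i j := by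
  have h := integral_homogeneous (p := fun v => v i * v j) (n := 2) fun r x hr => by
    simp; ring
  rw [(hasMean_coord_coord i j).2] at h
  have h2 := sphereArea_mul_radialMoment_two
  have h3 : radialMoment 2 ≠ 0 := fun h0 => by rw [h0] at h2; norm_num at h2
  apply mul_right_cancel₀ h3
  rw [← h]
  linear_combination (-(kron i j) / 3) * h2

lemma integral_sphere_coord_four (i j k l : Fin 3) :
    ∫ s : S2, (s : E3) i * ((s : E3) j * ((s : E3) k * (s : E3) l)) ∂sphereMeasure
      = sphereArea / 15 * (kron i j * kron k l + kron i k * kron j l + kron i l * kron j k) := by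
  have h := integral_homogeneous (p := fun v => v i * (v j * (v k * v l))) (n := 4)
    fun r x hr => by simp; ring
  rw [(hasMean_coord_four i j k l).2] at h
  have h2 := sphereArea_mul_radialMoment_four
  have h3 : radialMoment 4 ≠ 0 := fun h0 => by rw [h0] at h2; norm_num at h2
  apply mul_right_cancel₀ h3
  rw [← h]
  linear_combination
    (-(kron i j * kron k l + kron i k * kron j l + kron i l * kron j k) / 15) * h2

lemma integrable_sphere {f : S2 → ℝ} (hf : Continuous f) : Integrable f sphereMeasure := by
  have : CompactSpace S2 := isCompact_iff_compactSpace.1 (isCompact_sphere 0 1)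
  exact hf.integrable_of_hasCompactSupport (.of_compactSpace f)

lemma inner_eq_sum (x y : E3) : inner ℝ x y = ∑ i, x i * y i := by
  rw [PiLp.inner_apply]
  refine Finset.sum_congr rfl fun i _ => ?_
  simp [mul_comm]

lemma sum_mul_kron (f : Fin 3 → ℝ) (j : Fin 3) : ∑ i, f i * kron i j = f j := by simp [kron]

lemma integral_sphere_inner_coord (z : E3) (i : Fin 3) :
    ∫ s : S2, inner ℝ z (s : E3) * (s : E3) i ∂sphereMeasure = sphereArea / 3 * z i := by
  simp only [inner_eq_sum, Finset.sum_mul, mul_assoc]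
  rw [integral_finsetSum _ fun k _ => integrable_sphere (by fun_prop)]
  simp only [integral_const_mul, integral_sphere_coord_coord]
  rw [← sum_mul_kron (fun k => z k) i, Finset.mul_sum]
  exact Finset.sum_congr rfl fun k _ => by ring

lemma integral_sphere_inner_sq_coord_coord (z : E3) (i j : Fin 3) :
    ∫ s : S2, inner ℝ z (s : E3) ^ 2 * ((s : E3) i * (s : E3) j) ∂sphereMeasure
      = sphereArea / 15 * (‖z‖ ^ 2 * kron i j + 2 * (z i * z j)) := by
  have e : ∀ s : S2, inner ℝ z (s : E3) ^ 2 * ((s : E3) i * (s : E3) j)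
      = ∑ k, ∑ l, z k * z l * ((s : E3) k * ((s : E3) l * ((s : E3) i * (s : E3) j))) := by
    intro s
    rw [sq, inner_eq_sum, Finset.sum_mul_sum, Finset.sum_mul]
    refine Finset.sum_congr rfl fun k _ => ?_
    rw [Finset.sum_mul]
    exact Finset.sum_congr rfl fun l _ => by ring
  simp only [e]
  rw [integral_finsetSum _ fun k _ => integrable_sphere (by fun_prop)]
  have e2 : ∀ k, ∫ s : S2, ∑ l, z k * z l * ((s : E3) k * ((s : E3) l * ((s : E3) i * (s : E3) j)))
      ∂sphereMeasure = ∑ l, z k * z l * (sphereArea / 15 * (kron k l * kron i j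
        + kron k i * kron l j + kron k j * kron l i)) := by
    intro k
    rw [integral_finsetSum _ fun l _ => integrable_sphere (by fun_prop)]
    simp only [integral_const_mul, integral_sphere_coord_four]
  simp only [e2]
  rw [norm_sq_eq_sum]
  fin_cases i <;> fin_cases j <;> simp [Fin.sum_univ_three, kron] <;> ring

/-! ### The kernel of `L` -/

lemma volume_inner_eq_zero (v : E3) (s : S2) :
    (volume : Measure E3) {w | inner ℝ (v - w) (s : E3) = 0} = 0 := by
  have h1 : (volume : Measure E3) ((LinearMap.ker (innerSL ℝ (s : E3)).toLinearMap :
      Submodule ℝ E3) : Set E3) = 0 := by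
    refine Measure.addHaar_submodule _ _ fun htop => ?_
    have : (s : E3) ∈ LinearMap.ker (innerSL ℝ (s : E3)).toLinearMap := by rw [htop]; trivial
    rw [LinearMap.mem_ker] at this
    have h2 : inner ℝ (s : E3) (s : E3) = (0 : ℝ) := this
    rw [sphere_inner_self] at h2
    norm_num at h2
  have h2 := (Measure.measurePreserving_sub_left (volume : Measure E3) v).measure_preimage_equiv
    (f := MeasurableEquiv.subLeft v) ((LinearMap.ker (innerSL ℝ (s : E3)).toLinearMap :
      Submodule ℝ E3) : Set E3)
  rw [h1] at h2
  convert h2 using 2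
  ext w
  simp only [mem_ofPred_eq, mem_preimage, SetLike.mem_coe, LinearMap.mem_ker, real_inner_comm (s : E3)]
  rfl

lemma ae_inner_ne_zero : ∀ᵐ q : Coll ∂phaseMeasure, inner ℝ (q.1 - q.2.1) (q.2.2 : E3) ≠ 0 := by
  have hm : MeasurableSet {q : Coll | inner ℝ (q.1 - q.2.1) (q.2.2 : E3) ≠ 0} :=
    (isOpen_ne_fun (by fun_prop) continuous_const).measurableSet
  unfold phaseMeasure
  rw [Measure.ae_prod_iff_ae_ae hm]
  refine .of_forall fun v => ?_
  unfold velSphere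
  have hm2 : MeasurableSet {p : S2 × E3 | inner ℝ (v - p.2) (p.1 : E3) ≠ 0} :=
    (isOpen_ne_fun (by fun_prop) continuous_const).measurableSet
  have : ∀ᵐ p : S2 × E3 ∂(sphereMeasure.prod (volume : Measure E3)),
      inner ℝ (v - p.2) (p.1 : E3) ≠ 0 := by
    rw [Measure.ae_prod_iff_ae_ae hm2]
    refine .of_forall fun s => ?_
    rw [ae_iff]
    simpa using volume_inner_eq_zero v s
  exact (Measure.measurePreserving_swap (μ := (volume : Measure E3))
    (ν := sphereMeasure)).quasiMeasurePreserving.ae this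

/-- The weight `|(v-w)·s|` vanishes only on a null set, so almost everywhere statements survive its
removal. This permits testing kernel elements with a constant cross section. -/
lemma ae_phase_of_ae_coll {P : Coll → Prop} (h : ∀ᵐ q ∂collMeasure, P q) :
    ∀ᵐ q ∂phaseMeasure, P q := by
  unfold collMeasure at h
  rw [ae_withDensity_iff measurable_collWeight] at h
  filter_upwards [h, ae_inner_ne_zero] with q hq hq0
  exact hq (by simpa using hq0)

/-- An element of the kernel of `L` is a collision invariant almost everywhere. -/
lemma symTensor_collEquiv_ae {k : E3 → ℝ} (hk : DomL k) (h0 : pair (linL k) k = 0) :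
    ∀ᵐ q ∂phaseMeasure, symTensor k (collEquiv q) = symTensor k q := by
  apply ae_phase_of_ae_coll
  have hm := hk.memLp_symTensor
  have hC : MemLp (fun q => symTensor k (collEquiv q)) 2 collMeasure :=
    hm.comp_measurePreserving measurePreserving_collEquiv
  have i1 : Integrable (fun q => symTensor k q * symTensor k q) collMeasure := hm.integrable_mul hm
  have i2 : Integrable (fun q => symTensor k (collEquiv q) * symTensor k q) collMeasure :=
    hC.integrable_mul hm
  have i3 : Integrable (fun q => symTensor k (collEquiv q) * symTensor k (collEquiv q)) collMeasure :=
    hC.integrable_mul hC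
  have e3 : ∫ q, symTensor k (collEquiv q) * symTensor k (collEquiv q) ∂collMeasure
      = ∫ q, symTensor k q * symTensor k q ∂collMeasure :=
    integral_comp_collEquiv fun q => symTensor k q * symTensor k q
  rw [hk.pair_linL hk] at h0
  -- The collision map preserves `∫ (symTensor k)²`, so this integral equals four times the
  -- Dirichlet form `pair (linL k) k`.
  have hz : ∫ q, (symTensor k (collEquiv q) - symTensor k q) ^ 2 ∂collMeasure = 0 := by
    have e : ∀ q, (symTensor k (collEquiv q) - symTensor k q) ^ 2
        = (symTensor k (collEquiv q) * symTensor k (collEquiv q) + symTensor k q * symTensor k q)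
          - 2 * (symTensor k (collEquiv q) * symTensor k q) := fun q => by ring
    simp only [e]
    rw [integral_sub (by exact i3.add i1) (i2.const_mul 2), integral_add i3 i1, integral_const_mul, e3]
    linarith
  have hi : Integrable (fun q => (symTensor k (collEquiv q) - symTensor k q) ^ 2) collMeasure :=
    (hC.sub hm).integrable_sq
  rw [integral_eq_zero_iff_of_nonneg (fun q => sq_nonneg _) hi] at hz
  filter_upwards [hz] with q hq
  have := pow_eq_zero_iff (two_ne_zero) |>.1 hq
  linarith

/-- The collisional change `χ(v') + χ(w') - χ(v) - χ(w)`. -/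
def collDiff (χ : E3 → ℝ) (q : Coll) : ℝ :=
  χ (vPost q.1 q.2.1 q.2.2) + χ (wPost q.1 q.2.1 q.2.2) - χ q.1 - χ q.2.1

/-- Testing the collision invariance of a kernel element against `χ`. -/
lemma integral_kernel_collDiff {k : E3 → ℝ} (hk : DomL k) (h0 : pair (linL k) k = 0)
    {χ : E3 → ℝ} (hχ : ModGrowth χ) :
    ∫ v, k v * sqrtMaxw v * ∫ p : E3 × S2, maxw p.1 * collDiff χ (v, p) ∂velSphere = 0 := by
  set r : Coll → ℝ := fun q => sqrtMaxw q.1 * k q.1 * maxw q.2.1 with hr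
  set e : Coll → ℝ := fun q => χ q.1 + χ q.2.1 with he
  obtain ⟨D, N, hD, hb⟩ := hχ.exists_nonneg
  have hrm : AEStronglyMeasurable r phaseMeasure := by
    have h1 : AEStronglyMeasurable (fun q : Coll => k q.1) phaseMeasure := hk.1.1.comp_fst
    exact ((by fun_prop : Continuous fun q : Coll => sqrtMaxw q.1).aestronglyMeasurable.mul h1).mul
      (by fun_prop : Continuous fun q : Coll => maxw q.2.1).aestronglyMeasurable
  have hw : ModGrowth fun v => (1 + ‖v‖) ^ N :=
    .of_bound (by fun_prop) 1 N fun v => by rw [abs_of_nonneg (by positivity), one_mul]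
  have i0 : Integrable fun v => (1 + ‖v‖) ^ N * sqrtMaxw v * k v :=
    hw.memLp_mul_sqrtMaxw.integrable_mul hk.1
  have key : ∀ T : Coll → E3, Measurable T →
      (∀ q, 1 + ‖T q‖ ≤ (1 + ‖q.1‖) * (1 + ‖q.2.1‖)) →
      Integrable (fun q => r q * χ (T q)) phaseMeasure := by
    intro T hT hle
    refine ((i0.norm.mul_prod (integrable_weight N)).const_mul D).mono'
      (hrm.mul (hχ.1.comp hT).aestronglyMeasurable) (.of_forall fun q => ?_)
    have h1 : |χ (T q)| ≤ D * ((1 + ‖q.1‖) * (1 + ‖q.2.1‖)) ^ N :=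
      (hb _).trans (by gcongr; exact hle q)
    have h2 : maxw q.2.1 ≤ sqrtMaxw q.2.1 := by
      rw [← sqrtMaxw_mul_self]
      exact mul_le_of_le_one_left (sqrtMaxw_pos _).le (sqrtMaxw_le_one _)
    simp only [hr, norm_mul, Real.norm_eq_abs, abs_of_pos (sqrtMaxw_pos _), abs_of_pos (maxw_pos _)]
    rw [abs_of_nonneg (by positivity : 0 ≤ (1 + ‖q.1‖) ^ N)]
    have h3 := (sqrtMaxw_pos q.1).le
    have h4 := (sqrtMaxw_pos q.2.1).le
    calc _ ≤ sqrtMaxw q.1 * |k q.1| * sqrtMaxw q.2.1 * (D * ((1 + ‖q.1‖) * (1 + ‖q.2.1‖)) ^ N) := by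
          gcongr
      _ = _ := by rw [mul_pow]; ring
  have m1 : Measurable fun q : Coll => q.1 := by fun_prop
  have m2 : Measurable fun q : Coll => q.2.1 := by fun_prop
  have ie : Integrable (fun q => r q * e q) phaseMeasure := by
    have j1 := key (fun q => q.1) m1 fun q => by
      nlinarith [norm_nonneg q.1, norm_nonneg q.2.1, mul_nonneg (norm_nonneg q.1) (norm_nonneg q.2.1)]
    have j2 := key (fun q => q.2.1) m2 fun q => by
      nlinarith [norm_nonneg q.1, norm_nonneg q.2.1, mul_nonneg (norm_nonneg q.1) (norm_nonneg q.2.1)]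
    simp only [he, mul_add]
    exact j1.add j2
  have ieC : Integrable (fun q => r q * e (collEquiv q)) phaseMeasure := by
    have j1 := key (fun q => (collEquiv q).1) (m1.comp collEquiv.measurable)
      fun q => one_add_norm_vPost_le _ _ _
    have j2 := key (fun q => (collEquiv q).2.1) (m2.comp collEquiv.measurable)
      fun q => one_add_norm_wPost_le _ _ _
    simp only [he, mul_add]
    exact j1.add j2
  have heS : ∀ q, e (swapEquiv q) = e q := fun q => by simp only [he, swapEquiv_apply]; ring
  have ieS : Integrable (fun q => r (swapEquiv q) * e q) phaseMeasure := by
    simpa only [Function.comp_def, heS] using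
      measurePreserving_swapEquiv_phase.integrable_comp_of_integrable ie
  have ieCS : Integrable (fun q => r (swapEquiv q) * e (collEquiv q)) phaseMeasure := by
    simpa only [Function.comp_def, collEquiv_swapEquiv, heS] using
      measurePreserving_swapEquiv_phase.integrable_comp_of_integrable ieC
  have eS : ∫ q, r (swapEquiv q) * e q ∂phaseMeasure = ∫ q, r q * e q ∂phaseMeasure := by
    rw [← measurePreserving_swapEquiv_phase.integral_comp' (fun q => r q * e q)]
    simp only [heS]
  have eCS : ∫ q, r (swapEquiv q) * e (collEquiv q) ∂phaseMeasure
      = ∫ q, r q * e (collEquiv q) ∂phaseMeasure := by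
    rw [← measurePreserving_swapEquiv_phase.integral_comp' (fun q => r q * e (collEquiv q))]
    simp only [collEquiv_swapEquiv, heS]
  -- The symmetrized factor equals `√μ(v)√μ(w)` times `symTensor k`, which is collision invariant
  -- almost everywhere, and the unweighted measure is invariant too. Without the weight the
  -- integrals over `s` become polynomial.
  have hinv : ∫ q, (r q + r (swapEquiv q)) * e (collEquiv q) ∂phaseMeasure
      = ∫ q, (r q + r (swapEquiv q)) * e q ∂phaseMeasure := by
    rw [← measurePreserving_collEquiv_phase.integral_comp'
      (fun q => (r q + r (swapEquiv q)) * e q)]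
    refine integral_congr_ae ?_
    filter_upwards [symTensor_collEquiv_ae hk h0] with q hq
    have hg : ∀ q, r q + r (swapEquiv q) = sqrtMaxw q.1 * sqrtMaxw q.2.1 * symTensor k q := by
      intro q
      simp only [hr, swapEquiv_apply, symTensor, ← sqrtMaxw_mul_self]; ring
    simp only [hg]
    rw [hq]
    simp only [collEquiv_apply, sqrtMaxw_post]
  simp only [add_mul] at hinv
  rw [integral_add ieC ieCS, integral_add ie ieS, eS, eCS] at hinv
  have hfin : ∫ q, r q * e (collEquiv q) - r q * e q ∂phaseMeasure = 0 := by
    rw [integral_sub ieC ie]; linarith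
  have hdiff : Integrable (fun q => r q * e (collEquiv q) - r q * e q) phaseMeasure := ieC.sub ie
  unfold phaseMeasure at hfin hdiff
  rw [integral_prod _ hdiff] at hfin
  rw [← hfin]
  congr 1 with v
  rw [← integral_const_mul]
  congr 1 with p
  simp only [hr, he, collDiff, collEquiv_apply]
  ring

lemma integrable_maxw_velSphere {f : E3 × S2 → ℝ} (hf : Measurable f) (C : ℝ) (N : ℕ)
    (h : ∀ p, |f p| ≤ C * (1 + ‖p.1‖) ^ N) : Integrable (fun p => maxw p.1 * f p) velSphere := by
  refine ((integrable_weight N).const_mul C).mono'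
    (((by fun_prop : Continuous fun p : E3 × S2 => maxw p.1).measurable.mul
      hf).aestronglyMeasurable) (.of_forall fun p => ?_)
  have h2 : maxw p.1 ≤ sqrtMaxw p.1 := by
    rw [← sqrtMaxw_mul_self]
    exact mul_le_of_le_one_left (sqrtMaxw_pos _).le (sqrtMaxw_le_one _)
  have h3 := (sqrtMaxw_pos p.1).le
  have h4 := (abs_nonneg (f p)).trans (h p)
  rw [norm_mul, Real.norm_eq_abs, Real.norm_eq_abs, abs_of_pos (maxw_pos _)]
  calc _ ≤ sqrtMaxw p.1 * (C * (1 + ‖p.1‖) ^ N) := by gcongr; exact h p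
    _ = _ := by ring

lemma ModGrowth.integrable_collDiff {χ : E3 → ℝ} (hχ : ModGrowth χ) (v : E3) :
    Integrable (fun p : E3 × S2 => HilbertExpansion.maxw p.1 * collDiff χ (v, p)) velSphere := by
  obtain ⟨D, N, hD, hb⟩ := hχ.exists_nonneg
  have m1 : Measurable fun p : E3 × S2 => vPost v p.1 p.2 := (by fun_prop : Continuous _).measurable
  have m2 : Measurable fun p : E3 × S2 => wPost v p.1 p.2 := (by fun_prop : Continuous _).measurable
  refine integrable_maxw_velSphere ?_ (4 * D * (1 + ‖v‖) ^ N) N fun p => ?_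
  · change Measurable fun p : E3 × S2 =>
      χ (vPost v p.1 p.2) + χ (wPost v p.1 p.2) - χ v - χ p.1
    exact (((hχ.1.comp m1).add (hχ.1.comp m2)).sub measurable_const).sub (hχ.1.comp measurable_fst)
  · set R := (1 + ‖v‖) * (1 + ‖p.1‖) with hR
    have hv : 1 + ‖v‖ ≤ R := by
      nlinarith [norm_nonneg v, norm_nonneg p.1, mul_nonneg (norm_nonneg v) (norm_nonneg p.1)]
    have hw : 1 + ‖p.1‖ ≤ R := by
      nlinarith [norm_nonneg v, norm_nonneg p.1, mul_nonneg (norm_nonneg v) (norm_nonneg p.1)]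
    have e : ∀ x : E3, 1 + ‖x‖ ≤ R → |χ x| ≤ D * R ^ N := fun x hx =>
      (hb x).trans (by gcongr)
    have e1 := abs_le.1 (e _ (one_add_norm_vPost_le v p.1 p.2))
    have e2 := abs_le.1 (e _ (one_add_norm_wPost_le v p.1 p.2))
    have e3 := abs_le.1 (e _ hv)
    have e4 := abs_le.1 (e _ hw)
    rw [show 4 * D * (1 + ‖v‖) ^ N * (1 + ‖p.1‖) ^ N = 4 * (D * R ^ N) by rw [hR, mul_pow]; ring]
    rw [abs_le, collDiff]
    constructor <;> linarith [e1.1, e1.2, e2.1, e2.2, e3.1, e3.2, e4.1, e4.2]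

lemma integral_collDiff_eq {χ : E3 → ℝ} (hχ : ModGrowth χ) (v : E3) {Y : E3 → ℝ} {I : ℝ}
    (hs : ∀ w, ∫ s : S2, collDiff χ (v, w, s) ∂sphereMeasure = Y w) (hY : HasMean Y I) :
    ∫ p : E3 × S2, maxw p.1 * collDiff χ (v, p) ∂velSphere = I := by
  have h := hχ.integrable_collDiff v
  unfold velSphere at h ⊢
  rw [integral_prod _ h, ← hY.2]
  congr 1 with w
  simp only
  rw [integral_const_mul, hs, mul_comm]

/-- Kernel elements are orthogonal to the viscous stress. -/
lemma pair_kernel_stress {k : E3 → ℝ} (hk : DomL k) (h0 : pair (linL k) k = 0) (i j : Fin 3) :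
    pair k (fun v => (v i * v j - ‖v‖ ^ 2 / 3 * kron i j) * sqrtMaxw v) = 0 := by
  have hχ : ModGrowth fun v => v i * v j := (ModGrowth.coord i).mul (.coord j)
  have h := integral_kernel_collDiff hk h0 hχ
  -- The gain contributes the fourth moments of the sphere and the mixed terms the second ones;
  -- `4/15 - 2/3 = -2/5` is the coefficient of `z_i z_j`, with `z = v - w`. The term `-|v|²δ_ij/3`
  -- of the stress is a collision invariant, so `χ = v_i v_j` suffices.
  have hs : ∀ v w : E3, ∫ s : S2, collDiff (fun v => v i * v j) (v, w, s) ∂sphereMeasure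
      = -(2 * sphereArea / 5) * ((v - w) i * (v - w) j - ‖v - w‖ ^ 2 / 3 * kron i j) := by
    intro v w
    have e : ∀ s : S2, collDiff (fun v => v i * v j) (v, w, s)
        = 2 * (inner ℝ (v - w) (s : E3) ^ 2 * ((s : E3) i * (s : E3) j))
          - ((v - w) j * (inner ℝ (v - w) (s : E3) * (s : E3) i)
            + (v - w) i * (inner ℝ (v - w) (s : E3) * (s : E3) j)) := by
      intro s
      simp only [collDiff, vPost, wPost, PiLp.sub_apply, PiLp.add_apply, PiLp.smul_apply, smul_eq_mul]
      ring
    simp only [e]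
    rw [integral_sub (integrable_sphere (by fun_prop)) (integrable_sphere (by fun_prop)),
      integral_add (integrable_sphere (by fun_prop)) (integrable_sphere (by fun_prop)),
      integral_const_mul, integral_const_mul, integral_const_mul,
      integral_sphere_inner_coord, integral_sphere_inner_coord,
      integral_sphere_inner_sq_coord_coord]
    ring
  -- In the average over `w` the odd terms vanish, and the contributions `δ_ij` of `w_i w_j` and `3
  -- δ_ij / 3` of the trace cancel. The stress reappears in `v`, as an eigenfunction.
  have hm : ∀ v : E3, ∫ p : E3 × S2, maxw p.1 * collDiff (fun v => v i * v j) (v, p) ∂velSphere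
      = -(2 * sphereArea / 5) * (v i * v j - ‖v‖ ^ 2 / 3 * kron i j) := by
    intro v
    refine integral_collDiff_eq hχ v (hs v) ?_
    have a1 : HasMean (fun w => inner ℝ v w) 0 := .of_odd (.inner_left v) fun w => by simp
    have hq := ((hasMean_one.const_mul (v i * v j)).sub
      (((hasMean_coord j).const_mul (v i)).add ((hasMean_coord i).const_mul (v j)))).add
      (hasMean_coord_coord i j)
    have hn := ((hasMean_one.const_mul (‖v‖ ^ 2)).sub (a1.const_mul 2)).add hasMean_norm_sq
    refine ((hq.sub (hn.const_mul (kron i j / 3))).const_mul (-(2 * sphereArea / 5))).congr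
      (fun w => ?_) (by ring)
    rw [norm_sub_sq_real]
    simp only [PiLp.sub_apply]
    ring
  simp only [hm] at h
  have hc : -(2 * sphereArea / 5) ≠ 0 := by
    have := sphereArea_ne_zero
    simpa using this
  have e : ∀ v : E3, k v * sqrtMaxw v * (-(2 * sphereArea / 5) *
      (v i * v j - ‖v‖ ^ 2 / 3 * kron i j)) = -(2 * sphereArea / 5) *
        (k v * ((v i * v j - ‖v‖ ^ 2 / 3 * kron i j) * sqrtMaxw v)) := fun v => by ring
  simp only [e] at h
  rw [integral_const_mul] at h
  exact (mul_eq_zero.1 h).resolve_left hc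

/-- Kernel elements are orthogonal to the heat flux. -/
lemma pair_kernel_heat {k : E3 → ℝ} (hk : DomL k) (h0 : pair (linL k) k = 0) (i : Fin 3) :
    pair k (fun v => (‖v‖ ^ 2 - 5) / 2 * v i * sqrtMaxw v) = 0 := by
  -- The part `-5 v_i` of the heat flux is a collision invariant and would drop out of `collDiff`,
  -- so the leading cubic is enough.
  have hχ : ModGrowth fun v => ‖v‖ ^ 2 * v i := ModGrowth.norm_sq.mul (.coord i)
  have h := integral_kernel_collDiff hk h0 hχ
  have hs : ∀ v w : E3, ∫ s : S2, collDiff (fun v => ‖v‖ ^ 2 * v i) (v, w, s) ∂sphereMeasure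
      = (2 * sphereArea / 15) * (‖v - w‖ ^ 2 * (v + w) i
          - 3 * ((v - w) i * (‖v‖ ^ 2 - ‖w‖ ^ 2))) := by
    intro v w
    have e : ∀ s : S2, collDiff (fun v => ‖v‖ ^ 2 * v i) (v, w, s)
        = 2 * (∑ l, (v + w) l * (inner ℝ (v - w) (s : E3) ^ 2 * ((s : E3) l * (s : E3) i)))
          - (inner ℝ (v - w) (v + w) * (inner ℝ (v - w) (s : E3) * (s : E3) i)
            + (v - w) i * ∑ l, (v + w) l * (inner ℝ (v - w) (s : E3) * (s : E3) l)) := by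
      intro s
      have e1 : ∑ l, (v + w) l * (inner ℝ (v - w) (s : E3) ^ 2 * ((s : E3) l * (s : E3) i))
          = inner ℝ (v - w) (s : E3) ^ 2 * (s : E3) i * inner ℝ (v + w) (s : E3) := by
        rw [inner_eq_sum (v + w), Finset.mul_sum]
        exact Finset.sum_congr rfl fun l _ => by ring
      have e2 : ∑ l, (v + w) l * (inner ℝ (v - w) (s : E3) * (s : E3) l)
          = inner ℝ (v - w) (s : E3) * inner ℝ (v + w) (s : E3) := by
        rw [inner_eq_sum (v + w), Finset.mul_sum]
        exact Finset.sum_congr rfl fun l _ => by ring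
      rw [e1, e2]
      have n1 : ‖vPost v w s‖ ^ 2 = ‖v‖ ^ 2 - 2 * inner ℝ (v - w) (s : E3) * inner ℝ v (s : E3)
          + inner ℝ (v - w) (s : E3) ^ 2 := by
        rw [vPost, norm_sub_sq_real, norm_smul, norm_eq_of_mem_sphere, inner_smul_right]
        simp only [Real.norm_eq_abs, mul_one, sq_abs]; ring
      have n2 : ‖wPost v w s‖ ^ 2 = ‖w‖ ^ 2 + 2 * inner ℝ (v - w) (s : E3) * inner ℝ w (s : E3)
          + inner ℝ (v - w) (s : E3) ^ 2 := by
        rw [wPost, norm_add_sq_real, norm_smul, norm_eq_of_mem_sphere, inner_smul_right]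
        simp only [Real.norm_eq_abs, mul_one, sq_abs]; ring
      have n3 : inner ℝ (v - w) (v + w) = ‖v‖ ^ 2 - ‖w‖ ^ 2 := by
        rw [inner_sub_left, inner_add_right, inner_add_right, real_inner_comm w v,
          real_inner_self_eq_norm_sq, real_inner_self_eq_norm_sq]; ring
      simp only [collDiff, n1, n2, n3]
      simp only [vPost, wPost, PiLp.sub_apply, PiLp.add_apply, PiLp.smul_apply, smul_eq_mul,
        inner_sub_left, inner_add_left]
      ring
    have n3 : inner ℝ (v - w) (v + w) = ‖v‖ ^ 2 - ‖w‖ ^ 2 := by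
      rw [inner_sub_left, inner_add_right, inner_add_right, real_inner_comm w v,
        real_inner_self_eq_norm_sq, real_inner_self_eq_norm_sq]; ring
    have n4 : ∑ l, (v + w) l * (v - w) l = ‖v‖ ^ 2 - ‖w‖ ^ 2 := by
      rw [← n3, inner_eq_sum]; exact Finset.sum_congr rfl fun l _ => by ring
    simp only [e]
    rw [integral_sub (integrable_sphere (by fun_prop)) (integrable_sphere (by fun_prop)),
      integral_add (integrable_sphere (by fun_prop)) (integrable_sphere (by fun_prop)),
      integral_const_mul, integral_const_mul, integral_const_mul,
      integral_sphere_inner_coord,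
      integral_finsetSum _ fun l _ => integrable_sphere (by fun_prop),
      integral_finsetSum _ fun l _ => integrable_sphere (by fun_prop)]
    simp only [integral_const_mul, integral_sphere_inner_coord,
      integral_sphere_inner_sq_coord_coord]
    have e3 : ∑ l, (v + w) l * (sphereArea / 15 * (‖v - w‖ ^ 2 * kron l i + 2 * ((v - w) l * (v - w) i)))
        = sphereArea / 15 * (‖v - w‖ ^ 2 * (v + w) i + 2 * (v - w) i * (‖v‖ ^ 2 - ‖w‖ ^ 2)) := by
      rw [← n4, ← sum_mul_kron (fun l => (v + w) l) i, Finset.mul_sum, Finset.mul_sum,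
        ← Finset.sum_add_distrib, Finset.mul_sum]
      exact Finset.sum_congr rfl fun l _ => by ring
    have e4 : ∑ l, (v + w) l * (sphereArea / 3 * (v - w) l)
        = sphereArea / 3 * (‖v‖ ^ 2 - ‖w‖ ^ 2) := by
      rw [← n4, Finset.mul_sum]
      exact Finset.sum_congr rfl fun l _ => by ring
    rw [e3, e4, n3]
    ring
  -- The Gaussian average of the bracket in `hs` is `(|v|² + 1)v_i - 3(|v|² - 3)v_i = -4 (|v|² -
  -- 5)/2 v_i`, which gives the eigenvalue `-8/15` of the total area.
  have hm : ∀ v : E3, ∫ p : E3 × S2, maxw p.1 * collDiff (fun v => ‖v‖ ^ 2 * v i) (v, p) ∂velSphere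
      = -(8 * sphereArea / 15) * ((‖v‖ ^ 2 - 5) / 2 * v i) := by
    intro v
    refine integral_collDiff_eq hχ v (hs v) ?_
    have a1 : HasMean (fun w => inner ℝ v w) 0 := .of_odd (.inner_left v) fun w => by simp
    have a2 : HasMean (fun w => inner ℝ v w * w i) (v i) := by
      refine (HasMean.sum Finset.univ fun l _ =>
        (hasMean_coord_coord l i).const_mul (v l)).congr (fun w => ?_) (sum_mul_kron _ _).symm
      rw [inner_eq_sum, Finset.sum_mul]
      exact Finset.sum_congr rfl fun l _ => by ring
    have a3 : HasMean (fun w => ‖w‖ ^ 2 * w i) 0 :=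
      .of_odd (ModGrowth.norm_sq.mul (.coord i)) fun w => by simp
    have b1 := ((hasMean_one.const_mul (‖v‖ ^ 2 * v i)).add
      ((hasMean_coord i).const_mul (‖v‖ ^ 2))).sub
      (((a1.const_mul (2 * v i)).add (a2.const_mul 2)))
    have b2 := b1.add ((hasMean_norm_sq.const_mul (v i)).add a3)
    have b3 := ((hasMean_one.const_mul (‖v‖ ^ 2 * v i)).sub
      ((hasMean_coord i).const_mul (‖v‖ ^ 2))).sub ((hasMean_norm_sq.const_mul (v i)).sub a3)
    refine ((b2.sub (b3.const_mul 3)).const_mul (2 * sphereArea / 15)).congr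
      (fun w => ?_) (by ring)
    rw [norm_sub_sq_real]
    simp only [PiLp.sub_apply, PiLp.add_apply]
    ring
  simp only [hm] at h
  have hc : -(8 * sphereArea / 15) ≠ 0 := by
    have := sphereArea_ne_zero
    simpa using this
  have e : ∀ v : E3, k v * sqrtMaxw v * (-(8 * sphereArea / 15) * ((‖v‖ ^ 2 - 5) / 2 * v i))
      = -(8 * sphereArea / 15) * (k v * ((‖v‖ ^ 2 - 5) / 2 * v i * sqrtMaxw v)) :=
    fun v => by ring
  simp only [e] at h
  rw [integral_const_mul] at h
  exact (mul_eq_zero.1 h).resolve_left hc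

/-! ### The orthogonal complement of the null space -/

lemma ModGrowth.congr {a b : E3 → ℝ} (ha : ModGrowth a) (h : ∀ v, b v = a v) : ModGrowth b := by
  rwa [funext h]

lemma memLp_nullBasis (j : Fin 5) : MemLp (nullBasis j) 2 := by
  have h : ModGrowth fun v : E3 => (![1, v 0, v 1, v 2, (‖v‖ ^ 2 - 3) / 2] : Fin 5 → ℝ) j := by
    fin_cases j
    · exact .const 1
    · exact .coord 0
    · exact .coord 1
    · exact .coord 2
    · exact ((ModGrowth.norm_sq.sub (.const 3)).const_mul (1 / 2)).congr fun v => by simp; ring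
  exact h.memLp_mul_sqrtMaxw

lemma pair_add_left {f g k : E3 → ℝ} (hf : MemLp f 2) (hg : MemLp g 2) (hk : MemLp k 2) :
    pair (f + g) k = pair f k + pair g k := by
  unfold pair
  simp only [Pi.add_apply, add_mul]
  exact integral_add (hf.integrable_mul hk) (hg.integrable_mul hk)

lemma pair_smul_left (c : ℝ) (f k : E3 → ℝ) : pair (c • f) k = c * pair f k := by
  unfold pair
  simp only [Pi.smul_apply, smul_eq_mul, mul_assoc]
  exact integral_const_mul _ _

lemma pair_add_right {f g k : E3 → ℝ} (hf : MemLp f 2) (hg : MemLp g 2) (hk : MemLp k 2) :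
    pair k (f + g) = pair k f + pair k g := by
  rw [pair_comm, pair_add_left hf hg hk, pair_comm f, pair_comm g]

lemma pair_smul_right (c : ℝ) (f k : E3 → ℝ) : pair k (c • f) = c * pair k f := by
  rw [pair_comm, pair_smul_left, pair_comm]

lemma quadratic_eq_nullBasis (a : ℝ) (b : E3) (c : ℝ) :
    (fun v : E3 => (a + inner ℝ b v + c * ‖v‖ ^ 2) * sqrtMaxw v)
      = (a + 3 * c) • nullBasis 0 + (b 0 • nullBasis 1 + (b 1 • nullBasis 2
        + (b 2 • nullBasis 3 + (2 * c) • nullBasis 4))) := by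
  ext v
  simp [nullBasis, inner_eq_sum, Fin.sum_univ_three]
  ring

/-- A description of `𝒩` without coordinates, from which the invariance of `𝒩^⊥` under isometries is
immediate. -/
lemma inNullPerp_iff {h : E3 → ℝ} : InNullPerp h ↔ MemLp h 2 ∧ ∀ (a : ℝ) (b : E3) (c : ℝ),
    pair h (fun v => (a + inner ℝ b v + c * ‖v‖ ^ 2) * sqrtMaxw v) = 0 := by
  refine and_congr_right fun hh => ⟨fun H a b c => ?_, fun H j => ?_⟩
  · have m := memLp_nullBasis
    have s : ∀ (c : ℝ) j, MemLp (c • nullBasis j) 2 := fun c j => (m j).const_smul c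
    rw [quadratic_eq_nullBasis, pair_add_right (s _ _) (((s _ _).add ((s _ _).add ((s _ _).add (s _ _))))) hh,
      pair_add_right (s _ _) ((s _ _).add ((s _ _).add (s _ _))) hh,
      pair_add_right (s _ _) ((s _ _).add (s _ _)) hh, pair_add_right (s _ _) (s _ _) hh]
    simp only [pair_smul_right, H, mul_zero, add_zero]
  · have e : ∃ (a : ℝ) (b : E3) (c : ℝ),
        nullBasis j = fun v => (a + inner ℝ b v + c * ‖v‖ ^ 2) * sqrtMaxw v := by
      fin_cases j
      · exact ⟨1, 0, 0, by ext v; simp [nullBasis]⟩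
      · exact ⟨0, EuclideanSpace.single 0 1, 0, by ext v; simp [nullBasis, EuclideanSpace.inner_single_left]⟩
      · exact ⟨0, EuclideanSpace.single 1 1, 0, by ext v; simp [nullBasis, EuclideanSpace.inner_single_left]⟩
      · exact ⟨0, EuclideanSpace.single 2 1, 0, by ext v; simp [nullBasis, EuclideanSpace.inner_single_left]⟩
      · exact ⟨-3 / 2, 0, 1 / 2, by ext v; simp only [nullBasis, inner_zero_left]; simp; left; ring⟩
    obtain ⟨a, b, c, e⟩ := e
    rw [e, H]

lemma InNullPerp.comp {h : E3 → ℝ} (hh : InNullPerp h) (R : E3 ≃ₗᵢ[ℝ] E3) :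
    InNullPerp fun x => h (R x) := by
  rw [inNullPerp_iff] at hh ⊢
  refine ⟨hh.1.comp_measurePreserving R.measurePreserving, fun a b c => ?_⟩
  have e := hh.2 a (R b) c
  rw [← pair_comp R] at e
  simpa only [R.inner_map_map, R.norm_map, sqrtMaxw_map] using e

lemma InNullPerp.add {h k : E3 → ℝ} (hh : InNullPerp h) (hk : InNullPerp k) : InNullPerp (h + k) :=
  ⟨hh.1.add hk.1, fun j => by
    rw [pair_add_left hh.1 hk.1 (memLp_nullBasis j), hh.2, hk.2, add_zero]⟩

lemma InNullPerp.smul {h : E3 → ℝ} (hh : InNullPerp h) (c : ℝ) : InNullPerp (c • h) :=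
  ⟨hh.1.const_smul c, fun j => by rw [pair_smul_left, hh.2, mul_zero]⟩

namespace IsLInv

lemma domL {g h : E3 → ℝ} (H : IsLInv g h) : DomL h := ⟨H.1.1, H.2.1⟩

lemma linL_eq {g h : E3 → ℝ} (H : IsLInv g h) : linL h = g := funext H.2.2

lemma add {g h g' h' : E3 → ℝ} (H : IsLInv g h) (H' : IsLInv g' h') :
    IsLInv (g + g') (h + h') :=
  ⟨H.1.add H'.1, (H.domL.add H'.domL).2, fun v => by
    rw [Pi.add_apply, ← H.2.2, ← H'.2.2]
    exact linL_add_of_memLp H.1.1 H'.1.1 v⟩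

lemma smul {g h : E3 → ℝ} (H : IsLInv g h) (c : ℝ) : IsLInv (c • g) (c • h) :=
  ⟨H.1.smul c, (H.domL.const_mul c).2, fun v => by
    rw [Pi.smul_apply, smul_eq_mul, ← H.2.2]
    exact linL_const_mul h c v⟩

lemma comp {g h : E3 → ℝ} (H : IsLInv g h) (R : E3 ≃ₗᵢ[ℝ] E3) :
    IsLInv (fun x => g (R x)) fun x => h (R x) :=
  ⟨H.1.comp R, (H.domL.comp R).2, fun v => by rw [linL_comp, H.2.2]⟩

/-- Self-adjointness of `L⁻¹`. -/
lemma pair_comm {g h g' h' : E3 → ℝ} (H : IsLInv g h) (H' : IsLInv g' h') :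
    pair h g' = pair h' g := by
  have e := H.domL.pair_linL_comm H'.domL
  rw [H.linL_eq, H'.linL_eq] at e
  rw [← e, HilbertExpansion.pair_comm]

lemma zero : IsLInv 0 0 := by
  refine ⟨⟨MemLp.zero, fun j => by simp [pair]⟩, by simp, fun v => ?_⟩
  rw [show (0 : E3 → ℝ) = fun w => 0 * (0 : E3 → ℝ) w by ext; simp, linL_const_mul]
  simp

end IsLInv

/-! ### The range of `L` -/

/-- The square integrable functions in the range of `L`. -/
def rangeL : Submodule ℝ (E3 → ℝ) where
  carrier := {g | MemLp g 2 ∧ ∃ h, IsLInv g h}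
  add_mem' := fun ⟨m, h, H⟩ ⟨m', h', H'⟩ => ⟨m.add m', h + h', H.add H'⟩
  zero_mem' := ⟨MemLp.zero, 0, .zero⟩
  smul_mem' := fun c _ ⟨m, h, H⟩ => ⟨m.const_smul c, c • h, H.smul c⟩

lemma comp_mem_rangeL {g : E3 → ℝ} (hg : g ∈ rangeL) (R : E3 ≃ₗᵢ[ℝ] E3) :
    (fun v => g (R v)) ∈ rangeL := by
  obtain ⟨m, h, H⟩ := hg
  exact ⟨m.comp_measurePreserving R.measurePreserving, _, H.comp R⟩

lemma isLInv_linLInv {g : E3 → ℝ} (hg : ∃ h, IsLInv g h) : IsLInv g (linLInv g) := by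
  unfold linLInv
  rw [dif_pos hg]
  exact hg.choose_spec

lemma linLInv_of_not {g : E3 → ℝ} (hg : ¬∃ h, IsLInv g h) : linLInv g = 0 := by
  unfold linLInv
  rw [dif_neg hg]

/-- The quadratic form `⟨L⁻¹ g, g'⟩`. -/
def invForm (g g' : E3 → ℝ) : ℝ := pair (linLInv g) g'

section invForm

variable {g g' k : E3 → ℝ}

/-- The chosen preimage may be replaced by any other: if `k = L l`, self-adjointness turns `⟨h, k⟩`
into `⟨l, g⟩`, in which `h` does not occur. On the range the form is thus well defined without
uniqueness of `L⁻¹`. -/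
lemma invForm_eq {h : E3 → ℝ} (H : IsLInv g h) (hk : k ∈ rangeL) : invForm g k = pair h k := by
  obtain ⟨-, l, K⟩ := hk
  rw [invForm, (isLInv_linLInv ⟨h, H⟩).pair_comm K, H.pair_comm K]

lemma invForm_comm (hg : g ∈ rangeL) (hk : k ∈ rangeL) : invForm g k = invForm k g :=
  (isLInv_linLInv hg.2).pair_comm (isLInv_linLInv hk.2)

lemma invForm_add_right (hg : g ∈ rangeL) (hg' : g' ∈ rangeL) (hk : k ∈ rangeL) :
    invForm k (g + g') = invForm k g + invForm k g' :=
  pair_add_right hg.1 hg'.1 (isLInv_linLInv hk.2).1.1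

lemma invForm_smul_right (c : ℝ) : invForm k (c • g) = c * invForm k g :=
  pair_smul_right _ _ _

lemma invForm_add_left (hg : g ∈ rangeL) (hg' : g' ∈ rangeL) (hk : k ∈ rangeL) :
    invForm (g + g') k = invForm g k + invForm g' k := by
  rw [invForm_comm (rangeL.add_mem hg hg') hk, invForm_add_right hg hg' hk, invForm_comm hk hg,
    invForm_comm hk hg']

lemma invForm_smul_left (c : ℝ) (hg : g ∈ rangeL) (hk : k ∈ rangeL) :
    invForm (c • g) k = c * invForm g k := by
  rw [invForm_comm (rangeL.smul_mem c hg) hk, invForm_smul_right, invForm_comm hk hg]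

lemma invForm_comp (hg : g ∈ rangeL) (hk : k ∈ rangeL) (R : E3 ≃ₗᵢ[ℝ] E3) :
    invForm (fun v => g (R v)) (fun v => k (R v)) = invForm g k := by
  rw [invForm_eq ((isLInv_linLInv hg.2).comp R) (comp_mem_rangeL hk R), pair_comp, invForm]

end invForm

/-! ### Isometries adapted to the coordinates -/

/-- The sign change of the coordinate `m`. -/
def flip (m : Fin 3) : E3 ≃ₗᵢ[ℝ] E3 :=
  LinearIsometryEquiv.piLpCongrRight 2 fun i =>
    if i = m then LinearIsometryEquiv.neg ℝ else LinearIsometryEquiv.refl ℝ ℝ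

/-- The sign of the coordinate `i` under `flip m`. -/
def flipSign (m i : Fin 3) : ℝ := if i = m then -1 else 1

lemma flip_apply (m : Fin 3) (v : E3) (i : Fin 3) : flip m v i = flipSign m i * v i := by
  unfold flip flipSign
  rw [LinearIsometryEquiv.piLpCongrRight_apply]
  by_cases h : i = m <;> simp [h]

/-- The permutation of the coordinates by `σ`. -/
def permute (σ : Equiv.Perm (Fin 3)) : E3 ≃ₗᵢ[ℝ] E3 :=
  LinearIsometryEquiv.piLpCongrLeft 2 ℝ ℝ σ.symm

lemma permute_apply (σ : Equiv.Perm (Fin 3)) (v : E3) (i : Fin 3) : permute σ v i = v (σ i) := by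
  simp [permute, LinearIsometryEquiv.piLpCongrLeft_apply, Equiv.piCongrLeft']

/-- The reflection `v ↦ ((v₀ + v₁)/√2, (v₀ - v₁)/√2, v₂)`. -/
def diagonalize : E3 ≃ₗᵢ[ℝ] E3 :=
  LinearIsometry.toLinearIsometryEquiv
    { toFun := fun v => !₂[(v 0 + v 1) / Real.sqrt 2, (v 0 - v 1) / Real.sqrt 2, v 2]
      map_add' := fun v w => by
        ext i; fin_cases i <;> simp <;> ring
      map_smul' := fun c v => by
        ext i; fin_cases i <;> simp <;> ring
      norm_map' := fun v => by
        have h2 : Real.sqrt 2 ^ 2 = 2 := Real.sq_sqrt (by norm_num)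
        simp only [LinearMap.coe_mk, AddHom.coe_mk]
        rw [EuclideanSpace.norm_eq, EuclideanSpace.norm_eq]
        congr 1
        simp [Fin.sum_univ_three, div_pow]
        ring } rfl

lemma diagonalize_apply_zero (v : E3) : diagonalize v 0 = (v 0 + v 1) / Real.sqrt 2 := rfl

lemma diagonalize_apply_one (v : E3) : diagonalize v 1 = (v 0 - v 1) / Real.sqrt 2 := rfl

lemma exists_perm {i j : Fin 3} (h : i ≠ j) : ∃ σ : Equiv.Perm (Fin 3), σ 0 = i ∧ σ 1 = j := by
  revert i j; decide

/-! ### Stress and heat flux -/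

/-- The viscous stress `(v_i v_j - |v|² δ_ij / 3) √μ`. -/
def devSrc (i j : Fin 3) (v : E3) : ℝ := (v i * v j - ‖v‖ ^ 2 / 3 * kron i j) * sqrtMaxw v

/-- The heat flux `(|v|² - 5)/2 v_i √μ`. -/
def heatSrc (i : Fin 3) (v : E3) : ℝ := (‖v‖ ^ 2 - 5) / 2 * v i * sqrtMaxw v

lemma memLp_devSrc (i j : Fin 3) : MemLp (devSrc i j) 2 :=
  ModGrowth.memLp_mul_sqrtMaxw (((ModGrowth.coord i).mul (.coord j)).sub
    ((ModGrowth.norm_sq.mul (.const (1 / 3))).mul (.const (kron i j)) |>.congr fun v => by ring))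

lemma memLp_heatSrc (i : Fin 3) : MemLp (heatSrc i) 2 :=
  ModGrowth.memLp_mul_sqrtMaxw ((((ModGrowth.norm_sq.sub (.const 5)).mul (.const (1 / 2))).mul
    (.coord i)).congr fun v => by ring)

lemma devSrc_comm (i j : Fin 3) : devSrc i j = devSrc j i := by
  ext v; rw [devSrc, devSrc, kron_comm]; ring

lemma devSrc_trace : devSrc 0 0 + (devSrc 1 1 + devSrc 2 2) = 0 := by
  ext v
  simp [devSrc, norm_sq_eq_sum, Fin.sum_univ_three, kron]
  ring

lemma flipSign_mul_self (m i : Fin 3) : flipSign m i * flipSign m i = 1 := by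
  unfold flipSign; split <;> norm_num

lemma flipSign_mul_kron (m i j : Fin 3) : flipSign m i * flipSign m j * kron i j = kron i j := by
  unfold kron
  split_ifs with h
  · rw [h, flipSign_mul_self, one_mul]
  · simp

lemma devSrc_flip (m i j : Fin 3) :
    (fun v => devSrc i j (flip m v)) = (flipSign m i * flipSign m j) • devSrc i j := by
  ext v
  simp only [devSrc, flip_apply, LinearIsometryEquiv.norm_map, sqrtMaxw_map, Pi.smul_apply, smul_eq_mul]
  linear_combination (‖v‖ ^ 2 / 3 * sqrtMaxw v) * flipSign_mul_kron m i j

lemma heatSrc_flip (m i : Fin 3) : (fun v => heatSrc i (flip m v)) = flipSign m i • heatSrc i := by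
  ext v
  simp only [heatSrc, flip_apply, LinearIsometryEquiv.norm_map, sqrtMaxw_map, Pi.smul_apply, smul_eq_mul]
  ring

lemma devSrc_permute (σ : Equiv.Perm (Fin 3)) (i j : Fin 3) :
    (fun v => devSrc i j (permute σ v)) = devSrc (σ i) (σ j) := by
  ext v
  simp [devSrc, permute_apply, sqrtMaxw_map, kron]

lemma heatSrc_permute (σ : Equiv.Perm (Fin 3)) (i : Fin 3) :
    (fun v => heatSrc i (permute σ v)) = heatSrc (σ i) := by
  ext v
  simp [heatSrc, permute_apply, sqrtMaxw_map]

/-- This isometry turns `v₀v₁` into `(v₀² - v₁²)/2`; it is the link between off-diagonal and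
diagonal stresses that sign changes and permutations cannot provide. -/
lemma devSrc_diagonalize :
    (fun v => devSrc 0 1 (diagonalize v)) = (1 / 2 : ℝ) • (devSrc 0 0 + (-1 : ℝ) • devSrc 1 1) := by
  ext v
  have h2 : Real.sqrt 2 * Real.sqrt 2 = 2 := Real.mul_self_sqrt (by norm_num)
  simp only [devSrc, LinearIsometryEquiv.norm_map, sqrtMaxw_map, diagonalize_apply_zero,
    diagonalize_apply_one, Pi.smul_apply, Pi.add_apply, smul_eq_mul, div_mul_div_comm, h2]
  simp only [kron, if_true, if_false, zero_ne_one]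
  ring

lemma devSrc_sub_diagonalize :
    (fun v => (devSrc 0 0 + (-1 : ℝ) • devSrc 1 1) (diagonalize v)) = (2 : ℝ) • devSrc 0 1 := by
  ext v
  have h2 : Real.sqrt 2 * Real.sqrt 2 = 2 := Real.mul_self_sqrt (by norm_num)
  simp only [devSrc, Pi.add_apply, Pi.smul_apply, smul_eq_mul, LinearIsometryEquiv.norm_map, sqrtMaxw_map, diagonalize_apply_zero,
    diagonalize_apply_one, div_mul_div_comm, h2]
  simp only [kron, if_true, if_false, zero_ne_one]
  ring

/-! ### Isotropy of the range -/

lemma devSrc_permute_mem {i j : Fin 3} (h : devSrc i j ∈ rangeL) (σ : Equiv.Perm (Fin 3)) :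
    devSrc (σ i) (σ j) ∈ rangeL := by
  rw [← devSrc_permute]; exact comp_mem_rangeL h _

lemma devSrc_sub_permute_mem {i j : Fin 3} (h : devSrc i i + (-1 : ℝ) • devSrc j j ∈ rangeL)
    (σ : Equiv.Perm (Fin 3)) :
    devSrc (σ i) (σ i) + (-1 : ℝ) • devSrc (σ j) (σ j) ∈ rangeL := by
  rw [← devSrc_permute, ← devSrc_permute]; exact comp_mem_rangeL h (permute σ)

lemma devSrc_mem_of_ne {i j : Fin 3} (hij : i ≠ j) (h : devSrc i j ∈ rangeL) :
    devSrc 0 1 ∈ rangeL := by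
  obtain ⟨σ, rfl, rfl⟩ := exists_perm hij
  simpa using devSrc_permute_mem h σ.symm

lemma devSrc_mem_of_sub {i j : Fin 3} (hij : i ≠ j)
    (h : devSrc i i + (-1 : ℝ) • devSrc j j ∈ rangeL) : devSrc 0 1 ∈ rangeL := by
  obtain ⟨σ, rfl, rfl⟩ := exists_perm hij
  have h1 := devSrc_sub_permute_mem h σ.symm
  simp only [Equiv.symm_apply_apply] at h1
  have h2 := comp_mem_rangeL h1 diagonalize
  rw [devSrc_sub_diagonalize] at h2
  exact (rangeL.smul_mem_iff two_ne_zero).1 h2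

/-- If one stress component lies in the range of `L` then all do. -/
lemma devSrc_mem (h : devSrc 0 1 ∈ rangeL) (i j : Fin 3) : devSrc i j ∈ rangeL := by
  rcases eq_or_ne i j with rfl | hij
  · have h1 := comp_mem_rangeL h diagonalize
    rw [devSrc_diagonalize, rangeL.smul_mem_iff (by norm_num)] at h1
    have h2 := devSrc_sub_permute_mem h1 (Equiv.swap 1 2)
    -- Only differences of diagonal stresses are reachable so far; the vanishing trace recovers a
    -- single one.
    have e : devSrc 0 0 = (1 / 3 : ℝ) • ((devSrc 0 0 + (-1 : ℝ) • devSrc 1 1)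
        + (devSrc 0 0 + (-1 : ℝ) • devSrc 2 2)) := by
      ext v
      have := congrFun devSrc_trace v
      simp only [Pi.add_apply, Pi.smul_apply, smul_eq_mul, Pi.zero_apply] at this ⊢
      linarith
    have h0 : devSrc 0 0 ∈ rangeL := by
      rw [e]
      refine rangeL.smul_mem _ (rangeL.add_mem h1 ?_)
      have e0 : Equiv.swap (1 : Fin 3) 2 0 = 0 := by decide
      simpa [e0] using h2
    simpa using devSrc_permute_mem h0 (Equiv.swap 0 i)
  · obtain ⟨σ, rfl, rfl⟩ := exists_perm hij
    exact devSrc_permute_mem h σ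

lemma devSrc_zero_one_mem {i j : Fin 3} (h : devSrc i j ∈ rangeL) : devSrc 0 1 ∈ rangeL := by
  rcases eq_or_ne i j with rfl | hij
  · obtain ⟨j, hj⟩ := exists_ne i
    have h1 := devSrc_permute_mem h (Equiv.swap i j)
    rw [Equiv.swap_apply_left] at h1
    exact devSrc_mem_of_sub hj.symm (rangeL.add_mem h (rangeL.smul_mem _ h1))
  · exact devSrc_mem_of_ne hij h

/-- The stress with coefficients `S`. -/
def devSum (S : Fin 3 → Fin 3 → ℝ) : E3 → ℝ := ∑ i, ∑ j, S i j • devSrc i j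

lemma devSum_apply (S : Fin 3 → Fin 3 → ℝ) (v : E3) :
    devSum S v = ∑ i, ∑ j, S i j * devSrc i j v := by
  simp [devSum, Finset.sum_apply]

/-- Antisymmetrizing under the sign changes of coordinates `i` and `j` keeps only the components odd
in both, that is `ij` and `ji`, and doubles them each time; hence the factor `4`. -/
lemma devSrc_mem_of_devSum {S : Fin 3 → Fin 3 → ℝ} (hS : devSum S ∈ rangeL) {i j : Fin 3}
    (hij : i ≠ j) (h : S i j + S j i ≠ 0) : devSrc i j ∈ rangeL := by
  have h1 := rangeL.sub_mem hS (comp_mem_rangeL hS (flip i))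
  have h2 := rangeL.sub_mem h1 (comp_mem_rangeL h1 (flip j))
  have hd : ∀ m i j v, devSrc i j (flip m v) = flipSign m i * flipSign m j * devSrc i j v :=
    fun m i j v => congrFun (devSrc_flip m i j) v
  rw [← rangeL.smul_mem_iff (mul_ne_zero four_ne_zero h)]
  convert h2 using 1
  ext v
  have c01 : devSrc 1 0 v = devSrc 0 1 v := by rw [devSrc_comm]
  have c02 : devSrc 2 0 v = devSrc 0 2 v := by rw [devSrc_comm]
  have c12 : devSrc 2 1 v = devSrc 1 2 v := by rw [devSrc_comm]
  simp only [Pi.smul_apply, Pi.sub_apply, smul_eq_mul, devSum_apply, hd, Fin.sum_univ_three]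
  fin_cases i <;> fin_cases j <;> simp [flipSign, c01, c02, c12] at hij ⊢ <;> ring

lemma heatSrc_permute_mem {i : Fin 3} (h : heatSrc i ∈ rangeL) (σ : Equiv.Perm (Fin 3)) :
    heatSrc (σ i) ∈ rangeL := by
  rw [← heatSrc_permute]; exact comp_mem_rangeL h _

lemma heatSrc_mem {i : Fin 3} (h : heatSrc i ∈ rangeL) (j : Fin 3) : heatSrc j ∈ rangeL := by
  simpa using heatSrc_permute_mem h (Equiv.swap i j)

/-- Either every stress lies in the range of `L`, or no nonzero one does. -/
lemma devSum_dichotomy {S : Fin 3 → Fin 3 → ℝ} (hS : devSum S ∈ rangeL) :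
    devSrc 0 1 ∈ rangeL ∨ devSum S = 0 := by
  by_cases h : devSrc 0 1 ∈ rangeL
  · exact .inl h
  right
  have hoff : ∀ i j, i ≠ j → S i j + S j i = 0 := fun i j hij => by
    by_contra h0
    exact h (devSrc_mem_of_ne hij (devSrc_mem_of_devSum hS hij h0))
  have e01 := hoff 0 1 (by decide)
  have e02 := hoff 0 2 (by decide)
  have e12 := hoff 1 2 (by decide)
  have hg : devSum S = ∑ i, S i i • devSrc i i := by
    ext v
    have c01 : devSrc 1 0 v = devSrc 0 1 v := by rw [devSrc_comm]
    have c02 : devSrc 2 0 v = devSrc 0 2 v := by rw [devSrc_comm]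
    have c12 : devSrc 2 1 v = devSrc 1 2 v := by rw [devSrc_comm]
    simp only [devSum_apply, Fin.sum_univ_three, c01, c02, c12, Pi.add_apply, Pi.smul_apply, smul_eq_mul]
    linear_combination (devSrc 0 1 v) * e01 + (devSrc 0 2 v) * e02 + (devSrc 1 2 v) * e12
  -- Subtracting the image under the exchange of coordinates `0` and `j` leaves `S 0 0 - S j j`
  -- times a difference of diagonal stresses, which cannot lie in the range unless the coefficient
  -- is zero. Equal diagonal entries then give a multiple of the vanishing trace.
  have hdiag : ∀ j, S 0 0 = S j j := by
    intro j
    rcases eq_or_ne 0 j with rfl | hj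
    · rfl
    by_contra hne
    refine h (devSrc_mem_of_sub hj ((rangeL.smul_mem_iff (sub_ne_zero.2 hne)).1 ?_))
    have h1 := rangeL.sub_mem hS (comp_mem_rangeL hS (permute (Equiv.swap 0 j)))
    convert h1 using 1
    ext v
    have hd : ∀ i k, devSrc i k (permute (Equiv.swap 0 j) v)
        = devSrc (Equiv.swap 0 j i) (Equiv.swap 0 j k) v :=
      fun i k => congrFun (devSrc_permute _ i k) v
    simp only [hg, Fin.sum_univ_three, Pi.add_apply, Pi.sub_apply, Pi.smul_apply, smul_eq_mul, hd]
    have s1 : Equiv.swap (0 : Fin 3) 1 2 = 2 := by decide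
    have s2 : Equiv.swap (0 : Fin 3) 2 1 = 1 := by decide
    fin_cases j
    · simp at hj
    · simp [s1]; ring
    · simp [s2]; ring
  rw [hg]
  ext v
  have := congrFun devSrc_trace v
  simp only [Fin.sum_univ_three, Pi.add_apply, Pi.smul_apply, smul_eq_mul, Pi.zero_apply] at this ⊢
  linear_combination (S 0 0) * this - (devSrc 1 1 v) * hdiag 1 - (devSrc 2 2 v) * hdiag 2

/-- The heat flux with coefficients `c`. -/
def heatSum (c : Fin 3 → ℝ) : E3 → ℝ := ∑ i, c i • heatSrc i

lemma heatSum_apply (c : Fin 3 → ℝ) (v : E3) : heatSum c v = ∑ i, c i * heatSrc i v := by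
  simp [heatSum, Finset.sum_apply]

/-- Antisymmetrizing under the sign change of coordinate `i` isolates `2 c_i` times the `i`-th flux;
one nonzero coefficient therefore puts every flux in the range. -/
lemma heatSum_dichotomy {c : Fin 3 → ℝ} (hc : heatSum c ∈ rangeL) :
    heatSrc 0 ∈ rangeL ∨ heatSum c = 0 := by
  by_cases h : ∀ i, c i = 0
  · right; simp [heatSum, h]
  left
  push Not at h
  obtain ⟨i, hi⟩ := h
  refine heatSrc_mem (i := i) ((rangeL.smul_mem_iff (mul_ne_zero two_ne_zero hi)).1 ?_) 0
  convert rangeL.sub_mem hc (comp_mem_rangeL hc (flip i)) using 1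
  ext v
  have hd : ∀ m i v, heatSrc i (flip m v) = flipSign m i * heatSrc i v :=
    fun m i v => congrFun (heatSrc_flip m i) v
  simp only [Pi.smul_apply, Pi.sub_apply, smul_eq_mul, heatSum_apply, hd, Fin.sum_univ_three]
  fin_cases i <;> simp [flipSign] <;> ring

/-! ### The transport coefficients -/

lemma linL_tensorA (h : devSrc 0 1 ∈ rangeL) (i j : Fin 3) : linL (tensorA i j) = devSrc i j :=
  (isLInv_linLInv (devSrc_mem h i j).2).linL_eq

lemma linL_vectorB (h : heatSrc 0 ∈ rangeL) (i : Fin 3) : linL (vectorB i) = heatSrc i :=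
  (isLInv_linLInv (heatSrc_mem h i).2).linL_eq

/-- Outside the range `linLInv` takes its default value. As the stresses enter the range all
together, all `A_ij` vanish at once, and with them `η_v`. -/
lemma tensorA_eq_zero (h : devSrc 0 1 ∉ rangeL) (i j : Fin 3) : tensorA i j = 0 :=
  linLInv_of_not fun H => h (devSrc_zero_one_mem ⟨memLp_devSrc i j, H⟩)

lemma vectorB_eq_zero (h : heatSrc 0 ∉ rangeL) (i : Fin 3) : vectorB i = 0 :=
  linLInv_of_not fun H => h (heatSrc_mem ⟨memLp_heatSrc i, H⟩ 0)

lemma etaV_eq (h : devSrc 0 1 ∈ rangeL) : etaV = invForm (devSrc 0 1) (devSrc 0 1) := by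
  rw [etaV, linL_tensorA h]; rfl

lemma etaV_eq_zero (h : devSrc 0 1 ∉ rangeL) : etaV = 0 := by
  rw [etaV, tensorA_eq_zero h]; simp [pair]

lemma etaC_eq (h : heatSrc 0 ∈ rangeL) : etaC = 2 / 5 * invForm (heatSrc 0) (heatSrc 0) := by
  rw [etaC, linL_vectorB h, pair_comm]; rfl

lemma etaC_eq_zero (h : heatSrc 0 ∉ rangeL) : etaC = 0 := by
  rw [etaC, vectorB_eq_zero h]; simp [pair]

/-! ### Isotropy of the form `⟨L⁻¹ g, g'⟩` on stresses and heat fluxes -/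

lemma invForm_devSrc_flip (h : devSrc 0 1 ∈ rangeL) (m i j k l : Fin 3) :
    invForm (devSrc i j) (devSrc k l) = flipSign m i * flipSign m j * flipSign m k * flipSign m l
      * invForm (devSrc i j) (devSrc k l) := by
  have e := invForm_comp (devSrc_mem h i j) (devSrc_mem h k l) (flip m)
  rw [devSrc_flip, devSrc_flip, invForm_smul_right,
    invForm_smul_left _ (devSrc_mem h i j) (devSrc_mem h k l)] at e
  linear_combination -e

lemma invForm_devSrc_permute (h : devSrc 0 1 ∈ rangeL) (σ : Equiv.Perm (Fin 3)) (i j k l : Fin 3) :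
    invForm (devSrc (σ i) (σ j)) (devSrc (σ k) (σ l)) = invForm (devSrc i j) (devSrc k l) := by
  rw [← devSrc_permute, ← devSrc_permute]
  exact invForm_comp (devSrc_mem h i j) (devSrc_mem h k l) _

/-- Two linear equations for the two diagonal values `a` and `b`: the vanishing trace gives `a + 2b
= 0`, and the diagonalizing isometry gives `η_v = (a - b)/2`. -/
lemma invForm_devSrc_diag (h : devSrc 0 1 ∈ rangeL) :
    invForm (devSrc 0 0) (devSrc 0 0) = 4 / 3 * etaV ∧
      invForm (devSrc 0 0) (devSrc 1 1) = -(2 / 3) * etaV := by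
  have m := devSrc_mem h
  have t : invForm (devSrc 0 0) (devSrc 0 0) + 2 * invForm (devSrc 0 0) (devSrc 1 1) = 0 := by
    have e : invForm (devSrc 0 0) (devSrc 0 0 + (devSrc 1 1 + devSrc 2 2)) = 0 := by
      rw [devSrc_trace]; simp [invForm, pair]
    rw [invForm_add_right (m _ _) (rangeL.add_mem (m _ _) (m _ _)) (m _ _),
      invForm_add_right (m _ _) (m _ _) (m _ _)] at e
    have e2 := invForm_devSrc_permute h (Equiv.swap 1 2) 0 0 1 1
    have e0 : Equiv.swap (1 : Fin 3) 2 0 = 0 := by decide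
    rw [e0, Equiv.swap_apply_left] at e2
    linarith
  have d : etaV = 1 / 2 * (invForm (devSrc 0 0) (devSrc 0 0) - invForm (devSrc 0 0) (devSrc 1 1)) := by
    have e := invForm_comp (m 0 1) (m 0 1) diagonalize
    have p1 := rangeL.smul_mem (-1 : ℝ) (m 1 1)
    have p2 := rangeL.add_mem (m 0 0) p1
    rw [devSrc_diagonalize, invForm_smul_right, invForm_smul_left _ p2 p2,
      invForm_add_right (m _ _) p1 p2, invForm_smul_right, invForm_add_left (m _ _) p1 (m _ _),
      invForm_add_left (m _ _) p1 (m _ _), invForm_smul_left _ (m _ _) (m _ _),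
      invForm_smul_left _ (m _ _) (m _ _), invForm_comm (m 1 1) (m 0 0), ← etaV_eq h] at e
    have e2 := invForm_devSrc_permute h (Equiv.swap 0 1) 0 0 0 0
    rw [Equiv.swap_apply_left] at e2
    rw [e2] at e
    linarith
  constructor <;> linarith

lemma invForm_devSrc (h : devSrc 0 1 ∈ rangeL) (i j k l : Fin 3) :
    invForm (devSrc i j) (devSrc k l)
      = etaV * (kron i k * kron j l + kron i l * kron j k - 2 / 3 * (kron i j * kron k l)) := by
  -- Either some coordinate `m` occurs an odd number of times among the four indices, and its sign
  -- change annihilates the value, or the indices match in pairs in one of three patterns, each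
  -- reducible by a permutation.
  have hc : (∃ m, ((i = m) ^^ (j = m) ^^ (k = m) ^^ (l = m)) ∧ ¬(i = k ∧ j = l) ∧ ¬(i = l ∧ j = k) ∧
      ¬(i = j ∧ k = l)) ∨ (i = j ∧ k = l) ∨ (i ≠ j ∧ i = k ∧ j = l) ∨ (i ≠ j ∧ i = l ∧ j = k) := by
    revert i j k l; decide
  rcases hc with ⟨m, hm, n1, n2, n3⟩ | ⟨rfl, rfl⟩ | ⟨hij, rfl, rfl⟩ | ⟨hij, rfl, rfl⟩
  · have e := invForm_devSrc_flip h m i j k l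
    have hs : flipSign m i * flipSign m j * flipSign m k * flipSign m l = -1 := by
      unfold flipSign
      by_cases a : i = m <;> by_cases b : j = m <;> by_cases c : k = m <;> by_cases d : l = m <;>
        simp [a, b, c, d] at hm ⊢
    have k1 : kron i k * kron j l = 0 := by
      unfold kron; split_ifs <;> simp_all
    have k2 : kron i l * kron j k = 0 := by
      unfold kron; split_ifs <;> simp_all
    have k3 : kron i j * kron k l = 0 := by
      unfold kron; split_ifs <;> simp_all
    rw [hs] at e
    rw [k1, k2, k3]
    linarith
  · rcases eq_or_ne i k with rfl | hik
    · have e := invForm_devSrc_permute h (Equiv.swap 0 i) 0 0 0 0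
      rw [Equiv.swap_apply_left, (invForm_devSrc_diag h).1] at e
      rw [e]; simp [kron]; ring
    · obtain ⟨σ, rfl, rfl⟩ := exists_perm hik
      rw [invForm_devSrc_permute h, (invForm_devSrc_diag h).2]; simp [kron]
      ring
  · obtain ⟨σ, rfl, rfl⟩ := exists_perm hij
    rw [invForm_devSrc_permute h, ← etaV_eq h]; simp [kron]
  · obtain ⟨σ, rfl, rfl⟩ := exists_perm hij
    rw [invForm_devSrc_permute h, devSrc_comm 1 0, ← etaV_eq h]; simp [kron]

lemma invForm_heatSrc (h : heatSrc 0 ∈ rangeL) (k j : Fin 3) :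
    invForm (heatSrc k) (heatSrc j) = 5 / 2 * etaC * kron k j := by
  have m := heatSrc_mem h
  rcases eq_or_ne k j with rfl | hkj
  · have e := invForm_comp (m 0) (m 0) (permute (Equiv.swap 0 k))
    rw [heatSrc_permute, Equiv.swap_apply_left] at e
    rw [e, etaC_eq h]; simp [kron]; ring
  · have e := invForm_comp (m k) (m j) (flip k)
    rw [heatSrc_flip, heatSrc_flip, invForm_smul_right, invForm_smul_left _ (m _) (m _)] at e
    simp [flipSign, hkj.symm] at e
    simp [kron, hkj]
    linarith

theorem pair_tensorA (i j k l : Fin 3) : pair (tensorA i j) (linL (tensorA k l)) =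
    etaV * (kron i k * kron j l + kron i l * kron j k - 2 / 3 * (kron i j * kron k l)) := by
  by_cases h : devSrc 0 1 ∈ rangeL
  · rw [linL_tensorA h, ← invForm_devSrc h]; rfl
  · rw [tensorA_eq_zero h, etaV_eq_zero h]; simp [pair]

theorem pair_vectorB (k j : Fin 3) :
    pair (linL (vectorB k)) (vectorB j) = 5 / 2 * etaC * kron k j := by
  by_cases h : heatSrc 0 ∈ rangeL
  · rw [linL_vectorB h, pair_comm, kron_comm, ← invForm_heatSrc h]; rfl
  · rw [vectorB_eq_zero h j, etaC_eq_zero h]; simp [pair]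

/-! ### Products with the Maxwellian -/

lemma pair_mul_sqrtMaxw {P Q : E3 → ℝ} {I : ℝ} (h : HasMean (fun v => P v * Q v) I) :
    pair (fun v => P v * sqrtMaxw v) (fun v => Q v * sqrtMaxw v) = I := by
  rw [← h.2]
  unfold pair
  congr 1 with v
  rw [← sqrtMaxw_mul_self]; ring

/-- The polynomial factor of `nullBasis`. -/
def nullPoly (j : Fin 5) (v : E3) : ℝ := (![1, v 0, v 1, v 2, (‖v‖ ^ 2 - 3) / 2] : Fin 5 → ℝ) j

lemma nullBasis_eq (j : Fin 5) : nullBasis j = fun v => nullPoly j v * sqrtMaxw v := rfl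

/-- The squared norms of `nullBasis`. -/
def nullNorm (j : Fin 5) : ℝ := (![1, 1, 1, 1, 3 / 2] : Fin 5 → ℝ) j

lemma nullNorm_ne_zero (j : Fin 5) : nullNorm j ≠ 0 := by
  unfold nullNorm; fin_cases j <;> norm_num

lemma ModGrowth.nullPoly' (j : Fin 5) : ModGrowth (nullPoly j) := by
  fin_cases j
  · exact .const 1
  · exact .coord 0
  · exact .coord 1
  · exact .coord 2
  · exact ((ModGrowth.norm_sq.sub (.const 3)).const_mul (1 / 2)).congr fun v => by
      simp [HilbertExpansion.nullPoly]; ring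

lemma collInvariant_nullPoly (j : Fin 5) : CollInvariant (nullPoly j) := by
  intro v w s
  fin_cases j
  · rfl
  · exact vPost_apply_add v w s 0
  · exact vPost_apply_add v w s 1
  · exact vPost_apply_add v w s 2
  · have := norm_sq_post v w s
    simp [nullPoly]
    linarith

lemma hasMean_heat_weight : HasMean (fun v => (‖v‖ ^ 2 - 3) / 2) 0 :=
  ((hasMean_norm_sq.sub (hasMean_one.const_mul 3)).const_mul (1 / 2)).congr
    (fun v => by ring) (by norm_num)

lemma hasMean_nullPoly_mul (i j : Fin 5) :
    HasMean (fun v => nullPoly i v * nullPoly j v) (if i = j then nullNorm i else 0) := by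
  have sym : ∀ {P Q : E3 → ℝ} {I : ℝ}, HasMean (fun v => P v * Q v) I →
      HasMean (fun v => Q v * P v) I := fun h => h.congr (fun v => mul_comm _ _) rfl
  have c : ∀ (i j : Fin 3) (I : ℝ), I = kron i j → HasMean (fun v => v i * v j) I := fun i j I h =>
    (hasMean_coord_coord i j).congr (fun v => rfl) h
  have z : ∀ i : Fin 3, HasMean (fun v => v i * ((‖v‖ ^ 2 - 3) / 2)) 0 := fun i =>
    .of_odd ((ModGrowth.coord i).mul hasMean_heat_weight.1) fun v => by simp
  have q : HasMean (fun v => (‖v‖ ^ 2 - 3) / 2 * ((‖v‖ ^ 2 - 3) / 2)) (3 / 2) :=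
    (((hasMean_norm_four.sub (hasMean_norm_sq.const_mul 6)).add (hasMean_one.const_mul 9)).const_mul
      (1 / 4)).congr (fun v => by ring) (by norm_num)
  have o : ∀ {P : E3 → ℝ} {I : ℝ}, HasMean P I → HasMean (fun v => 1 * P v) I :=
    fun h => h.congr (fun v => one_mul _) rfl
  fin_cases i <;> fin_cases j
  · exact o hasMean_one
  · exact o (hasMean_coord 0)
  · exact o (hasMean_coord 1)
  · exact o (hasMean_coord 2)
  · exact o hasMean_heat_weight
  · exact sym (o (hasMean_coord 0))
  · exact c 0 0 _ (by simp [kron, nullNorm])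
  · exact c 0 1 _ (by simp [kron])
  · exact c 0 2 _ (by simp [kron])
  · exact z 0
  · exact sym (o (hasMean_coord 1))
  · exact c 1 0 _ (by simp [kron])
  · exact c 1 1 _ (by simp [kron, nullNorm])
  · exact c 1 2 _ (by simp [kron])
  · exact z 1
  · exact sym (o (hasMean_coord 2))
  · exact c 2 0 _ (by simp [kron])
  · exact c 2 1 _ (by simp [kron])
  · exact c 2 2 _ (by simp [kron, nullNorm])
  · exact z 2
  · exact sym (o hasMean_heat_weight)
  · exact sym (z 0)
  · exact sym (z 1)
  · exact sym (z 2)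
  · exact q

lemma pair_nullBasis (i j : Fin 5) :
    pair (nullBasis i) (nullBasis j) = if i = j then nullNorm i else 0 :=
  pair_mul_sqrtMaxw (hasMean_nullPoly_mul i j)

/-! ### The projection -/

lemma projP_eq (g : E3 → ℝ) (v : E3) :
    projP g v = (∑ j, pair g (nullBasis j) / nullNorm j * nullPoly j v) * sqrtMaxw v := by
  rw [projP, Finset.sum_mul]
  refine Finset.sum_congr rfl fun j _ => ?_
  rw [pair_nullBasis, if_pos rfl, nullBasis_eq]; ring

lemma projP_eq_sum_smul (g : E3 → ℝ) :
    projP g = ∑ j, (pair g (nullBasis j) / nullNorm j) • nullBasis j := by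
  ext v
  rw [projP, Finset.sum_apply]
  refine Finset.sum_congr rfl fun j _ => ?_
  rw [pair_nullBasis, if_pos rfl]; rfl

lemma projP_eq_zero {g : E3 → ℝ} (h : ∀ j, pair g (nullBasis j) = 0) : projP g = 0 := by
  rw [projP_eq_sum_smul]; simp [h]

lemma pair_sum_left {ι : Type*} (t : Finset ι) {f : ι → E3 → ℝ} {k : E3 → ℝ}
    (hf : ∀ i ∈ t, MemLp (f i) 2) (hk : MemLp k 2) :
    pair (∑ i ∈ t, f i) k = ∑ i ∈ t, pair (f i) k := by
  unfold pair
  simp only [Finset.sum_apply, Finset.sum_mul]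
  exact integral_finsetSum _ fun i hi => (hf i hi).integrable_mul hk

lemma memLp_projP (g : E3 → ℝ) : MemLp (projP g) 2 := by
  rw [projP_eq_sum_smul]
  exact memLp_finsetSum' _ fun j _ => (memLp_nullBasis j).const_smul _

lemma pair_projP (g : E3 → ℝ) (j : Fin 5) : pair (projP g) (nullBasis j) = pair g (nullBasis j) := by
  rw [projP_eq_sum_smul, pair_sum_left _ (fun j _ => (memLp_nullBasis j).const_smul _)
    (memLp_nullBasis j)]
  simp only [pair_smul_left, pair_nullBasis]
  simp [nullNorm_ne_zero]

lemma pair_sub_left {f g k : E3 → ℝ} (hf : MemLp f 2) (hg : MemLp g 2) (hk : MemLp k 2) :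
    pair (f - g) k = pair f k - pair g k := by
  unfold pair
  simp only [Pi.sub_apply, sub_mul]
  exact integral_sub (hf.integrable_mul hk) (hg.integrable_mul hk)

lemma inNullPerp_sub_projP {g : E3 → ℝ} (hg : MemLp g 2) : InNullPerp (g - projP g) :=
  ⟨hg.sub (memLp_projP g), fun j => by
    rw [pair_sub_left hg (memLp_projP g) (memLp_nullBasis j), pair_projP, sub_self]⟩

lemma collInvariant_sum {ι : Type*} (t : Finset ι) (c : ι → ℝ) {ψ : ι → E3 → ℝ}
    (h : ∀ i, CollInvariant (ψ i)) : CollInvariant fun v => ∑ i ∈ t, c i * ψ i v := by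
  intro v w s
  simp only [← Finset.sum_add_distrib, ← mul_add, h _ v w s]

/-! ### Collision invariants -/

lemma gamKer_mul_sqrtMaxw (a b : E3 → ℝ) (v : E3) (p : E3 × S2) :
    gamKer (fun v => a v * sqrtMaxw v) (fun v => b v * sqrtMaxw v) v p
      = sqrtMaxw v * (sqrtMaxw p.1 * gamKer a b v p) := by
  have h := sqrtMaxw_post v p.1 p.2
  simp only [gamKer]
  linear_combination (|inner ℝ (v - p.1) (p.2 : E3)| * sqrtMaxw p.1 *
    (a (vPost v p.1 p.2) * b (wPost v p.1 p.2) + b (vPost v p.1 p.2) * a (wPost v p.1 p.2))) * h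

/-- Since `√μ√μ_*` is collision invariant, a factor `√μ(v)` leaves the integral. This gives the
decay needed for `Γ(f₁,f₁) ∈ L²`, which polynomial bounds alone do not provide. -/
lemma gam_mul_sqrtMaxw {a b : E3 → ℝ} (ha : ModGrowth a) (hb : ModGrowth b) :
    ∃ m, ModGrowth m ∧ gam (fun v => a v * sqrtMaxw v) (fun v => b v * sqrtMaxw v)
      = fun v => m v * sqrtMaxw v := by
  have ha' := ha.mul .sqrtMaxw'
  have hb' := hb.mul .sqrtMaxw'
  obtain ⟨C, N, hC, h⟩ := ha.exists_nonneg
  obtain ⟨D, K, hD, k⟩ := hb.exists_nonneg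
  have hi := integrable_weight (N + K + 1)
  refine ⟨fun v => gam (fun v => a v * sqrtMaxw v) (fun v => b v * sqrtMaxw v) v / sqrtMaxw v,
    .of_bound ((ha'.gam hb').1.div continuous_sqrtMaxw.measurable)
      (1 / 2 * (4 * C * D * ∫ p : E3 × S2, (1 + ‖p.1‖) ^ (N + K + 1) * sqrtMaxw p.1 ∂velSphere))
      (N + K + 1) fun v => ?_, funext fun v => (div_mul_cancel₀ _ (sqrtMaxw_pos v).ne').symm⟩
  rw [(ha'.gamInt hb' v).gam_eq]
  simp only [gamKer_mul_sqrtMaxw]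
  rw [integral_const_mul, ← mul_assoc, mul_comm (1 / 2 : ℝ), mul_assoc,
    mul_div_cancel_left₀ _ (sqrtMaxw_pos v).ne', abs_mul, abs_of_pos (by norm_num : (0 : ℝ) < 1 / 2)]
  rw [mul_assoc (1 / 2 : ℝ)]
  refine mul_le_mul_of_nonneg_left ?_ (by norm_num)
  rw [← Real.norm_eq_abs]
  calc ‖∫ p : E3 × S2, sqrtMaxw p.1 * gamKer a b v p ∂velSphere‖
      ≤ ∫ p : E3 × S2, (4 * C * D * (1 + ‖v‖) ^ (N + K + 1)) *
          ((1 + ‖p.1‖) ^ (N + K + 1) * sqrtMaxw p.1) ∂velSphere := by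
        refine norm_integral_le_of_norm_le (hi.const_mul _) (.of_forall fun p => ?_)
        rw [norm_mul, Real.norm_of_nonneg (sqrtMaxw_pos _).le]
        exact (mul_le_of_le_one_left (norm_nonneg _) (sqrtMaxw_le_one _)).trans
          (abs_gamKer_le hC hD h k v p)
    _ = _ := by rw [integral_const_mul]; ring

lemma gamKer_sqrtMaxw_mul (b : E3 → ℝ) (v : E3) (p : E3 × S2) :
    gamKer sqrtMaxw (fun v => b v * sqrtMaxw v) v p = sqrtMaxw v * (sqrtMaxw p.1 *
      gamKer (fun _ => 1) b v p) := by
  rw [← gamKer_mul_sqrtMaxw]; simp only [one_mul]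

lemma linL_collInvariant {ψ : E3 → ℝ} (h : CollInvariant ψ) (v : E3) :
    linL (fun v => ψ v * sqrtMaxw v) v = 0 := by
  rw [linL_eq_gam, gam_eq_iterated]
  have : ∀ p, gamKer sqrtMaxw (fun v => ψ v * sqrtMaxw v) v p = 0 := fun p => by
    rw [gamKer_sqrtMaxw_mul]
    simp only [gamKer]
    linear_combination (sqrtMaxw v * (sqrtMaxw p.1 * (|inner ℝ (v - p.1) (p.2 : E3)| *
      sqrtMaxw p.1))) * h v p.1 p.2
  simp [this]

/-- `Γ(φ√μ, φ√μ) = ½ L(φ²√μ)` for a collision invariant `φ`. -/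
lemma gam_collInvariant_self {ψ : E3 → ℝ} (h : CollInvariant ψ) (v : E3) :
    gam (fun v => ψ v * sqrtMaxw v) (fun v => ψ v * sqrtMaxw v) v
      = 1 / 2 * linL (fun v => ψ v ^ 2 * sqrtMaxw v) v := by
  rw [linL_eq_gam, gam_eq_iterated, gam_eq_iterated]
  -- Squaring the invariance, `(ψ' + ψ_*')² = (ψ + ψ_*)²`, shows that the change of the sum of
  -- squares is minus twice the change of the product.
  have : ∀ p, gamKer sqrtMaxw (fun v => ψ v ^ 2 * sqrtMaxw v) v p
      = - gamKer (fun v => ψ v * sqrtMaxw v) (fun v => ψ v * sqrtMaxw v) v p := fun p => by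
    rw [gamKer_sqrtMaxw_mul, gamKer_mul_sqrtMaxw]
    simp only [gamKer]
    linear_combination (sqrtMaxw v * (sqrtMaxw p.1 * (|inner ℝ (v - p.1) (p.2 : E3)| *
      sqrtMaxw p.1))) * (ψ (vPost v p.1 p.2) + ψ (wPost v p.1 p.2) + ψ v + ψ p.1) * h v p.1 p.2
  simp only [this, integral_neg]
  ring

lemma linL_projP (g : E3 → ℝ) (v : E3) : linL (projP g) v = 0 := by
  rw [funext (projP_eq g)]
  exact linL_collInvariant (collInvariant_sum _ _ collInvariant_nullPoly) v

lemma domL_projP (g : E3 → ℝ) : DomL (projP g) := by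
  rw [funext (projP_eq g)]
  exact ModGrowth.domL_mul_sqrtMaxw (.sum fun j _ => (ModGrowth.nullPoly' j).const_mul _)

lemma linL_sub_of_memLp {h k : E3 → ℝ} (hh : MemLp h 2) (hk : MemLp k 2) (v : E3) :
    linL (h - k) v = linL h v - linL k v := by
  have e := linL_add_of_memLp hh (hk.const_mul (-1)) v
  rw [linL_const_mul] at e
  rw [show h - k = fun w => h w + -1 * k w by ext w; simp; ring, e]; ring

/-- `L⁻¹ Γ(φ√μ, φ√μ)` for a collision invariant `φ`. -/
lemma isLInv_gam_collInvariant {ψ : E3 → ℝ} (h : CollInvariant ψ) (hm : ModGrowth ψ) :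
    IsLInv (gam (fun v => ψ v * sqrtMaxw v) (fun v => ψ v * sqrtMaxw v))
      ((1 / 2 : ℝ) • ((fun v => ψ v ^ 2 * sqrtMaxw v) - projP fun v => ψ v ^ 2 * sqrtMaxw v)) := by
  have hd : DomL (fun v => ψ v ^ 2 * sqrtMaxw v) :=
    ModGrowth.domL_mul_sqrtMaxw ((hm.mul hm).congr fun v => sq _)
  have hp := domL_projP fun v => ψ v ^ 2 * sqrtMaxw v
  refine ⟨(inNullPerp_sub_projP hd.1).smul _, ?_, fun v => ?_⟩
  · have e := (hd.add (hp.const_mul (-1))).const_mul (1 / 2)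
    convert e.2 using 3 with v
    simp only [Pi.smul_apply, Pi.sub_apply, smul_eq_mul]; ring
  · rw [gam_collInvariant_self h]
    have e := linL_const_mul ((fun v => ψ v ^ 2 * sqrtMaxw v) - projP fun v => ψ v ^ 2 * sqrtMaxw v)
      (1 / 2) v
    rw [linL_sub_of_memLp hd.1 hp.1, linL_projP, sub_zero] at e
    exact e

/-! ### Orthogonality of `Γ`, the stress and the heat flux to the null space -/

lemma inNullPerp_gam {a b : E3 → ℝ} (ha : ModGrowth a) (hb : ModGrowth b) :
    InNullPerp (gam (fun v => a v * sqrtMaxw v) (fun v => b v * sqrtMaxw v)) := by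
  obtain ⟨m, hm, e⟩ := gam_mul_sqrtMaxw ha hb
  refine ⟨by rw [e]; exact hm.memLp_mul_sqrtMaxw, fun j => ?_⟩
  exact integral_gam_mul_collInvariant (ha.mul .sqrtMaxw') (hb.mul .sqrtMaxw') (.nullPoly' j)
    (collInvariant_nullPoly j)

lemma inNullPerp_devSrc (i j : Fin 3) : InNullPerp (devSrc i j) := by
  refine ⟨memLp_devSrc i j, fun k => pair_mul_sqrtMaxw ?_⟩
  have hm : ModGrowth fun v => v i * v j - ‖v‖ ^ 2 / 3 * kron i j :=
    ((ModGrowth.coord i).mul (.coord j)).sub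
      (((ModGrowth.norm_sq.mul (.const (1 / 3))).mul (.const (kron i j))).congr fun v => by ring)
  have o : ∀ l : Fin 3, HasMean (fun v => (v i * v j - ‖v‖ ^ 2 / 3 * kron i j) * v l) 0 := fun l =>
    .of_odd (hm.mul (.coord l)) fun v => by simp
  have z : HasMean (fun v => v i * v j - ‖v‖ ^ 2 / 3 * kron i j) 0 :=
    ((hasMean_coord_coord i j).sub (hasMean_norm_sq.const_mul (kron i j / 3))).congr
      (fun v => by ring) (by ring)
  have z2 : HasMean (fun v => (v i * v j - ‖v‖ ^ 2 / 3 * kron i j) * ‖v‖ ^ 2) 0 :=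
    ((hasMean_norm_sq_coord_coord i j).sub (hasMean_norm_four.const_mul (kron i j / 3))).congr
      (fun v => by ring) (by ring)
  fin_cases k
  · exact z.congr (fun v => mul_one _) rfl
  · exact o 0
  · exact o 1
  · exact o 2
  · exact ((z2.sub (z.const_mul 3)).const_mul (1 / 2)).congr
      (fun v => by simp; ring) (by ring)

lemma inNullPerp_heatSrc (i : Fin 3) : InNullPerp (heatSrc i) := by
  refine ⟨memLp_heatSrc i, fun k => pair_mul_sqrtMaxw ?_⟩
  have hm : ModGrowth fun v => (‖v‖ ^ 2 - 5) / 2 * v i :=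
    (((ModGrowth.norm_sq.sub (.const 5)).mul (.const (1 / 2))).mul (.coord i)).congr
      fun v => by ring
  have z : ∀ l : Fin 3, HasMean (fun v => (‖v‖ ^ 2 - 5) / 2 * v i * v l) 0 := fun l =>
    (((hasMean_norm_sq_coord_coord i l).sub ((hasMean_coord_coord i l).const_mul 5)).const_mul
      (1 / 2)).congr (fun v => by ring) (by ring)
  fin_cases k
  · exact .of_odd (hm.mul (.const 1)) fun v => by simp
  · exact z 0
  · exact z 1
  · exact z 2
  · exact .of_odd (hm.mul hasMean_heat_weight.1) fun v => by simp

lemma inNullPerp_sum {ι : Type*} (t : Finset ι) {f : ι → E3 → ℝ} (h : ∀ i, InNullPerp (f i)) :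
    InNullPerp (∑ i ∈ t, f i) :=
  ⟨memLp_finsetSum' _ fun i _ => (h i).1, fun j => by
    rw [pair_sum_left _ (fun i _ => (h i).1) (memLp_nullBasis j)]
    exact Finset.sum_eq_zero fun i _ => (h i).2 j⟩

lemma inNullPerp_devSum (S : Fin 3 → Fin 3 → ℝ) : InNullPerp (devSum S) :=
  inNullPerp_sum _ fun i => inNullPerp_sum _ fun j => (inNullPerp_devSrc i j).smul _

lemma inNullPerp_heatSum (c : Fin 3 → ℝ) : InNullPerp (heatSum c) :=
  inNullPerp_sum _ fun i => (inNullPerp_heatSrc i).smul _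

/-! ### Stress and heat flux of `L⁻¹ g` -/

/-- The difference of two preimages is annihilated by `L`. It is not shown to vanish; zero Dirichlet
form is all that the orthogonality to stress and heat flux requires. -/
lemma IsLInv.domL_sub {g h h' : E3 → ℝ} (H : IsLInv g h) (H' : IsLInv g h') :
    DomL (fun v => h v + -1 * h' v) ∧ pair (linL fun v => h v + -1 * h' v)
      (fun v => h v + -1 * h' v) = 0 := by
  refine ⟨H.domL.add (H'.domL.const_mul (-1)), ?_⟩
  have : (linL fun v => h v + -1 * h' v) = 0 := by
    ext v
    rw [linL_add_of_memLp H.1.1 (H'.1.1.const_mul (-1)), linL_const_mul, H.2.2, H'.2.2]; simp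
  rw [this]; simp [pair]

lemma pair_eq_of_sub {h h' k : E3 → ℝ} (hh : MemLp h 2) (hh' : MemLp h' 2) (hk : MemLp k 2)
    (e : pair (fun v => h v + -1 * h' v) k = 0) : pair h k = pair h' k := by
  have e2 : (fun v => h v + -1 * h' v) = h - h' := by ext v; simp; ring
  rw [e2, pair_sub_left hh hh' hk] at e
  linarith

/-- The stress of `L⁻¹ g` depends on `g` only. -/
lemma IsLInv.pair_devSrc_unique {g h h' : E3 → ℝ} (H : IsLInv g h) (H' : IsLInv g h') (i j : Fin 3) :
    pair h (devSrc i j) = pair h' (devSrc i j) :=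
  have d := H.domL_sub H'
  pair_eq_of_sub H.1.1 H'.1.1 (memLp_devSrc i j) (pair_kernel_stress d.1 d.2 i j)

/-- The heat flux of `L⁻¹ g` depends on `g` only. -/
lemma IsLInv.pair_heatSrc_unique {g h h' : E3 → ℝ} (H : IsLInv g h) (H' : IsLInv g h') (i : Fin 3) :
    pair h (heatSrc i) = pair h' (heatSrc i) :=
  have d := H.domL_sub H'
  pair_eq_of_sub H.1.1 H'.1.1 (memLp_heatSrc i) (pair_kernel_heat d.1 d.2 i)

/-- The reflection `v ↦ -v`. -/
def negIso : E3 ≃ₗᵢ[ℝ] E3 := LinearIsometryEquiv.neg ℝ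

lemma negIso_apply (v : E3) : negIso v = -v := rfl

lemma devSrc_neg (i j : Fin 3) (v : E3) : devSrc i j (-v) = devSrc i j v := by
  have := sqrtMaxw_congr (norm_neg v)
  simp [devSrc, this]

lemma heatSrc_neg (i : Fin 3) (v : E3) : heatSrc i (-v) = -heatSrc i v := by
  have := sqrtMaxw_congr (norm_neg v)
  simp [heatSrc, this]

lemma devSum_neg (S : Fin 3 → Fin 3 → ℝ) (v : E3) : devSum S (-v) = devSum S v := by
  simp [devSum_apply, devSrc_neg]

lemma heatSum_neg (c : Fin 3 → ℝ) (v : E3) : heatSum c (-v) = -heatSum c v := by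
  simp [heatSum_apply, heatSrc_neg]

lemma pair_sum_right {ι : Type*} (t : Finset ι) {f : ι → E3 → ℝ} {k : E3 → ℝ}
    (hf : ∀ i ∈ t, MemLp (f i) 2) (hk : MemLp k 2) :
    pair k (∑ i ∈ t, f i) = ∑ i ∈ t, pair k (f i) := by
  rw [pair_comm, pair_sum_left t hf hk]
  exact Finset.sum_congr rfl fun i _ => pair_comm _ _

/-- If the stresses are invertible, this expands the isotropic form. Otherwise the dichotomy forces
the source to be zero, the stress of `h` equals that of the preimage `0`, and `η_v = 0` as well. -/
lemma pair_isLInv_devSum {S : Fin 3 → Fin 3 → ℝ} {h : E3 → ℝ} (H : IsLInv (devSum S) h)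
    (i j : Fin 3) :
    pair h (devSrc i j) = etaV * (S i j + S j i - 2 / 3 * kron i j * ∑ k, S k k) := by
  by_cases hr : devSrc 0 1 ∈ rangeL
  · obtain ⟨-, l, hl⟩ := devSrc_mem hr i j
    have e := H.pair_comm hl
    rw [e, devSum, pair_sum_right _ (fun k _ => memLp_finsetSum' _ fun l _ =>
      (memLp_devSrc k l).const_smul _) hl.1.1]
    have e2 : ∀ k, pair l (∑ m, S k m • devSrc k m) = ∑ m, S k m * (etaV * (kron i k * kron j m
        + kron i m * kron j k - 2 / 3 * (kron i j * kron k m))) := by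
      intro k
      rw [pair_sum_right _ (fun m _ => (memLp_devSrc k m).const_smul _) hl.1.1]
      refine Finset.sum_congr rfl fun m _ => ?_
      rw [pair_smul_right, ← invForm_eq hl (devSrc_mem hr k m), invForm_devSrc hr]
    simp only [e2]
    fin_cases i <;> fin_cases j <;> simp [kron, Fin.sum_univ_three] <;> ring
  · have h0 := (devSum_dichotomy ⟨(inNullPerp_devSum S).1, h, H⟩).resolve_left hr
    rw [h0] at H
    rw [H.pair_devSrc_unique .zero, etaV_eq_zero hr]; simp [pair]

lemma pair_isLInv_heatSum {c : Fin 3 → ℝ} {h : E3 → ℝ} (H : IsLInv (heatSum c) h) (i : Fin 3) :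
    pair h (heatSrc i) = 5 / 2 * etaC * c i := by
  by_cases hr : heatSrc 0 ∈ rangeL
  · obtain ⟨-, l, hl⟩ := heatSrc_mem hr i
    rw [H.pair_comm hl, heatSum, pair_sum_right _ (fun k _ => (memLp_heatSrc k).const_smul _) hl.1.1]
    have e2 : ∀ k, pair l (c k • heatSrc k) = c k * (5 / 2 * etaC * kron i k) := by
      intro k
      rw [pair_smul_right, ← invForm_eq hl (heatSrc_mem hr k), invForm_heatSrc hr]
    simp only [e2]
    fin_cases i <;> simp [kron] <;> ring
  · have h0 := (heatSum_dichotomy ⟨(inNullPerp_heatSum c).1, h, H⟩).resolve_left hr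
    rw [h0] at H
    rw [H.pair_heatSrc_unique .zero, etaC_eq_zero hr]; simp [pair]

/-- Both `h(-v)` and `-h(v)` are preimages of `-g` and so have equal stress, while the stress, being
even, is unchanged by `v ↦ -v`. Oddness of `h` itself is not needed. -/
lemma pair_isLInv_odd {g h : E3 → ℝ} (H : IsLInv g h) (hg : ∀ v, g (-v) = -g v) (i j : Fin 3) :
    pair h (devSrc i j) = 0 := by
  have e1 := H.comp negIso
  have e2 : (fun x => g (negIso x)) = (-1 : ℝ) • g := by ext x; simp [negIso_apply, hg]
  rw [e2] at e1
  have e3 := e1.pair_devSrc_unique (H.smul (-1)) i j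
  rw [pair_smul_left, ← pair_comp negIso h] at e3
  simp only [negIso_apply, devSrc_neg] at e3
  have e4 := pair_comp negIso h (devSrc i j)
  simp only [negIso_apply, devSrc_neg] at e4
  linarith

lemma pair_isLInv_even {g h : E3 → ℝ} (H : IsLInv g h) (hg : ∀ v, g (-v) = g v) (i : Fin 3) :
    pair h (heatSrc i) = 0 := by
  have e1 := H.comp negIso
  have e2 : (fun x => g (negIso x)) = g := by ext x; simp [negIso_apply, hg]
  rw [e2] at e1
  have e3 := e1.pair_heatSrc_unique H i
  have e4 := pair_comp negIso h (heatSrc i)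
  simp only [negIso_apply, heatSrc_neg] at e4 e3
  have e5 : pair (fun x => h (-x)) (fun x => -heatSrc i x) = - pair (fun x => h (-x)) (heatSrc i) := by
    simp [pair, integral_neg]
  linarith

/-! ### The hydrodynamic part -/

/-- The polynomial `r + b·v + τ (|v|² - 3)/2`. -/
def hydroPoly (r : ℝ) (b : E3) (τ : ℝ) (v : E3) : ℝ := r + inner ℝ b v + τ * ((‖v‖ ^ 2 - 3) / 2)

lemma collInvariant_hydroPoly (r : ℝ) (b : E3) (τ : ℝ) : CollInvariant (hydroPoly r b τ) := by
  intro v w s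
  have h1 := norm_sq_post v w s
  have h2 : inner ℝ b (vPost v w s) + inner ℝ b (wPost v w s) = inner ℝ b v + inner ℝ b w := by
    rw [← inner_add_right, vPost_add_wPost, inner_add_right]
  simp only [hydroPoly]
  linear_combination h2 + τ / 2 * h1

lemma ModGrowth.hydroPoly' (r : ℝ) (b : E3) (τ : ℝ) : ModGrowth (hydroPoly r b τ) :=
  ((ModGrowth.const r).add (.inner_left b)).add (hasMean_heat_weight.1.const_mul τ)

/-! ### Gaussian moments of the squared hydrodynamic polynomial -/

lemma hasMean_inner_sq_coord_coord (b : E3) (i j : Fin 3) :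
    HasMean (fun v => inner ℝ b v ^ 2 * (v i * v j)) (‖b‖ ^ 2 * kron i j + 2 * (b i * b j)) := by
  refine (HasMean.sum Finset.univ fun k _ => HasMean.sum Finset.univ fun l _ =>
    (hasMean_coord_four k l i j).const_mul (b k * b l)).congr (fun v => ?_) ?_
  · rw [sq, inner_eq_sum, Finset.sum_mul_sum, Finset.sum_mul]
    refine Finset.sum_congr rfl fun k _ => ?_
    rw [Finset.sum_mul]
    exact Finset.sum_congr rfl fun l _ => by ring
  · rw [norm_sq_eq_sum]
    fin_cases i <;> fin_cases j <;> simp [Fin.sum_univ_three, kron] <;> ring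

lemma hasMean_inner_sq_norm_sq (b : E3) :
    HasMean (fun v => inner ℝ b v ^ 2 * ‖v‖ ^ 2) (5 * ‖b‖ ^ 2) := by
  refine (HasMean.sum Finset.univ fun k _ => hasMean_inner_sq_coord_coord b k k).congr
    (fun v => ?_) ?_
  · rw [norm_sq_eq_sum, Finset.mul_sum]
  · simp only [Finset.sum_add_distrib, ← Finset.mul_sum, sum_kron_self, ← norm_sq_eq_sum]; ring

lemma hydroPoly_neg_self (b : E3) (τ : ℝ) (v : E3) :
    hydroPoly (-τ) b τ v = inner ℝ b v + τ * ((‖v‖ ^ 2 - 5) / 2) := by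
  rw [hydroPoly]; ring

/-- The cross term is odd and the `τ²` term is radial, hence orthogonal to a trace-free quadratic.
Only `(b·v)²` contributes; this is the source of `u ⊗ u` in the momentum equation. -/
lemma hasMean_hydroPoly_sq_dev (b : E3) (τ : ℝ) (i j : Fin 3) :
    HasMean (fun v => hydroPoly (-τ) b τ v ^ 2 * (v i * v j - ‖v‖ ^ 2 / 3 * kron i j))
      (2 * (b i * b j - ‖b‖ ^ 2 / 3 * kron i j)) := by
  have hw : ModGrowth fun v => v i * v j - ‖v‖ ^ 2 / 3 * kron i j :=
    ((ModGrowth.coord i).mul (.coord j)).sub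
      (((ModGrowth.norm_sq.mul (.const (1 / 3))).mul (.const (kron i j))).congr fun v => by ring)
  have a := (hasMean_inner_sq_coord_coord b i j).sub
    ((hasMean_inner_sq_norm_sq b).const_mul (kron i j / 3))
  have o : HasMean (fun v => inner ℝ b v * (‖v‖ ^ 2 - 5) *
      (v i * v j - ‖v‖ ^ 2 / 3 * kron i j)) 0 :=
    .of_odd (((ModGrowth.inner_left b).mul (ModGrowth.norm_sq.sub (.const 5))).mul hw)
      fun v => by simp
  have r := ((hasMean_norm_four_coord_coord i j).sub ((hasMean_norm_sq_coord_coord i j).const_mul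
    10)).add ((hasMean_coord_coord i j).const_mul 25)
  have s := ((hasMean_norm_six.sub (hasMean_norm_four.const_mul 10)).add
    (hasMean_norm_sq.const_mul 25)).const_mul (kron i j / 3)
  refine ((a.add (o.const_mul τ)).add ((r.sub s).const_mul (τ ^ 2 / 4))).congr
    (fun v => ?_) (by ring)
  rw [hydroPoly_neg_self]; ring

/-- Against an odd weight only the cross term of `b·v` and `τ(|v|²-5)/2` survives; this is the
source of the convective flux `θ u`. -/
lemma hasMean_hydroPoly_sq_heat (b : E3) (τ : ℝ) (i : Fin 3) :
    HasMean (fun v => hydroPoly (-τ) b τ v ^ 2 * ((‖v‖ ^ 2 - 5) / 2 * v i)) (5 * τ * b i) := by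
  have m5 : ModGrowth fun v => ‖v‖ ^ 2 - 5 := ModGrowth.norm_sq.sub (.const 5)
  have o : HasMean (fun v => (inner ℝ b v * inner ℝ b v + τ ^ 2 / 4 * ((‖v‖ ^ 2 - 5) *
      (‖v‖ ^ 2 - 5))) * (‖v‖ ^ 2 - 5) * v i) 0 :=
    .of_odd (((((ModGrowth.inner_left b).mul (.inner_left b)).add ((m5.mul m5).const_mul _)).mul
      m5).mul (.coord i)) fun v => by simp
  have e : HasMean (fun v => inner ℝ b v * ((‖v‖ ^ 2 - 5) * (‖v‖ ^ 2 - 5) * v i)) (10 * b i) := by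
    refine (HasMean.sum Finset.univ fun k _ => (((hasMean_norm_four_coord_coord k i).sub
      ((hasMean_norm_sq_coord_coord k i).const_mul 10)).add
      ((hasMean_coord_coord k i).const_mul 25)).const_mul (b k)).congr (fun v => ?_) ?_
    · rw [inner_eq_sum, Finset.sum_mul]
      exact Finset.sum_congr rfl fun k _ => by ring
    · rw [← sum_mul_kron (fun k => b k) i, Finset.mul_sum]
      exact Finset.sum_congr rfl fun k _ => by ring
  refine ((o.const_mul (1 / 2)).add (e.const_mul (τ / 2))).congr (fun v => ?_) (by ring)
  rw [hydroPoly_neg_self]; ring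

/-! ### Constitutive laws: stress and heat flux of the microscopic part of `f₂` -/

lemma pair_projP_inNullPerp (f : E3 → ℝ) {k : E3 → ℝ} (hk : InNullPerp k) :
    pair (projP f) k = 0 := by
  rw [projP_eq_sum_smul, pair_sum_left _ (fun j _ => (memLp_nullBasis j).const_smul _) hk.1]
  refine Finset.sum_eq_zero fun j _ => ?_
  rw [pair_smul_left, pair_comm (nullBasis j) k, hk.2, mul_zero]

lemma pair_half_sub_projP {f k : E3 → ℝ} (hf : MemLp f 2) (hk : InNullPerp k) :
    pair ((1 / 2 : ℝ) • (f - projP f)) k = 1 / 2 * pair f k := by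
  rw [pair_smul_left, pair_sub_left hf (memLp_projP f) hk.1, pair_projP_inNullPerp f hk, sub_zero]

/-- The source of the microscopic part: viscous stress, heat flux and the quadratic term. -/
def microSum (κ : ℝ) (S : Fin 3 → Fin 3 → ℝ) (c : Fin 3 → ℝ) (b : E3) (τ : ℝ) : E3 → ℝ :=
  (-κ) • (devSum S + heatSum c) + gam (fun v => hydroPoly (-τ) b τ v * sqrtMaxw v)
    (fun v => hydroPoly (-τ) b τ v * sqrtMaxw v)

lemma inNullPerp_microSum (κ : ℝ) (S : Fin 3 → Fin 3 → ℝ) (c : Fin 3 → ℝ) (b : E3) (τ : ℝ) :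
    InNullPerp (microSum κ S c b τ) :=
  (((inNullPerp_devSum S).add (inNullPerp_heatSum c)).smul _).add
    (inNullPerp_gam (.hydroPoly' _ _ _) (.hydroPoly' _ _ _))

/-- Only the total source is assumed to have a preimage. The quadratic term has an explicit one and
can be subtracted; the even and odd parts under `v ↦ -v` then separate stress from heat flux. -/
lemma exists_isLInv_parts {κ : ℝ} (hκ : κ ≠ 0) {S : Fin 3 → Fin 3 → ℝ} {c : Fin 3 → ℝ} {b : E3}
    {τ : ℝ} {h : E3 → ℝ} (H : IsLInv (microSum κ S c b τ) h) :
    (∃ h₁, IsLInv (devSum S) h₁) ∧ ∃ h₂, IsLInv (heatSum c) h₂ := by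
  have hg : gam (fun v => hydroPoly (-τ) b τ v * sqrtMaxw v)
      (fun v => hydroPoly (-τ) b τ v * sqrtMaxw v) ∈ rangeL :=
    ⟨(inNullPerp_gam (.hydroPoly' _ _ _) (.hydroPoly' _ _ _)).1, _,
      isLInv_gam_collInvariant (collInvariant_hydroPoly _ _ _) (.hydroPoly' _ _ _)⟩
  have hm : microSum κ S c b τ ∈ rangeL := ⟨(inNullPerp_microSum _ _ _ _ _).1, h, H⟩
  have h1 : devSum S + heatSum c ∈ rangeL := by
    rw [← rangeL.smul_mem_iff (neg_ne_zero.2 hκ)]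
    exact (rangeL.add_mem_iff_left hg).1 hm
  have h2 := comp_mem_rangeL h1 negIso
  have e1 : devSum S ∈ rangeL := by
    convert rangeL.smul_mem (1 / 2 : ℝ) (rangeL.add_mem h1 h2) using 1
    ext v
    simp [negIso_apply, devSum_neg, heatSum_neg]; ring
  exact ⟨e1.2, ((rangeL.add_mem_iff_right e1).1 h1).2⟩

lemma pair_isLInv_microSum_dev {κ : ℝ} (hκ : κ ≠ 0) {S : Fin 3 → Fin 3 → ℝ} {c : Fin 3 → ℝ} {b : E3}
    {τ : ℝ} {h : E3 → ℝ} (H : IsLInv (microSum κ S c b τ) h) (i j : Fin 3) :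
    pair h (devSrc i j) = -κ * (etaV * (S i j + S j i - 2 / 3 * kron i j * ∑ k, S k k))
      + (b i * b j - ‖b‖ ^ 2 / 3 * kron i j) := by
  obtain ⟨⟨h₁, H₁⟩, h₂, H₂⟩ := exists_isLInv_parts hκ H
  have H₃ := isLInv_gam_collInvariant (collInvariant_hydroPoly (-τ) b τ) (.hydroPoly' _ _ _)
  have m := memLp_devSrc i j
  rw [H.pair_devSrc_unique (((H₁.add H₂).smul (-κ)).add H₃),
    pair_add_left ((H₁.add H₂).smul (-κ)).1.1 H₃.1.1 m, pair_smul_left,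
    pair_add_left H₁.1.1 H₂.1.1 m, pair_isLInv_devSum H₁, pair_isLInv_odd H₂ (heatSum_neg c),
    pair_half_sub_projP (((ModGrowth.hydroPoly' (-τ) b τ).mul (.hydroPoly' (-τ) b τ)).congr
      fun v => sq _).memLp_mul_sqrtMaxw (inNullPerp_devSrc i j)]
  have e := pair_mul_sqrtMaxw (hasMean_hydroPoly_sq_dev b τ i j)
  change pair _ (devSrc i j) = _ at e
  rw [e]; ring

lemma pair_isLInv_microSum_heat {κ : ℝ} (hκ : κ ≠ 0) {S : Fin 3 → Fin 3 → ℝ} {c : Fin 3 → ℝ} {b : E3}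
    {τ : ℝ} {h : E3 → ℝ} (H : IsLInv (microSum κ S c b τ) h) (i : Fin 3) :
    pair h (heatSrc i) = -κ * (5 / 2 * etaC * c i) + 5 / 2 * (τ * b i) := by
  obtain ⟨⟨h₁, H₁⟩, h₂, H₂⟩ := exists_isLInv_parts hκ H
  have H₃ := isLInv_gam_collInvariant (collInvariant_hydroPoly (-τ) b τ) (.hydroPoly' _ _ _)
  have m := memLp_heatSrc i
  rw [H.pair_heatSrc_unique (((H₁.add H₂).smul (-κ)).add H₃),
    pair_add_left ((H₁.add H₂).smul (-κ)).1.1 H₃.1.1 m, pair_smul_left,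
    pair_add_left H₁.1.1 H₂.1.1 m, pair_isLInv_heatSum H₂, pair_isLInv_even H₁ (devSum_neg S),
    pair_half_sub_projP (((ModGrowth.hydroPoly' (-τ) b τ).mul (.hydroPoly' (-τ) b τ)).congr
      fun v => sq _).memLp_mul_sqrtMaxw (inNullPerp_heatSrc i)]
  have e := pair_mul_sqrtMaxw (hasMean_hydroPoly_sq_heat b τ i)
  change pair _ (heatSrc i) = _ at e
  rw [e]; ring

/-! ### Slices of space-time functions -/

section slices

variable {G : Type*} [NormedAddCommGroup G] [NormedSpace ℝ G] {T : ℝ} {Ω : Set E3} {n : WithTop ℕ∞}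
  {f : ℝ → E3 → G} {t : ℝ} {x : E3}

lemma contDiffAt_of_contDiffOn (hΩ : IsOpen Ω)
    (hf : ContDiffOn ℝ n (fun z : ℝ × E3 => f z.1 z.2) (Ioo 0 T ×ˢ Ω)) (ht : t ∈ Ioo 0 T)
    (hx : x ∈ Ω) : ContDiffAt ℝ n (fun z : ℝ × E3 => f z.1 z.2) (t, x) :=
  hf.contDiffAt ((isOpen_Ioo.prod hΩ).mem_nhds ⟨ht, hx⟩)

lemma contDiffAt_space (hΩ : IsOpen Ω)
    (hf : ContDiffOn ℝ n (fun z : ℝ × E3 => f z.1 z.2) (Ioo 0 T ×ˢ Ω)) (ht : t ∈ Ioo 0 T)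
    (hx : x ∈ Ω) : ContDiffAt ℝ n (f t) x :=
  (contDiffAt_of_contDiffOn hΩ hf ht hx).comp x (contDiffAt_const.prodMk contDiffAt_id)

lemma contDiffAt_time (hΩ : IsOpen Ω)
    (hf : ContDiffOn ℝ n (fun z : ℝ × E3 => f z.1 z.2) (Ioo 0 T ×ˢ Ω)) (ht : t ∈ Ioo 0 T)
    (hx : x ∈ Ω) : ContDiffAt ℝ n (fun s => f s x) t :=
  (contDiffAt_of_contDiffOn hΩ hf ht hx).comp t (contDiffAt_id.prodMk contDiffAt_const)

end slices

/-- The standard basis vectors. -/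
def unitVec (i : Fin 3) : E3 := EuclideanSpace.single i 1

lemma sum_smul_unitVec (v : E3) : ∑ i, v i • unitVec i = v := by
  ext j; fin_cases j <;> simp [Fin.sum_univ_three, unitVec]

lemma map_eq_sum {G : Type*} [NormedAddCommGroup G] [NormedSpace ℝ G] (L : E3 →L[ℝ] G) (v : E3) :
    L v = ∑ i, v i • L (unitVec i) := by
  conv_lhs => rw [← sum_smul_unitVec v]
  simp [map_sum]

lemma hydro_eq (ρ : ℝ → E3 → ℝ) (u : ℝ → E3 → E3) (θ : ℝ → E3 → ℝ) (t : ℝ) (x : E3) :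
    hydro ρ u θ t x = fun v => hydroPoly (ρ t x) (u t x) (θ t x) v * sqrtMaxw v := rfl

lemma linL_hydro (ρ : ℝ → E3 → ℝ) (u : ℝ → E3 → E3) (θ : ℝ → E3 → ℝ) (t : ℝ) (x v : E3) :
    linL (hydro ρ u θ t x) v = 0 :=
  linL_collInvariant (collInvariant_hydroPoly _ _ _) v

lemma ModGrowth.hydro' (ρ : ℝ → E3 → ℝ) (u : ℝ → E3 → E3) (θ : ℝ → E3 → ℝ) (t : ℝ) (x : E3) :
    ModGrowth (hydro ρ u θ t x) :=
  (ModGrowth.hydroPoly' _ _ _).mul .sqrtMaxw'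

lemma transport_hydro {ρ : ℝ → E3 → ℝ} {u : ℝ → E3 → E3} {θ : ℝ → E3 → ℝ} {t : ℝ} {x : E3}
    (hρ : DifferentiableAt ℝ (ρ t) x) (hu : DifferentiableAt ℝ (u t) x)
    (hθ : DifferentiableAt ℝ (θ t) x) (v : E3) :
    transport (hydro ρ u θ) t x v = (fderiv ℝ (ρ t) x v + inner ℝ (fderiv ℝ (u t) x v) v
      + fderiv ℝ (θ t) x v * ((‖v‖ ^ 2 - 3) / 2)) * sqrtMaxw v := by
  unfold transport hydro
  have h2 : HasFDerivAt (fun y => inner ℝ (u t y) v)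
      ((innerSL ℝ v).comp (fderiv ℝ (u t) x)) x := by
    have := (innerSL ℝ v).hasFDerivAt.comp x hu.hasFDerivAt
    refine this.congr_of_eventuallyEq (.of_forall fun y => ?_)
    simp [real_inner_comm]
  rw [(((hρ.hasFDerivAt.fun_add h2).fun_add
    (hθ.hasFDerivAt.mul_const ((‖v‖ ^ 2 - 3) / 2))).mul_const (sqrtMaxw v)).fderiv]
  simp [real_inner_comm]
  ring

lemma dt_hydro {ρ : ℝ → E3 → ℝ} {u : ℝ → E3 → E3} {θ : ℝ → E3 → ℝ} {t : ℝ} {x : E3}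
    (hρ : DifferentiableAt ℝ (fun s => ρ s x) t) (hu : DifferentiableAt ℝ (fun s => u s x) t)
    (hθ : DifferentiableAt ℝ (fun s => θ s x) t) (v : E3) :
    dt (hydro ρ u θ) t x v = hydroPoly (deriv (fun s => ρ s x) t) (deriv (fun s => u s x) t)
      (deriv (fun s => θ s x) t) v * sqrtMaxw v := by
  unfold dt hydro hydroPoly
  have h2 : HasDerivAt (fun s => inner ℝ (u s x) v) (inner ℝ (deriv (fun s => u s x) t) v) t := by
    simpa using hu.hasDerivAt.inner ℝ (hasDerivAt_const t v)
  exact (((hρ.hasDerivAt.add h2).add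
    (hθ.hasDerivAt.mul_const ((‖v‖ ^ 2 - 3) / 2))).mul_const (sqrtMaxw v)).deriv

/-! ### The first order -/

namespace IsNSF

variable {T : ℝ} {Ω : Set E3} {κ : ℝ} {ρ : ℝ → E3 → ℝ} {u : ℝ → E3 → E3} {θ p : ℝ → E3 → ℝ}
  {t : ℝ} {x : E3}

lemma rho_eventuallyEq (h : IsNSF T Ω κ ρ u θ p) (hΩ : IsOpen Ω) (ht : t ∈ Ioo 0 T) (hx : x ∈ Ω) :
    ρ t =ᶠ[nhds x] fun y => -θ t y := by
  filter_upwards [hΩ.mem_nhds hx] with y hy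
  linarith [h.boussinesq t ht y hy]

lemma rho_eq (h : IsNSF T Ω κ ρ u θ p) (ht : t ∈ Ioo 0 T) (hx : x ∈ Ω) : ρ t x = -θ t x := by
  linarith [h.boussinesq t ht x hx]

/-- The velocity gradient. -/
def velGrad (u : ℝ → E3 → E3) (t : ℝ) (x : E3) (i j : Fin 3) : ℝ := fderiv ℝ (u t) x (unitVec i) j

/-- The temperature gradient. -/
def tempGrad (θ : ℝ → E3 → ℝ) (t : ℝ) (x : E3) (i : Fin 3) : ℝ := fderiv ℝ (θ t) x (unitVec i)

lemma trace_velGrad (h : IsNSF T Ω κ ρ u θ p) (ht : t ∈ Ioo 0 T) (hx : x ∈ Ω) :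
    ∑ i, velGrad u t x i i = 0 := h.incompressible t ht x hx

/-- The two constraints remove the components along `𝒩`: `∇·u = 0` supplies the missing trace part
of the stress, and `∇ρ = -∇θ` turns the weight `(|v|²-3)/2` into `(|v|²-5)/2`. -/
lemma transport_eq (h : IsNSF T Ω κ ρ u θ p) (hΩ : IsOpen Ω) (ht : t ∈ Ioo 0 T) (hx : x ∈ Ω) :
    transport (hydro ρ u θ) t x = devSum (velGrad u t x) + heatSum (tempGrad θ t x) := by
  ext v
  have dθ := (contDiffAt_space hΩ h.contDiff_theta ht hx).differentiableAt (by norm_num)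
  have dρ := (contDiffAt_space hΩ h.contDiff_rho ht hx).differentiableAt (by norm_num)
  have du := (contDiffAt_space hΩ h.contDiff_u ht hx).differentiableAt (by norm_num)
  rw [transport_hydro dρ du dθ, (h.rho_eventuallyEq hΩ ht hx).fderiv_eq]
  have e1 : fderiv ℝ (fun y => -θ t y) x v = -fderiv ℝ (θ t) x v := by
    rw [dθ.hasFDerivAt.fun_neg.fderiv]; rfl
  have e2 : inner ℝ (fderiv ℝ (u t) x v) v = ∑ i, ∑ j, velGrad u t x i j * (v i * v j) := by
    rw [map_eq_sum, sum_inner]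
    refine Finset.sum_congr rfl fun i _ => ?_
    rw [inner_smul_left, inner_eq_sum, Finset.mul_sum]
    refine Finset.sum_congr rfl fun j _ => ?_
    simp [velGrad]; ring
  have e3 : fderiv ℝ (θ t) x v = ∑ i, tempGrad θ t x i * v i := by
    rw [map_eq_sum]
    refine Finset.sum_congr rfl fun i _ => ?_
    simp [tempGrad]; ring
  rw [e1, e2, Pi.add_apply, devSum_apply, heatSum_apply, e3]
  have tr := h.trace_velGrad ht hx
  simp only [Fin.sum_univ_three, devSrc, heatSrc, kron] at tr ⊢
  simp
  linear_combination (‖v‖ ^ 2 / 3 * sqrtMaxw v) * tr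

lemma microSource_eq (h : IsNSF T Ω κ ρ u θ p) (hΩ : IsOpen Ω) (ht : t ∈ Ioo 0 T) (hx : x ∈ Ω) :
    microSource κ (hydro ρ u θ) t x
      = microSum κ (velGrad u t x) (tempGrad θ t x) (u t x) (θ t x) := by
  ext v
  rw [microSource, h.transport_eq hΩ ht hx, hydro_eq, h.rho_eq ht hx]
  rfl

lemma dt_hydro_eq (h : IsNSF T Ω κ ρ u θ p) (hΩ : IsOpen Ω) (ht : t ∈ Ioo 0 T) (hx : x ∈ Ω) :
    dt (hydro ρ u θ) t x = fun v => hydroPoly (deriv (fun s => ρ s x) t) (deriv (fun s => u s x) t)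
      (deriv (fun s => θ s x) t) v * sqrtMaxw v :=
  funext (dt_hydro ((contDiffAt_time hΩ h.contDiff_rho ht hx).differentiableAt (by norm_num))
    ((contDiffAt_time hΩ h.contDiff_u ht hx).differentiableAt (by norm_num))
    ((contDiffAt_time hΩ h.contDiff_theta ht hx).differentiableAt (by norm_num)))

end IsNSF

/-! ### The second order -/

lemma linL_secondCorrector {g f : E3 → ℝ} (H : IsLInv g fun v => f v - projP f v) (v : E3) :
    linL f v = g v := by
  rw [← H.2.2 v]
  have e := linL_add_of_memLp H.1.1 (memLp_projP f) v
  rw [linL_projP, add_zero] at e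
  rw [← e]
  congr 1
  ext w
  ring

/-! ### Moments of kinetic functions -/

lemma PolyGrowth.exists_bound {G : Type*} [NormedAddCommGroup G] {T : ℝ} {Ω : Set E3}
    {f : ℝ → E3 → E3 → G} (hf : PolyGrowth T Ω f) (hΩ : IsOpen Ω) {t : ℝ} {x : E3} (ht : t ∈ Ioo 0 T)
    (hx : x ∈ Ω) : ∃ (r C : ℝ) (N : ℕ), 0 < r ∧ 0 ≤ C ∧ ∀ s ∈ Metric.ball t r, ∀ y ∈ Metric.ball x r,
      s ∈ Ioo 0 T ∧ y ∈ Ω ∧ ∀ v, ‖f s y v‖ ≤ C * (1 + ‖v‖) ^ N := by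
  obtain ⟨r, hr, hsub⟩ := Metric.nhds_basis_closedBall.mem_iff.1
    ((isOpen_Ioo.prod hΩ).mem_nhds (⟨ht, hx⟩ : (t, x) ∈ Ioo 0 T ×ˢ Ω))
  obtain ⟨C, N, h⟩ := hf _ (isCompact_closedBall _ _) hsub
  refine ⟨r, |C|, N, hr, abs_nonneg C, fun s hs y hy => ?_⟩
  have hm : (s, y) ∈ Metric.closedBall (t, x) r := by
    rw [← closedBall_prod_same]
    exact ⟨Metric.ball_subset_closedBall hs, Metric.ball_subset_closedBall hy⟩
  exact ⟨(hsub hm).1, (hsub hm).2, fun v => (h _ hm v).trans (by gcongr; exact le_abs_self C)⟩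

section kin

variable {T : ℝ} {Ω : Set E3} {f : ℝ → E3 → E3 → ℝ} {t : ℝ} {x : E3} {q : E3 → ℝ}

lemma KinRegular.modGrowth (hf : KinRegular T Ω f) (hΩ : IsOpen Ω) (ht : t ∈ Ioo 0 T) (hx : x ∈ Ω) :
    ModGrowth (f t x) := by
  obtain ⟨r, C, N, hr, -, h⟩ := hf.growth.exists_bound hΩ ht hx
  exact .of_bound (hf.measurable t ht x hx) C N
    (h t (Metric.mem_ball_self hr) x (Metric.mem_ball_self hr)).2.2

lemma KinRegular.differentiableAt_space (hf : KinRegular T Ω f) (hΩ : IsOpen Ω) (ht : t ∈ Ioo 0 T)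
    (hx : x ∈ Ω) (v : E3) : DifferentiableAt ℝ (fun y => f t y v) x :=
  (contDiffAt_space (f := fun s y => f s y v) hΩ (hf.contDiff v) ht hx).differentiableAt (by norm_num)

lemma KinRegular.differentiableAt_time (hf : KinRegular T Ω f) (hΩ : IsOpen Ω) (ht : t ∈ Ioo 0 T)
    (hx : x ∈ Ω) (v : E3) : DifferentiableAt ℝ (fun s => f s x v) t :=
  (contDiffAt_time (f := fun s y => f s y v) hΩ (hf.contDiff v) ht hx).differentiableAt (by norm_num)

/-- Directional derivatives of a function measurable in a parameter are measurable in it. -/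
lemma measurable_fderiv_apply {g : E3 → E3 → ℝ} {e : E3} (hm : ∀ᶠ y in nhds x, Measurable (g y))
    (hd : ∀ v, DifferentiableAt ℝ (fun y => g y v) x) :
    Measurable fun v => fderiv ℝ (fun y => g y v) x e := by
  have hlim : Filter.Tendsto (fun n : ℕ => x + ((n : ℝ) + 1)⁻¹ • e) .atTop (nhds x) := by
    have h : Filter.Tendsto (fun n : ℕ => ((n : ℝ) + 1)⁻¹) .atTop (nhds 0) := by
      simpa using tendsto_one_div_add_atTop_nhds_zero_nat (𝕜 := ℝ)
    simpa using tendsto_const_nhds.add (h.smul_const e)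
  -- Measurability is available only near `x`, so the sequence of difference quotients is shifted by
  -- `n₀`.
  obtain ⟨n₀, hn₀⟩ := Filter.eventually_atTop.1 (hlim.eventually hm)
  refine measurable_of_tendsto_metrizable
    (f := fun n : ℕ => fun v => ((n + n₀ : ℕ) + 1 : ℝ) *
      (g (x + (((n + n₀ : ℕ) : ℝ) + 1)⁻¹ • e) v - g x v)) (fun n => ?_) ?_
  · exact (((hn₀ _ (Nat.le_add_left _ _))).sub (mem_of_mem_nhds hm)).const_mul _
  · rw [tendsto_pi_nhds]
    intro v
    have h1 : HasDerivAt (fun r : ℝ => g (x + r • e) v) (fderiv ℝ (fun y => g y v) x e) 0 := by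
      have h2 : HasDerivAt (fun r : ℝ => x + r • e) e 0 := by
        simpa using ((hasDerivAt_id (0 : ℝ)).smul_const e).const_add x
      have h3 := (hd v).hasFDerivAt
      rw [show x = x + (0 : ℝ) • e by simp] at h3
      have := h3.comp_hasDerivAt (0 : ℝ) h2
      simpa [Function.comp_def] using this
    have h4 := hasDerivAt_iff_tendsto_slope_zero.1 h1
    have h5 : Filter.Tendsto (fun n : ℕ => (((n + n₀ : ℕ) : ℝ) + 1)⁻¹) .atTop (nhdsWithin 0 {0}ᶜ) := by
      refine tendsto_nhdsWithin_iff.2 ⟨?_, .of_forall fun n => ?_⟩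
      · have h : Filter.Tendsto (fun n : ℕ => ((n : ℝ) + 1)⁻¹) .atTop (nhds 0) := by
          simpa using tendsto_one_div_add_atTop_nhds_zero_nat (𝕜 := ℝ)
        exact h.comp (Filter.tendsto_add_atTop_nat n₀)
      · have : (((n + n₀ : ℕ) : ℝ) + 1)⁻¹ ≠ 0 := by positivity
        exact this
    have h6 := h4.comp h5
    simpa [Function.comp_def] using h6

lemma KinRegular.eventually_measurable (hf : KinRegular T Ω f) (hΩ : IsOpen Ω) (ht : t ∈ Ioo 0 T)
    (hx : x ∈ Ω) : ∀ᶠ y in nhds x, Measurable (f t y) := by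
  filter_upwards [hΩ.mem_nhds hx] with y hy using hf.measurable t ht y hy

lemma KinRegular.measurable_fderiv (hf : KinRegular T Ω f) (hΩ : IsOpen Ω) (ht : t ∈ Ioo 0 T)
    (hx : x ∈ Ω) (e : E3) : Measurable fun v => fderiv ℝ (fun y => f t y v) x e :=
  measurable_fderiv_apply (hf.eventually_measurable hΩ ht hx) (hf.differentiableAt_space hΩ ht hx)

lemma clm_eq_sum (L : E3 →L[ℝ] ℝ) :
    L = ∑ i, L (unitVec i) • (EuclideanSpace.proj i : E3 →L[ℝ] ℝ) := by
  ext v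
  rw [map_eq_sum]
  simp [mul_comm]

lemma KinRegularGrad.modGrowth_fderiv (hf : KinRegularGrad T Ω f) (hΩ : IsOpen Ω) (ht : t ∈ Ioo 0 T)
    (hx : x ∈ Ω) (e : E3) : ModGrowth fun v => fderiv ℝ (fun y => f t y v) x e := by
  obtain ⟨r, C, N, hr, -, h⟩ := hf.growth_grad.exists_bound hΩ ht hx
  refine .of_bound (hf.measurable_fderiv hΩ ht hx e) (C * ‖e‖) N fun v => ?_
  have h1 := (h t (Metric.mem_ball_self hr) x (Metric.mem_ball_self hr)).2.2 v
  calc _ ≤ ‖fderiv ℝ (fun y => f t y v) x‖ * ‖e‖ := ContinuousLinearMap.le_opNorm _ _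
    _ ≤ C * (1 + ‖v‖) ^ N * ‖e‖ := by gcongr
    _ = _ := by ring

lemma transport_eq_sum (f : ℝ → E3 → E3 → ℝ) (t : ℝ) (x v : E3) :
    transport f t x v = ∑ i, v i * fderiv ℝ (fun y => f t y v) x (unitVec i) := by
  rw [transport, map_eq_sum]; simp

lemma KinRegularGrad.modGrowth_transport (hf : KinRegularGrad T Ω f) (hΩ : IsOpen Ω)
    (ht : t ∈ Ioo 0 T) (hx : x ∈ Ω) : ModGrowth (transport f t x) := by
  have h : ModGrowth fun v => ∑ i, v i * fderiv ℝ (fun y => f t y v) x (unitVec i) :=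
    .sum fun i _ => (ModGrowth.coord i).mul (hf.modGrowth_fderiv hΩ ht hx _)
  exact h.congr (transport_eq_sum f t x)

/-- The moment `⟨a, q √μ⟩`. -/
def moment (q a : E3 → ℝ) : ℝ := ∫ v, a v * (q v * sqrtMaxw v)

lemma integrable_moment {a : E3 → ℝ} (ha : ModGrowth a) (hq : ModGrowth q) :
    Integrable fun v => a v * (q v * sqrtMaxw v) :=
  (ha.mul hq).integrable_mul_sqrtMaxw.congr (.of_forall fun v => by simp only; ring)

/-- Differentiation of moments in the space variable. -/
lemma KinRegularGrad.hasFDerivAt_moment (hf : KinRegularGrad T Ω f) (hΩ : IsOpen Ω)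
    (ht : t ∈ Ioo 0 T) (hx : x ∈ Ω) (hq : ModGrowth q) :
    ∃ L : E3 →L[ℝ] ℝ, HasFDerivAt (fun y => moment q (f t y)) L x ∧
      ∀ e, L e = moment q fun v => fderiv ℝ (fun y => f t y v) x e := by
  obtain ⟨r, C, N, hr, hC, h⟩ := hf.growth_grad.exists_bound hΩ ht hx
  obtain ⟨D, M, hD, hqb⟩ := hq.exists_nonneg
  have hb := h t (Metric.mem_ball_self hr)
  have hm : AEStronglyMeasurable
      (fun v => (q v * sqrtMaxw v) • fderiv ℝ (fun y => f t y v) x) volume := by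
    have e : (fun v => (q v * sqrtMaxw v) • fderiv ℝ (fun y => f t y v) x)
        = fun v => ∑ i, (q v * sqrtMaxw v * fderiv ℝ (fun y => f t y v) x (unitVec i)) •
          (EuclideanSpace.proj i : E3 →L[ℝ] ℝ) := by
      ext1 v
      conv_lhs => rw [clm_eq_sum (fderiv ℝ (fun y => f t y v) x)]
      simp only [Finset.smul_sum, smul_smul]
    rw [e]
    refine (Finset.measurable_sum _ fun i _ => ?_).aestronglyMeasurable
    exact ((hq.1.mul continuous_sqrtMaxw.measurable).mul
      (hf.measurable_fderiv hΩ ht hx _)).smul_const _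
  have hbound : Integrable fun v : E3 => (C * (1 + ‖v‖) ^ N) * (D * (1 + ‖v‖) ^ M) * sqrtMaxw v :=
    ModGrowth.integrable_mul_sqrtMaxw (.of_bound (by fun_prop) (C * D) (N + M) fun v => by
      rw [abs_of_nonneg (by positivity)]; exact le_of_eq (by ring))
  have key := hasFDerivAt_integral_of_dominated_of_fderiv_le (𝕜 := ℝ) (μ := volume)
    (F := fun y v => f t y v * (q v * sqrtMaxw v))
    (F' := fun y v => (q v * sqrtMaxw v) • fderiv ℝ (fun y => f t y v) y) (x₀ := x)
    (bound := fun v => (C * (1 + ‖v‖) ^ N) * (D * (1 + ‖v‖) ^ M) * sqrtMaxw v)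
    (Metric.ball_mem_nhds x hr) ?_ ?_ hm (.of_forall fun v y hy => ?_) hbound
    (.of_forall fun v y hy => ?_)
  · refine ⟨_, key, fun e => ?_⟩
    have hi : Integrable (fun v => (q v * sqrtMaxw v) • fderiv ℝ (fun y => f t y v) x) := by
      refine hbound.mono' hm (.of_forall fun v => ?_)
      rw [norm_smul, norm_mul, Real.norm_of_nonneg (sqrtMaxw_pos v).le, Real.norm_eq_abs]
      calc |q v| * sqrtMaxw v * ‖fderiv ℝ (fun y => f t y v) x‖
          ≤ (D * (1 + ‖v‖) ^ M) * sqrtMaxw v * (C * (1 + ‖v‖) ^ N) := by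
            have := (sqrtMaxw_pos v).le
            gcongr
            · exact hqb v
            · exact (hb x (Metric.mem_ball_self hr)).2.2 v
        _ = _ := by ring
    rw [ContinuousLinearMap.integral_apply hi, moment]
    congr 1 with v
    simp [mul_comm]
  · filter_upwards [Metric.ball_mem_nhds x hr] with y hy
    exact ((hf.measurable t ht y (hb y hy).2.1).mul
      (hq.1.mul continuous_sqrtMaxw.measurable)).aestronglyMeasurable
  · exact integrable_moment (hf.modGrowth hΩ ht hx) hq
  · rw [norm_smul, norm_mul, Real.norm_of_nonneg (sqrtMaxw_pos v).le, Real.norm_eq_abs]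
    calc |q v| * sqrtMaxw v * ‖fderiv ℝ (fun y => f t y v) y‖
        ≤ (D * (1 + ‖v‖) ^ M) * sqrtMaxw v * (C * (1 + ‖v‖) ^ N) := by
          have := (sqrtMaxw_pos v).le
          gcongr
          · exact hqb v
          · exact (hb y hy).2.2 v
      _ = _ := by ring
  · exact (hf.differentiableAt_space hΩ ht (hb y hy).2.1 v).hasFDerivAt.mul_const _

lemma KinRegularGrad.differentiableAt_moment (hf : KinRegularGrad T Ω f) (hΩ : IsOpen Ω)
    (ht : t ∈ Ioo 0 T) (hx : x ∈ Ω) (hq : ModGrowth q) :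
    DifferentiableAt ℝ (fun y => moment q (f t y)) x :=
  have ⟨_, h, _⟩ := hf.hasFDerivAt_moment hΩ ht hx hq
  h.differentiableAt

/-- The moments of `v·∇_x f` are divergences of moments of `f`. -/
lemma KinRegularGrad.moment_transport (hf : KinRegularGrad T Ω f) (hΩ : IsOpen Ω)
    (ht : t ∈ Ioo 0 T) (hx : x ∈ Ω) (hq : ModGrowth q) :
    moment q (transport f t x)
      = ∑ i, fderiv ℝ (fun y => moment (fun v => v i * q v) (f t y)) x (unitVec i) := by
  have e : ∀ i, fderiv ℝ (fun y => moment (fun v => v i * q v) (f t y)) x (unitVec i)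
      = moment (fun v => v i * q v) fun v => fderiv ℝ (fun y => f t y v) x (unitVec i) := by
    intro i
    obtain ⟨L, hL, hLe⟩ := hf.hasFDerivAt_moment hΩ ht hx ((ModGrowth.coord i).mul hq)
    rw [hL.fderiv, hLe]
  simp only [e]
  unfold moment
  rw [← integral_finsetSum _ fun i _ => integrable_moment (hf.modGrowth_fderiv hΩ ht hx _)
    ((ModGrowth.coord i).mul hq)]
  congr 1 with v
  rw [transport_eq_sum, Finset.sum_mul]
  exact Finset.sum_congr rfl fun i _ => by ring

end kin

/-! ### Moments of the second corrector -/

lemma hydroPoly_eq_sum (r : ℝ) (b : E3) (τ : ℝ) (v : E3) :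
    hydroPoly r b τ v = ∑ j, (![r, b 0, b 1, b 2, τ] : Fin 5 → ℝ) j * nullPoly j v := by
  simp [hydroPoly, nullPoly, Fin.sum_univ_succ, inner_eq_sum]
  ring

lemma pair_hydroPoly_nullBasis (r : ℝ) (b : E3) (τ : ℝ) (j : Fin 5) :
    pair (fun v => hydroPoly r b τ v * sqrtMaxw v) (nullBasis j)
      = (![r, b 0, b 1, b 2, τ] : Fin 5 → ℝ) j * nullNorm j := by
  have e : (fun v => hydroPoly r b τ v * sqrtMaxw v)
      = ∑ k, (![r, b 0, b 1, b 2, τ] : Fin 5 → ℝ) k • nullBasis k := by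
    ext v
    rw [hydroPoly_eq_sum, Finset.sum_mul, Finset.sum_apply]
    exact Finset.sum_congr rfl fun k _ => by
      rw [nullBasis_eq, Pi.smul_apply, smul_eq_mul, mul_assoc]
  rw [e, pair_sum_left _ (fun k _ => (memLp_nullBasis k).const_smul _) (memLp_nullBasis j)]
  simp only [pair_smul_left, pair_nullBasis]
  rw [Finset.sum_eq_single j (fun k _ hk => by simp [hk]) (by simp)]
  simp

lemma projP_hydroPoly (r : ℝ) (b : E3) (τ : ℝ) :
    projP (fun v => hydroPoly r b τ v * sqrtMaxw v) = fun v => hydroPoly r b τ v * sqrtMaxw v := by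
  ext v
  rw [projP_eq, hydroPoly_eq_sum]
  simp only [pair_hydroPoly_nullBasis, mul_div_cancel_right₀ _ (nullNorm_ne_zero _)]

lemma moment_eq_pair (q a : E3 → ℝ) : moment q a = pair a fun v => q v * sqrtMaxw v := rfl

lemma moment_nullPoly (j : Fin 5) (a : E3 → ℝ) : moment (nullPoly j) a = pair a (nullBasis j) := rfl

lemma nullPoly_zero : nullPoly 0 = fun _ => 1 := rfl

lemma nullPoly_four : nullPoly 4 = fun v => (‖v‖ ^ 2 - 3) / 2 := rfl

/-- The index of the basis function `v_i √μ`. -/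
def velIndex (i : Fin 3) : Fin 5 := ![1, 2, 3] i

lemma nullPoly_velIndex (i : Fin 3) : nullPoly (velIndex i) = fun v => v i := by
  fin_cases i <;> rfl

section corrector

variable {r : ℝ} {b : E3} {τ : ℝ} {f g : E3 → ℝ}

lemma memLp_of_isLInv (H : IsLInv g fun v => f v - projP f v) : MemLp f 2 := by
  have := H.1.1.add (memLp_projP f)
  convert this using 1
  ext v; simp

lemma pair_of_isLInv (H : IsLInv g fun v => f v - projP f v) {k : E3 → ℝ} (hk : InNullPerp k) :
    pair f k = pair (fun v => f v - projP f v) k := by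
  have e := pair_sub_left (memLp_of_isLInv H) (memLp_projP f) hk.1
  rw [pair_projP_inNullPerp f hk, sub_zero] at e
  exact e.symm

lemma moment_nullPoly_of_projP (hP : ∀ v, projP f v = hydroPoly r b τ v * sqrtMaxw v) (j : Fin 5) :
    moment (nullPoly j) f = (![r, b 0, b 1, b 2, τ] : Fin 5 → ℝ) j * nullNorm j := by
  rw [moment_nullPoly, ← pair_projP, funext hP, pair_hydroPoly_nullBasis]

lemma moment_one_of_projP (hP : ∀ v, projP f v = hydroPoly r b τ v * sqrtMaxw v) :
    moment (fun _ => 1) f = r := by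
  have := moment_nullPoly_of_projP hP 0
  simpa [nullNorm, nullPoly_zero] using this

lemma moment_coord_of_projP (hP : ∀ v, projP f v = hydroPoly r b τ v * sqrtMaxw v) (i : Fin 3) :
    moment (fun v => v i) f = b i := by
  have := moment_nullPoly_of_projP hP (velIndex i)
  rw [nullPoly_velIndex] at this
  rw [this]
  fin_cases i <;> simp [velIndex, nullNorm]

lemma moment_energy_of_projP (hP : ∀ v, projP f v = hydroPoly r b τ v * sqrtMaxw v) :
    moment (fun v => (‖v‖ ^ 2 - 3) / 2) f = τ * (3 / 2) := by
  have := moment_nullPoly_of_projP hP 4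
  simpa [nullNorm, nullPoly_four] using this

/-- The decomposition `v_i v_j = (v_i v_j - |v|²δ_ij/3) + δ_ij (1 + (2/3)(|v|²-3)/2)` separates the
microscopic stress from the pressure `r + τ`; the factor `2/3` compensates the squared norm `3/2` of
the energy function. -/
lemma moment_coord_coord (H : IsLInv g fun v => f v - projP f v)
    (hP : ∀ v, projP f v = hydroPoly r b τ v * sqrtMaxw v) (i j : Fin 3) :
    moment (fun v => v i * v j) f
      = pair (fun v => f v - projP f v) (devSrc i j) + (r + τ) * kron i j := by
  have hf := memLp_of_isLInv H
  rw [← pair_of_isLInv H (inNullPerp_devSrc i j)]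
  have h1 := moment_one_of_projP hP
  have h4 := moment_energy_of_projP hP
  rw [moment_eq_pair, show (fun v : E3 => v i * v j * sqrtMaxw v) = devSrc i j
    + ((kron i j) • nullBasis 0 + (2 / 3 * kron i j) • nullBasis 4) by
      ext v; simp [devSrc, nullBasis]; ring,
    pair_add_right (memLp_devSrc i j) (((memLp_nullBasis 0).const_smul _).add
      ((memLp_nullBasis 4).const_smul _)) hf,
    pair_add_right ((memLp_nullBasis 0).const_smul _) ((memLp_nullBasis 4).const_smul _) hf,
    pair_smul_right, pair_smul_right, ← moment_nullPoly, ← moment_nullPoly, nullPoly_zero,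
    nullPoly_four, h1, h4]
  ring

lemma moment_coord_energy (H : IsLInv g fun v => f v - projP f v)
    (hP : ∀ v, projP f v = hydroPoly r b τ v * sqrtMaxw v) (i : Fin 3) :
    moment (fun v => v i * ((‖v‖ ^ 2 - 3) / 2)) f
      = pair (fun v => f v - projP f v) (heatSrc i) + b i := by
  have hf := memLp_of_isLInv H
  rw [← pair_of_isLInv H (inNullPerp_heatSrc i), moment_eq_pair,
    show (fun v : E3 => v i * ((‖v‖ ^ 2 - 3) / 2) * sqrtMaxw v) = heatSrc i + nullBasis (velIndex i)
      by ext v; rw [Pi.add_apply, nullBasis_eq, nullPoly_velIndex, heatSrc]; ring,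
    pair_add_right (memLp_heatSrc i) (memLp_nullBasis _) hf, ← moment_nullPoly, nullPoly_velIndex,
    moment_coord_of_projP hP]

end corrector

/-! ### Second derivatives -/

lemma laplacian_eq_sum {G : Type*} [NormedAddCommGroup G] [NormedSpace ℝ G] (f : E3 → G) (x : E3) :
    Laplacian.laplacian f x = ∑ i, fderiv ℝ (fderiv ℝ f) x (unitVec i) (unitVec i) := by
  rw [InnerProductSpace.laplacian_eq_iteratedFDeriv_orthonormalBasis f
    (EuclideanSpace.basisFun (Fin 3) ℝ)]
  refine Finset.sum_congr rfl fun i _ => ?_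
  rw [iteratedFDeriv_two_apply]
  simp [unitVec]

lemma gradient_apply (f : E3 → ℝ) (x : E3) (j : Fin 3) : gradient f x j = fderiv ℝ f x (unitVec j) := by
  rw [← inner_gradient_left, unitVec, EuclideanSpace.inner_single_right]
  simp

lemma fderiv_coord {g : E3 → E3} {x : E3} (hg : DifferentiableAt ℝ g x) (j : Fin 3) (e : E3) :
    fderiv ℝ (fun y => g y j) x e = fderiv ℝ g x e j := by
  have h := ((EuclideanSpace.proj j : E3 →L[ℝ] ℝ).hasFDerivAt.comp x hg.hasFDerivAt).fderiv
  have e2 : (EuclideanSpace.proj j : E3 →L[ℝ] ℝ) ∘ g = fun y => g y j := rfl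
  rw [e2] at h
  rw [h]; rfl

lemma hasFDerivAt_fderiv_apply {G : Type*} [NormedAddCommGroup G] [NormedSpace ℝ G] {f : E3 → G}
    {x : E3} (hf : ContDiffAt ℝ 2 f x) (e : E3) :
    HasFDerivAt (fun y => fderiv ℝ f y e)
      ((ContinuousLinearMap.apply ℝ G e).comp (fderiv ℝ (fderiv ℝ f) x)) x := by
  have h : DifferentiableAt ℝ (fderiv ℝ f) x :=
    (hf.fderiv_right (m := 1) (by norm_num)).differentiableAt (by norm_num)
  exact (ContinuousLinearMap.apply ℝ G e).hasFDerivAt.comp x h.hasFDerivAt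

lemma fderiv_fderiv_comm {G : Type*} [NormedAddCommGroup G] [NormedSpace ℝ G] {f : E3 → G}
    {x : E3} (hf : ContDiffAt ℝ 2 f x) (e k : E3) :
    fderiv ℝ (fderiv ℝ f) x e k = fderiv ℝ (fderiv ℝ f) x k e :=
  (hf.isSymmSndFDerivAt (by simp)).eq e k

/-! ### Conservation laws for the second corrector -/

section conservation

open IsNSF

variable {T : ℝ} {Ω : Set E3} {κ : ℝ} {ρ : ℝ → E3 → ℝ} {u : ℝ → E3 → E3} {θ p : ℝ → E3 → ℝ}
  {ρ₂ : ℝ → E3 → ℝ} {u₂ : ℝ → E3 → E3} {θ₂ : ℝ → E3 → ℝ} {f₂ : ℝ → E3 → E3 → ℝ} {t : ℝ} {x : E3}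

lemma corrector_isLInv (hN : IsNSF T Ω κ ρ u θ p) (hΩ : IsOpen Ω)
    (hC : IsSecondCorrector T Ω κ ρ u p (hydro ρ u θ) ρ₂ u₂ θ₂ f₂) (ht : t ∈ Ioo 0 T) (hx : x ∈ Ω) :
    IsLInv (microSum κ (velGrad u t x) (tempGrad θ t x) (u t x) (θ t x))
      fun v => f₂ t x v - projP (f₂ t x) v := by
  rw [← hN.microSource_eq hΩ ht hx]
  exact hC.micro t ht x hx

/-- The quadratic term yields only the trace-free part of `u ⊗ u`. Its correction `-|u|²/3` joins
the pressure, which explains the combination `ρ₂ + θ₂ - |u|²/3` in the choice of `f₂`. -/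
lemma corrector_stress (hN : IsNSF T Ω κ ρ u θ p) (hΩ : IsOpen Ω) (hκ : κ ≠ 0)
    (hC : IsSecondCorrector T Ω κ ρ u p (hydro ρ u θ) ρ₂ u₂ θ₂ f₂) (ht : t ∈ Ioo 0 T) (hx : x ∈ Ω)
    (i j : Fin 3) : moment (fun v => v i * v j) (f₂ t x)
      = (ρ₂ t x + θ₂ t x - 1 / 3 * ‖u t x‖ ^ 2) * kron i j + u t x i * u t x j
        - κ * etaV * (velGrad u t x i j + velGrad u t x j i) := by
  have H := corrector_isLInv hN hΩ hC ht hx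
  rw [moment_coord_coord H (hC.macro_part t ht x hx), pair_isLInv_microSum_dev hκ H,
    hN.trace_velGrad ht hx]
  ring

lemma corrector_heatFlux (hN : IsNSF T Ω κ ρ u θ p) (hΩ : IsOpen Ω) (hκ : κ ≠ 0)
    (hC : IsSecondCorrector T Ω κ ρ u p (hydro ρ u θ) ρ₂ u₂ θ₂ f₂) (ht : t ∈ Ioo 0 T) (hx : x ∈ Ω)
    (i : Fin 3) : moment (fun v => v i * ((‖v‖ ^ 2 - 3) / 2)) (f₂ t x)
      = u₂ t x i + 5 / 2 * (θ t x * u t x i - κ * etaC * tempGrad θ t x i) := by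
  have H := corrector_isLInv hN hΩ hC ht hx
  rw [moment_coord_energy H (hC.macro_part t ht x hx), pair_isLInv_microSum_heat hκ H]
  ring

/-- Smoothness of the macroscopic fields of `f₂` is not assumed; it follows because they are moments
of `f₂`. -/
lemma differentiableAt_rho₂ (hΩ : IsOpen Ω) (hf : KinRegularGrad T Ω f₂)
    (hC : IsSecondCorrector T Ω κ ρ u p (hydro ρ u θ) ρ₂ u₂ θ₂ f₂) (ht : t ∈ Ioo 0 T)
    (hx : x ∈ Ω) : DifferentiableAt ℝ (ρ₂ t) x := by
  refine (hf.differentiableAt_moment hΩ ht hx (.const 1)).congr_of_eventuallyEq ?_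
  filter_upwards [hΩ.mem_nhds hx] with y hy
  exact (moment_one_of_projP (hC.macro_part t ht y hy)).symm

lemma differentiableAt_theta₂ (hΩ : IsOpen Ω) (hf : KinRegularGrad T Ω f₂)
    (hC : IsSecondCorrector T Ω κ ρ u p (hydro ρ u θ) ρ₂ u₂ θ₂ f₂) (ht : t ∈ Ioo 0 T)
    (hx : x ∈ Ω) : DifferentiableAt ℝ (θ₂ t) x := by
  refine ((hf.differentiableAt_moment hΩ ht hx hasMean_heat_weight.1).const_mul
    (2 / 3)).congr_of_eventuallyEq ?_
  filter_upwards [hΩ.mem_nhds hx] with y hy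
  rw [moment_energy_of_projP (hC.macro_part t ht y hy)]; ring

lemma differentiableAt_u₂ (hΩ : IsOpen Ω) (hf : KinRegularGrad T Ω f₂)
    (hC : IsSecondCorrector T Ω κ ρ u p (hydro ρ u θ) ρ₂ u₂ θ₂ f₂) (ht : t ∈ Ioo 0 T)
    (hx : x ∈ Ω) : DifferentiableAt ℝ (u₂ t) x := by
  refine (differentiableAt_euclidean (𝕜 := ℝ)).2 fun i => ?_
  refine (hf.differentiableAt_moment hΩ ht hx (.coord i)).congr_of_eventuallyEq ?_
  filter_upwards [hΩ.mem_nhds hx] with y hy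
  exact (moment_coord_of_projP (hC.macro_part t ht y hy) i).symm

lemma moment_transport_mass (hΩ : IsOpen Ω) (hf : KinRegularGrad T Ω f₂)
    (hC : IsSecondCorrector T Ω κ ρ u p (hydro ρ u θ) ρ₂ u₂ θ₂ f₂) (ht : t ∈ Ioo 0 T) (hx : x ∈ Ω) :
    moment (fun _ => 1) (transport f₂ t x) = -deriv (fun s => ρ s x) t := by
  rw [hf.moment_transport hΩ ht hx (.const 1), ← hC.div_u₂ t ht x hx]
  refine Finset.sum_congr rfl fun i _ => ?_
  have e : (fun y => moment (fun v => v i * 1) (f₂ t y)) =ᶠ[nhds x] fun y => u₂ t y i := by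
    filter_upwards [hΩ.mem_nhds hx] with y hy
    simp only [mul_one]
    exact moment_coord_of_projP (hC.macro_part t ht y hy) i
  rw [e.fderiv_eq, fderiv_coord (differentiableAt_u₂ hΩ hf hC ht hx)]
  rfl

/-- The divergence of the stress is `∇p + u·∇u - κη_v Δu`: by incompressibility `div(u ⊗ u) = u·∇u`,
and the transposed gradient has zero divergence. The momentum equation identifies it with `-∂_t u`.
-/
lemma moment_transport_momentum (hΩ : IsOpen Ω) (hf : KinRegularGrad T Ω f₂)
    (hC : IsSecondCorrector T Ω κ ρ u p (hydro ρ u θ) ρ₂ u₂ θ₂ f₂) (ht : t ∈ Ioo 0 T) (hx : x ∈ Ω)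
    (hN : IsNSF T Ω κ ρ u θ p) (hκ : κ ≠ 0) (j : Fin 3) :
    moment (fun v => v j) (transport f₂ t x) = -deriv (fun s => u s x) t j := by
  have cu := contDiffAt_space hΩ hN.contDiff_u ht hx
  have du := cu.differentiableAt (by norm_num)
  have dπ : DifferentiableAt ℝ (fun y => ρ₂ t y + θ₂ t y - 1 / 3 * ‖u t y‖ ^ 2) x :=
    ((differentiableAt_rho₂ hΩ hf hC ht hx).fun_add (differentiableAt_theta₂ hΩ hf hC ht hx)).fun_sub
      ((du.norm_sq ℝ).const_mul _)
  set H := fderiv ℝ (fderiv ℝ (u t)) x with hH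
  have dS : ∀ i k, HasFDerivAt (fun y => velGrad u t y i k)
      ((EuclideanSpace.proj k : E3 →L[ℝ] ℝ).comp
        ((ContinuousLinearMap.apply ℝ E3 (unitVec i)).comp H)) x := fun i k =>
    (EuclideanSpace.proj k : E3 →L[ℝ] ℝ).hasFDerivAt.comp x (hasFDerivAt_fderiv_apply cu (unitVec i))
  have duk : ∀ k, HasFDerivAt (fun y => u t y k)
      ((EuclideanSpace.proj k : E3 →L[ℝ] ℝ).comp (fderiv ℝ (u t) x)) x := fun k =>
    (EuclideanSpace.proj k : E3 →L[ℝ] ℝ).hasFDerivAt.comp x du.hasFDerivAt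
  have key : ∀ i, fderiv ℝ (fun y => moment (fun v => v i * v j) (f₂ t y)) x (unitVec i)
      = gradient (p t) x i * kron i j + (velGrad u t x i i * u t x j + u t x i * velGrad u t x i j)
        - κ * etaV * (H (unitVec i) (unitVec i) j + H (unitVec j) (unitVec i) i) := by
    intro i
    have e : (fun y => moment (fun v => v i * v j) (f₂ t y)) =ᶠ[nhds x] fun y =>
        (ρ₂ t y + θ₂ t y - 1 / 3 * ‖u t y‖ ^ 2) * kron i j + u t y i * u t y j
          - κ * etaV * (velGrad u t y i j + velGrad u t y j i) := by
      filter_upwards [hΩ.mem_nhds hx] with y hy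
      exact corrector_stress hN hΩ hκ hC ht hy i j
    rw [e.fderiv_eq, (((dπ.hasFDerivAt.mul_const (kron i j)).fun_add
      ((duk i).fun_mul (duk j))).fun_sub (((dS i j).fun_add (dS j i)).const_mul _)).fderiv,
      ← hC.grad_pressure t ht x hx, gradient_apply, fderiv_fderiv_comm cu (unitVec j)]
    simp [velGrad, hH]
    ring
  -- Differentiating `∇·u = 0`, which holds on a neighbourhood of `x`, in the direction `j`.
  have tr : ∑ i, H (unitVec j) (unitVec i) i = 0 := by
    have h0 : HasFDerivAt (fun y => ∑ i, velGrad u t y i i) (0 : E3 →L[ℝ] ℝ) x := by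
      refine (hasFDerivAt_const (0 : ℝ) x).congr_of_eventuallyEq ?_
      filter_upwards [hΩ.mem_nhds hx] with y hy
      exact hN.trace_velGrad ht hy
    have hs : HasFDerivAt (fun y => ∑ i, velGrad u t y i i) (∑ i,
        (EuclideanSpace.proj i : E3 →L[ℝ] ℝ).comp
          ((ContinuousLinearMap.apply ℝ E3 (unitVec i)).comp H)) x :=
      HasFDerivAt.fun_sum fun i _ => dS i i
    have h1 := hs.unique h0
    have h2 := congrArg (fun L : E3 →L[ℝ] ℝ => L (unitVec j)) h1
    simpa [sum_apply] using h2
  have lap : Laplacian.laplacian (u t) x j = ∑ i, H (unitVec i) (unitVec i) j := by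
    rw [laplacian_eq_sum]; simp [hH]
  have adv : fderiv ℝ (u t) x (u t x) j = ∑ i, u t x i * velGrad u t x i j := by
    rw [map_eq_sum]; simp [velGrad]
  have mom := congrArg (fun w : E3 => w j) (hN.momentum t ht x hx)
  simp only [PiLp.add_apply, PiLp.sub_apply, PiLp.smul_apply, PiLp.zero_apply, smul_eq_mul] at mom
  rw [lap, adv] at mom
  rw [hf.moment_transport hΩ ht hx (.coord j)]
  simp only [key, Finset.sum_add_distrib, Finset.sum_sub_distrib, ← Finset.mul_sum, ← Finset.sum_mul]
  rw [sum_mul_kron, hN.trace_velGrad ht hx, tr]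
  linarith

/-- The flux `u₂` contributes `∇·u₂ = -∂_tρ = ∂_tθ`, and by the heat equation the remaining flux
contributes `-(5/2)∂_tθ`; together they give `-(3/2)∂_tθ`. -/
lemma moment_transport_energy (hΩ : IsOpen Ω) (hf : KinRegularGrad T Ω f₂)
    (hC : IsSecondCorrector T Ω κ ρ u p (hydro ρ u θ) ρ₂ u₂ θ₂ f₂) (ht : t ∈ Ioo 0 T) (hx : x ∈ Ω)
    (hN : IsNSF T Ω κ ρ u θ p) (hκ : κ ≠ 0) :
    moment (fun v => (‖v‖ ^ 2 - 3) / 2) (transport f₂ t x)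
      = -(3 / 2) * deriv (fun s => θ s x) t := by
  have du := (contDiffAt_space hΩ hN.contDiff_u ht hx).differentiableAt (by norm_num)
  have cθ := contDiffAt_space hΩ hN.contDiff_theta ht hx
  have dθ := cθ.differentiableAt (by norm_num)
  have du2 := differentiableAt_u₂ hΩ hf hC ht hx
  have dk : ∀ (w : E3 → E3), DifferentiableAt ℝ w x → ∀ k, HasFDerivAt (fun y => w y k)
      ((EuclideanSpace.proj k : E3 →L[ℝ] ℝ).comp (fderiv ℝ w x)) x := fun w hw k =>
    (EuclideanSpace.proj k : E3 →L[ℝ] ℝ).hasFDerivAt.comp x hw.hasFDerivAt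
  set H := fderiv ℝ (fderiv ℝ (θ t)) x with hH
  have key : ∀ i, fderiv ℝ (fun y => moment (fun v => v i * ((‖v‖ ^ 2 - 3) / 2)) (f₂ t y)) x
      (unitVec i) = fderiv ℝ (u₂ t) x (unitVec i) i + 5 / 2 * (velGrad u t x i i * θ t x
        + u t x i * tempGrad θ t x i - κ * etaC * H (unitVec i) (unitVec i)) := by
    intro i
    have e : (fun y => moment (fun v => v i * ((‖v‖ ^ 2 - 3) / 2)) (f₂ t y)) =ᶠ[nhds x] fun y =>
        u₂ t y i + 5 / 2 * (θ t y * u t y i - κ * etaC * fderiv ℝ (θ t) y (unitVec i)) := by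
      filter_upwards [hΩ.mem_nhds hx] with y hy
      exact corrector_heatFlux hN hΩ hκ hC ht hy i
    rw [e.fderiv_eq, ((dk _ du2 i).fun_add (((dθ.hasFDerivAt.fun_mul (dk _ du i)).fun_sub
      ((hasFDerivAt_fderiv_apply cθ (unitVec i)).const_mul _)).const_mul _)).fderiv]
    simp [velGrad, tempGrad, hH]
    ring
  have lap : Laplacian.laplacian (θ t) x = ∑ i, H (unitVec i) (unitVec i) := laplacian_eq_sum _ _
  have adv : fderiv ℝ (θ t) x (u t x) = ∑ i, u t x i * tempGrad θ t x i := by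
    rw [map_eq_sum]; simp [tempGrad]
  have en := hN.heat t ht x hx
  rw [lap, adv] at en
  have hdiv : ∑ i, fderiv ℝ (u₂ t) x (unitVec i) i = deriv (fun s => θ s x) t := by
    have e1 : divg (u₂ t) x = _ := hC.div_u₂ t ht x hx
    have e2 : (fun s => ρ s x) =ᶠ[nhds t] fun s => -θ s x := by
      filter_upwards [isOpen_Ioo.mem_nhds ht] with s hs using hN.rho_eq hs hx
    rw [e2.deriv_eq, deriv.fun_neg, neg_neg] at e1
    exact e1
  rw [hf.moment_transport hΩ ht hx hasMean_heat_weight.1]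
  simp only [key, Finset.sum_add_distrib, Finset.sum_sub_distrib, ← Finset.mul_sum, ← Finset.sum_mul]
  rw [hN.trace_velGrad ht hx, hdiv]
  linarith

/-- The solvability condition of the next order. -/
lemma pair_transport_nullBasis (hΩ : IsOpen Ω) (hf : KinRegularGrad T Ω f₂)
    (hC : IsSecondCorrector T Ω κ ρ u p (hydro ρ u θ) ρ₂ u₂ θ₂ f₂) (ht : t ∈ Ioo 0 T) (hx : x ∈ Ω)
    (hN : IsNSF T Ω κ ρ u θ p) (hκ : κ ≠ 0) (j : Fin 5) :
    pair (transport f₂ t x) (nullBasis j) = -pair (dt (hydro ρ u θ) t x) (nullBasis j) := by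
  rw [hN.dt_hydro_eq hΩ ht hx, pair_hydroPoly_nullBasis]
  have a0 := moment_transport_mass hΩ hf hC ht hx
  have a1 := moment_transport_momentum hΩ hf hC ht hx hN hκ
  have a4 := moment_transport_energy hΩ hf hC ht hx hN hκ
  fin_cases j
  · change moment (fun _ => 1) _ = _
    rw [a0]; simp [nullNorm]
  · change moment (fun v => v 0) _ = _
    rw [a1]; simp [nullNorm]
  · change moment (fun v => v 1) _ = _
    rw [a1]; simp [nullNorm]
  · change moment (fun v => v 2) _ = _
    rw [a1]; simp [nullNorm]
  · change moment (fun v => (‖v‖ ^ 2 - 3) / 2) _ = _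
    rw [a4]; simp [nullNorm]; ring

/-- Since `∂_t f₁` already lies in `𝒩`, equality of moments is equality of functions. This trades
the term `∂_t f₁` of the expansion for `-𝐏(v·∇f₂)`. -/
lemma projP_transport (hΩ : IsOpen Ω) (hf : KinRegularGrad T Ω f₂)
    (hC : IsSecondCorrector T Ω κ ρ u p (hydro ρ u θ) ρ₂ u₂ θ₂ f₂) (ht : t ∈ Ioo 0 T) (hx : x ∈ Ω)
    (hN : IsNSF T Ω κ ρ u θ p) (hκ : κ ≠ 0) (v : E3) :
    projP (transport f₂ t x) v = -dt (hydro ρ u θ) t x v := by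
  have e : projP (dt (hydro ρ u θ) t x) v = dt (hydro ρ u θ) t x v := by
    rw [hN.dt_hydro_eq hΩ ht hx, projP_hydroPoly]
  rw [← e, projP_eq, projP_eq]
  simp only [pair_transport_nullBasis hΩ hf hC ht hx hN hκ, neg_div, neg_mul, Finset.sum_neg_distrib]

lemma projP_solvability (hΩ : IsOpen Ω) (hf : KinRegularGrad T Ω f₂)
    (hC : IsSecondCorrector T Ω κ ρ u p (hydro ρ u θ) ρ₂ u₂ θ₂ f₂) (ht : t ∈ Ioo 0 T) (hx : x ∈ Ω)
    (hN : IsNSF T Ω κ ρ u θ p) (hκ : κ ≠ 0) (v : E3) :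
    projP (fun w => dt (hydro ρ u θ) t x w + transport f₂ t x w
      - 2 / κ * gam (hydro ρ u θ t x) (f₂ t x) w) v = 0 := by
  refine congrFun (projP_eq_zero fun j => ?_) v
  have m1 : ModGrowth (dt (hydro ρ u θ) t x) := by
    rw [hN.dt_hydro_eq hΩ ht hx]; exact (ModGrowth.hydroPoly' _ _ _).mul .sqrtMaxw'
  have m3 := (ModGrowth.hydro' ρ u θ t x).gam (hf.modGrowth hΩ ht hx)
  have i1 := integrable_moment m1 (ModGrowth.nullPoly' j)
  have i2 := integrable_moment (hf.modGrowth_transport hΩ ht hx) (ModGrowth.nullPoly' j)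
  have i3 := integrable_moment (m3.const_mul (2 / κ)) (ModGrowth.nullPoly' j)
  have i12 : Integrable fun v => dt (hydro ρ u θ) t x v * (nullPoly j v * sqrtMaxw v)
      + transport f₂ t x v * (nullPoly j v * sqrtMaxw v) := i1.add i2
  have e3 : ∫ v, 2 / κ * gam (hydro ρ u θ t x) (f₂ t x) v * (nullPoly j v * sqrtMaxw v) = 0 := by
    simp only [mul_assoc]
    rw [integral_const_mul, integral_gam_mul_collInvariant (ModGrowth.hydro' ρ u θ t x)
      (hf.modGrowth hΩ ht hx) (.nullPoly' j) (collInvariant_nullPoly j), mul_zero]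
  have e4 := pair_transport_nullBasis hΩ hf hC ht hx hN hκ j
  unfold pair at e4 ⊢
  simp only [nullBasis_eq, add_mul, sub_mul] at e4 ⊢
  rw [integral_sub i12 i3, integral_add i1 i2, e3, sub_zero, e4]
  ring

end conservation

/-! ### The equation for the remainder -/

lemma gam_sqrtMaxw (h : E3 → ℝ) (v : E3) : gam sqrtMaxw h v = -(1 / 2) * linL h v := by
  rw [linL_eq_gam]; ring

lemma linL_sqrtMaxw (v : E3) : linL sqrtMaxw v = 0 := by
  have h := linL_collInvariant (ψ := fun _ => 1) (fun _ _ _ => rfl) v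
  simpa using h

/-- Bilinear expansion around equilibrium: `Γ(√μ,√μ) = 0`, and the mixed terms `2Γ(√μ,·)` are `-L`.
-/
lemma gam_expand {a b c : E3 → ℝ} (ha : ModGrowth a) (hb : ModGrowth b) (hc : ModGrowth c)
    (α β γ : ℝ) (v : E3) :
    gam (fun w => sqrtMaxw w + (α * a w + (β * b w + γ * c w)))
      (fun w => sqrtMaxw w + (α * a w + (β * b w + γ * c w))) v
      = -α * linL a v - β * linL b v - γ * linL c v + α ^ 2 * gam a a v + β ^ 2 * gam b b v
        + γ ^ 2 * gam c c v + 2 * α * β * gam a b v + 2 * α * γ * gam a c v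
        + 2 * β * γ * gam b c v := by
  have hm : ModGrowth sqrtMaxw := .sqrtMaxw'
  have h2 := (hb.const_mul β).add (hc.const_mul γ)
  have h1 := (ha.const_mul α).add h2
  have h0 := hm.add h1
  have right : ∀ {k : E3 → ℝ}, ModGrowth k →
      gam k (fun w => sqrtMaxw w + (α * a w + (β * b w + γ * c w))) v
        = gam k sqrtMaxw v + (α * gam k a v + (β * gam k b v + γ * gam k c v)) := by
    intro k hk
    rw [gam_add_right (hk.gamInt hm v) (hk.gamInt h1 v),
      gam_add_right (hk.gamInt (ha.const_mul α) v) (hk.gamInt h2 v),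
      gam_add_right (hk.gamInt (hb.const_mul β) v) (hk.gamInt (hc.const_mul γ) v),
      gam_const_mul_right, gam_const_mul_right, gam_const_mul_right]
  rw [right h0, gam_comm _ sqrtMaxw, gam_comm _ a, gam_comm _ b, gam_comm _ c, right hm, right ha,
    right hb, right hc, gam_comm a sqrtMaxw, gam_comm b sqrtMaxw, gam_comm c sqrtMaxw, gam_comm b a,
    gam_comm c a, gam_comm c b]
  simp only [gam_sqrtMaxw, linL_sqrtMaxw]
  ring

section remainder

variable {T : ℝ} {Ω : Set E3} {ε κ : ℝ} {ρ : ℝ → E3 → ℝ} {u : ℝ → E3 → E3} {θ p : ℝ → E3 → ℝ}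
  {ρ₂ : ℝ → E3 → ℝ} {u₂ : ℝ → E3 → E3} {θ₂ : ℝ → E3 → ℝ} {f₂ : ℝ → E3 → E3 → ℝ} {t : ℝ} {x : E3}

lemma order_two (hκ : κ ≠ 0)
    (hC : IsSecondCorrector T Ω κ ρ u p (hydro ρ u θ) ρ₂ u₂ θ₂ f₂) (ht : t ∈ Ioo 0 T) (hx : x ∈ Ω)
    (v : E3) : transport (hydro ρ u θ) t x v - 1 / κ * gam (hydro ρ u θ t x) (hydro ρ u θ t x) v
      + 1 / κ * linL (f₂ t x) v = 0 := by
  rw [linL_secondCorrector (hC.micro t ht x hx), microSource]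
  field_simp
  ring

theorem remainderEq (hN : IsNSF T Ω κ ρ u θ p) (hΩ : IsOpen Ω) (hε : 0 < ε) (hκ : 0 < κ)
    (hf : KinRegularGrad T Ω f₂)
    (hC : IsSecondCorrector T Ω κ ρ u p (hydro ρ u θ) ρ₂ u₂ θ₂ f₂) {F fR : ℝ → E3 → E3 → ℝ}
    (hR : KinRegular T Ω fR)
    (hF : ∀ t ∈ Ioo 0 T, ∀ x ∈ Ω, ∀ v : E3, F t x v = maxw v + ε * hydro ρ u θ t x v * sqrtMaxw v
      + ε ^ 2 * f₂ t x v * sqrtMaxw v + ε ^ (3 / 2 : ℝ) * fR t x v * sqrtMaxw v)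
    (hB : SolvesBoltzmann T Ω ε (κ * ε) F) : RemainderEq T Ω ε κ (hydro ρ u θ) f₂ fR := by
  intro t ht x hx v
  -- Writing every power of `ε` as an integer power of `s = √ε` makes the final comparison an
  -- identity of rational functions.
  set s : ℝ := ε ^ (1 / 2 : ℝ) with hs
  have hs0 : 0 < s := Real.rpow_pos_of_pos hε _
  have hs2 : ε = s ^ 2 := by
    rw [hs, ← Real.rpow_natCast, ← Real.rpow_mul hε.le]; norm_num
  have hs3 : ε ^ (3 / 2 : ℝ) = s ^ 3 := by
    rw [hs, ← Real.rpow_natCast, ← Real.rpow_mul hε.le]; norm_num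
  rw [hs3] at hF
  have hF' : ∀ t ∈ Ioo 0 T, ∀ x ∈ Ω, ∀ v, F t x v = sqrtMaxw v *
      (sqrtMaxw v + (ε * hydro ρ u θ t x v + (ε ^ 2 * f₂ t x v + s ^ 3 * fR t x v))) := by
    intro t ht x hx v
    rw [hF t ht x hx, ← sqrtMaxw_mul_self]; ring
  have m1 := ModGrowth.hydro' ρ u θ t x
  have m2 := hf.modGrowth hΩ ht hx
  have m3 := hR.modGrowth hΩ ht hx
  have c1 : ContDiffOn ℝ 1 (fun z : ℝ × E3 => hydro ρ u θ z.1 z.2 v) (Ioo 0 T ×ˢ Ω) := by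
    have e2 : ContDiffOn ℝ 2 (fun z : ℝ × E3 => hydro ρ u θ z.1 z.2 v) (Ioo 0 T ×ˢ Ω) :=
      ((hN.contDiff_rho.add (hN.contDiff_u.inner ℝ contDiffOn_const)).add
        (hN.contDiff_theta.mul contDiffOn_const)).mul contDiffOn_const
    exact e2.of_le (by norm_num)
  have d1t := ((contDiffAt_time (f := fun s y => hydro ρ u θ s y v) hΩ c1 ht hx).differentiableAt
    (by norm_num)).hasDerivAt
  have d1x := ((contDiffAt_space (f := fun s y => hydro ρ u θ s y v) hΩ c1 ht hx).differentiableAt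
    (by norm_num)).hasFDerivAt
  have d2t := (hf.differentiableAt_time hΩ ht hx v).hasDerivAt
  have d2x := (hf.differentiableAt_space hΩ ht hx v).hasFDerivAt
  have d3t := (hR.differentiableAt_time hΩ ht hx v).hasDerivAt
  have d3x := (hR.differentiableAt_space hΩ ht hx v).hasFDerivAt
  have eT : dt F t x v = sqrtMaxw v *
      (ε * dt (hydro ρ u θ) t x v + (ε ^ 2 * dt f₂ t x v + s ^ 3 * dt fR t x v)) := by
    have e : (fun r => F r x v) =ᶠ[nhds t] fun r => sqrtMaxw v *
      (sqrtMaxw v + (ε * hydro ρ u θ r x v + (ε ^ 2 * f₂ r x v + s ^ 3 * fR r x v))) := by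
      filter_upwards [isOpen_Ioo.mem_nhds ht] with r hr using hF' r hr x hx v
    rw [dt, e.deriv_eq]
    exact ((((d1t.const_mul ε).fun_add ((d2t.const_mul (ε ^ 2)).fun_add
      (d3t.const_mul (s ^ 3)))).const_add _).const_mul _).deriv
  have eX : transport F t x v = sqrtMaxw v *
      (ε * transport (hydro ρ u θ) t x v + (ε ^ 2 * transport f₂ t x v + s ^ 3 * transport fR t x v)) := by
    have e : (fun y => F t y v) =ᶠ[nhds x] fun y => sqrtMaxw v *
      (sqrtMaxw v + (ε * hydro ρ u θ t y v + (ε ^ 2 * f₂ t y v + s ^ 3 * fR t y v))) := by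
      filter_upwards [hΩ.mem_nhds hx] with y hy using hF' t ht y hy v
    rw [transport, e.fderiv_eq, ((((d1x.const_mul ε).fun_add ((d2x.const_mul (ε ^ 2)).fun_add
      (d3x.const_mul (s ^ 3)))).const_add _).const_mul _).fderiv]
    simp [transport]
    ring
  have eQ : collQ (F t x) (F t x) v = sqrtMaxw v * gam
      (fun w => sqrtMaxw w + (ε * hydro ρ u θ t x w + (ε ^ 2 * f₂ t x w + s ^ 3 * fR t x w)))
      (fun w => sqrtMaxw w + (ε * hydro ρ u θ t x w + (ε ^ 2 * f₂ t x w + s ^ 3 * fR t x w))) v := by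
    rw [← collQ_eq_gam, funext (hF' t ht x hx)]
  have hb := hB t ht x hx v
  rw [eT, eX, eQ, gam_expand m1 m2 m3, linL_hydro] at hb
  have hb2 : ε * (ε * dt (hydro ρ u θ) t x v + (ε ^ 2 * dt f₂ t x v + s ^ 3 * dt fR t x v))
      + (ε * transport (hydro ρ u θ) t x v + (ε ^ 2 * transport f₂ t x v + s ^ 3 * transport fR t x v))
      = 1 / (κ * ε) * (-ε * 0 - ε ^ 2 * linL (f₂ t x) v - s ^ 3 * linL (fR t x) v
        + ε ^ 2 * gam (hydro ρ u θ t x) (hydro ρ u θ t x) v + (ε ^ 2) ^ 2 * gam (f₂ t x) (f₂ t x) v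
        + (s ^ 3) ^ 2 * gam (fR t x) (fR t x) v
        + 2 * ε * ε ^ 2 * gam (hydro ρ u θ t x) (f₂ t x) v
        + 2 * ε * s ^ 3 * gam (hydro ρ u θ t x) (fR t x) v
        + 2 * ε ^ 2 * s ^ 3 * gam (f₂ t x) (fR t x) v) := by
    apply mul_left_cancel₀ (sqrtMaxw_pos v).ne'
    linear_combination hb
  have h2 := order_two hκ.ne' hC ht hx v
  have hP := projP_transport hΩ hf hC ht hx hN hκ.ne' v
  rw [hP, gam_add_left (m1.gamInt m3 v) ((m2.const_mul ε).gamInt m3 v), gam_const_mul_left]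
  rw [hs2] at hb2 ⊢
  -- Eliminating `v·∇f₁` cancels the order `ε` in `hb2`; what is left is the remainder equation
  -- times `ε^(5/2)`.
  have h2' : transport (hydro ρ u θ) t x v = 1 / κ * gam (hydro ρ u θ t x) (hydro ρ u θ t x) v
    - 1 / κ * linL (f₂ t x) v := by linear_combination h2
  rw [h2'] at hb2
  generalize gam (hydro ρ u θ t x) (hydro ρ u θ t x) v = G11 at *
  generalize gam (f₂ t x) (f₂ t x) v = G22 at *
  generalize gam (fR t x) (fR t x) v = GRR at *
  generalize gam (hydro ρ u θ t x) (f₂ t x) v = G12 at *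
  generalize gam (hydro ρ u θ t x) (fR t x) v = G1R at *
  generalize gam (f₂ t x) (fR t x) v = G2R at *
  have hk := hκ.ne'
  have hs' := hs0.ne'
  field_simp at hb2 ⊢
  apply mul_left_cancel₀ hs'
  linear_combination hb2

end remainder

/-! ### Mixed partial derivatives -/

/-- If `f` and `∂_t f` are `C¹` then `∂_t ∇_x f = ∇_x ∂_t f`. -/
lemma hasDerivAt_fderiv_time {T : ℝ} {Ω : Set E3} {f : ℝ → E3 → ℝ} {t : ℝ} {x : E3}
    (hΩ : IsOpen Ω) (hf : ContDiffOn ℝ 1 (fun z : ℝ × E3 => f z.1 z.2) (Ioo 0 T ×ˢ Ω))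
    (hg : ContDiffOn ℝ 1 (fun z : ℝ × E3 => deriv (fun s => f s z.2) z.1) (Ioo 0 T ×ˢ Ω))
    (ht : t ∈ Ioo 0 T) (hx : x ∈ Ω) :
    HasDerivAt (fun s => fderiv ℝ (f s) x) (fderiv ℝ (fun y => deriv (fun s => f s y) t) x) t := by
  set g : ℝ → E3 → ℝ := fun s y => deriv (fun r => f r y) s with hgdef
  set D := fderiv ℝ (g t) x with hD
  have hgc := contDiffAt_of_contDiffOn (f := g) hΩ hg ht hx
  have hev : ∀ᶠ z in nhds (t, x), z ∈ Ioo 0 T ×ˢ Ω := (isOpen_Ioo.prod hΩ).mem_nhds ⟨ht, hx⟩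
  have hgs : ∀ z : ℝ × E3, z ∈ Ioo 0 T ×ˢ Ω → HasFDerivAt (g z.1)
      ((fderiv ℝ (fun z : ℝ × E3 => g z.1 z.2) z).comp (ContinuousLinearMap.inr ℝ ℝ E3)) z.2 := by
    intro z hz
    have h1 := ((contDiffAt_of_contDiffOn (f := g) hΩ hg hz.1 hz.2).differentiableAt
      (by norm_num)).hasFDerivAt
    exact h1.comp z.2 (hasFDerivAt_prodMk_right z.1 z.2)
  have hcont : ContinuousAt (fun z : ℝ × E3 => fderiv ℝ (g z.1) z.2) (t, x) := by
    have h1 : ContinuousAt (fderiv ℝ (fun z : ℝ × E3 => g z.1 z.2)) (t, x) :=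
      (hgc.fderiv_right (m := 0) (by norm_num)).continuousAt
    have h2 : ContinuousAt (fun z => (fderiv ℝ (fun z : ℝ × E3 => g z.1 z.2) z).comp
        (ContinuousLinearMap.inr ℝ ℝ E3)) (t, x) := h1.clm_comp continuousAt_const
    refine h2.congr ?_
    filter_upwards [hev] with z hz using (hgs z hz).fderiv.symm
  refine HasDerivAt.of_isLittleO (Asymptotics.isLittleO_iff.2 fun c hc => ?_)
  have h3 : ∀ᶠ z in nhds (t, x), z ∈ Ioo 0 T ×ˢ Ω ∧ ‖fderiv ℝ (g z.1) z.2 - D‖ ≤ c := by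
    refine hev.and ?_
    have := Metric.continuousAt_iff'.1 hcont c hc
    filter_upwards [this] with z hz
    rw [dist_eq_norm] at hz
    exact hz.le
  obtain ⟨r, hr, hball⟩ := Metric.eventually_nhds_iff_ball.1 h3
  have hb : ∀ s ∈ Metric.ball t r, ∀ y ∈ Metric.ball x r,
      (s ∈ Ioo 0 T ∧ y ∈ Ω) ∧ ‖fderiv ℝ (g s) y - D‖ ≤ c := fun s hs y hy =>
    hball (s, y) (by rw [← ball_prod_same]; exact ⟨hs, hy⟩)
  filter_upwards [Metric.ball_mem_nhds t hr] with s hs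
  have hsT := (hb s hs x (Metric.mem_ball_self hr)).1.1
  have dfs := (contDiffAt_space hΩ hf hsT hx).differentiableAt (by norm_num)
  have dft := (contDiffAt_space hΩ hf ht hx).differentiableAt (by norm_num)
  -- The error to be estimated is the derivative at `x` of this function, so it suffices to bound
  -- the increments of the function from `x` by `c |s - t|` times the distance. `f` need not be
  -- `C²`, so the classical symmetry of second derivatives does not apply.
  have hder : HasFDerivAt (fun y => f s y - f t y - (s - t) • D y)
      (fderiv ℝ (f s) x - fderiv ℝ (f t) x - (s - t) • D) x :=
    (dfs.hasFDerivAt.fun_sub dft.hasFDerivAt).fun_sub (D.hasFDerivAt.const_smul (s - t))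
  refine hder.le_of_lip' (by positivity) ?_
  filter_upwards [Metric.ball_mem_nhds x hr] with y hy
  have hφ : ∀ q ∈ Metric.ball t r, HasDerivWithinAt (fun q => f q y - f q x - (q - t) * D (y - x))
      (g q y - g q x - D (y - x)) (Metric.ball t r) q := by
    intro q hq
    have d1 := ((contDiffAt_time hΩ hf (hb q hq y hy).1.1 (hb q hq y hy).1.2).differentiableAt
      (by norm_num)).hasDerivAt
    have d2 := ((contDiffAt_time hΩ hf (hb q hq y hy).1.1 hx).differentiableAt
      (by norm_num)).hasDerivAt
    have d3 : HasDerivAt (fun q => (q - t) * D (y - x)) (D (y - x)) q := by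
      simpa using ((hasDerivAt_id q).sub_const t).mul_const (D (y - x))
    exact ((d1.fun_sub d2).fun_sub d3).hasDerivWithinAt
  -- The mean value inequality is used twice: here in space for `∂_t f`, whose gradient stays within
  -- `c` of `D`, and then in time for the increment of `f` between `x` and `y`.
  have hbd : ∀ q ∈ Metric.ball t r, ‖g q y - g q x - D (y - x)‖ ≤ c * ‖y - x‖ := by
    intro q hq
    exact Convex.norm_image_sub_le_of_norm_hasFDerivWithin_le' (f' := fun y => fderiv ℝ (g q) y)
      (fun z hz => ((hgs (q, z) (hb q hq z hz).1).differentiableAt.hasFDerivAt).hasFDerivWithinAt)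
      (fun z hz => (hb q hq z hz).2) (convex_ball x r) (Metric.mem_ball_self hr) hy
  have h := Convex.norm_image_sub_le_of_norm_hasDerivWithin_le hφ hbd (convex_ball t r)
    (Metric.mem_ball_self hr) hs
  calc _ = ‖f s y - f s x - (s - t) * D (y - x) - (f t y - f t x - (t - t) * D (y - x))‖ := by
        congr 1; simp only [smul_eq_mul, map_sub]; ring
    _ ≤ c * ‖y - x‖ * ‖s - t‖ := h
    _ = _ := by ring

/-! ### Differentiation in time -/

/-- `a` is differentiable in time near `t` with derivative `a'`, both of moderate growth in the
velocity uniformly near `t`. -/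
structure TimeReg (a a' : ℝ → E3 → ℝ) (t : ℝ) : Prop where
  measurable : ∀ᶠ s in nhds t, Measurable (a s)
  measurable' : Measurable (a' t)
  hasDerivAt : ∀ᶠ s in nhds t, ∀ v, HasDerivAt (fun r => a r v) (a' s v) s
  growth : ∃ (C : ℝ) (N : ℕ), 0 ≤ C ∧ ∀ᶠ s in nhds t, ∀ v, |a s v| ≤ C * (1 + ‖v‖) ^ N
  growth' : ∃ (C : ℝ) (N : ℕ), 0 ≤ C ∧ ∀ᶠ s in nhds t, ∀ v, |a' s v| ≤ C * (1 + ‖v‖) ^ N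

namespace TimeReg

variable {a a' b b' : ℝ → E3 → ℝ} {t : ℝ}

lemma modGrowth (h : TimeReg a a' t) : ModGrowth (a t) :=
  have ⟨C, N, _, hb⟩ := h.growth
  .of_bound h.measurable.self_of_nhds C N hb.self_of_nhds

lemma modGrowth' (h : TimeReg a a' t) : ModGrowth (a' t) :=
  have ⟨C, N, _, hb⟩ := h.growth'
  .of_bound h.measurable' C N hb.self_of_nhds

lemma const {k : E3 → ℝ} (hk : ModGrowth k) (t : ℝ) : TimeReg (fun _ => k) (fun _ _ => 0) t := by
  obtain ⟨C, N, hC, hb⟩ := hk.exists_nonneg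
  exact ⟨.of_forall fun _ => hk.1, measurable_const, .of_forall fun s v => hasDerivAt_const _ _,
    ⟨C, N, hC, .of_forall fun _ => hb⟩, ⟨0, 0, le_rfl, .of_forall fun s v => by simp⟩⟩

lemma growth_add {a b : ℝ → E3 → ℝ} {t : ℝ}
    (ha : ∃ (C : ℝ) (N : ℕ), 0 ≤ C ∧ ∀ᶠ s in nhds t, ∀ v, |a s v| ≤ C * (1 + ‖v‖) ^ N)
    (hb : ∃ (C : ℝ) (N : ℕ), 0 ≤ C ∧ ∀ᶠ s in nhds t, ∀ v, |b s v| ≤ C * (1 + ‖v‖) ^ N) :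
    ∃ (C : ℝ) (N : ℕ), 0 ≤ C ∧ ∀ᶠ s in nhds t, ∀ v, |a s v + b s v| ≤ C * (1 + ‖v‖) ^ N := by
  obtain ⟨C, N, hC, h⟩ := ha
  obtain ⟨D, K, hD, k⟩ := hb
  refine ⟨C + D, N + K, by positivity, ?_⟩
  filter_upwards [h, k] with s hs ks v
  have h1 : (1 : ℝ) ≤ 1 + ‖v‖ := by linarith [norm_nonneg v]
  calc |a s v + b s v| ≤ |a s v| + |b s v| := abs_add_le _ _
    _ ≤ C * (1 + ‖v‖) ^ (N + K) + D * (1 + ‖v‖) ^ (N + K) := by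
        gcongr ?_ + ?_
        · exact (hs v).trans (by gcongr; omega)
        · exact (ks v).trans (by gcongr; omega)
    _ = _ := by ring

lemma add (ha : TimeReg a a' t) (hb : TimeReg b b' t) :
    TimeReg (fun s v => a s v + b s v) (fun s v => a' s v + b' s v) t where
  measurable := by filter_upwards [ha.measurable, hb.measurable] with s h k using h.add k
  measurable' := ha.measurable'.add hb.measurable'
  hasDerivAt := by
    filter_upwards [ha.hasDerivAt, hb.hasDerivAt] with s h k v using (h v).fun_add (k v)
  growth := growth_add ha.growth hb.growth
  growth' := growth_add ha.growth' hb.growth'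

lemma const_mul (ha : TimeReg a a' t) (c : ℝ) :
    TimeReg (fun s v => c * a s v) (fun s v => c * a' s v) t where
  measurable := by filter_upwards [ha.measurable] with s h using h.const_mul c
  measurable' := ha.measurable'.const_mul c
  hasDerivAt := by filter_upwards [ha.hasDerivAt] with s h v using (h v).const_mul c
  growth := by
    obtain ⟨C, N, hC, h⟩ := ha.growth
    refine ⟨|c| * C, N, by positivity, ?_⟩
    filter_upwards [h] with s hs v
    rw [abs_mul, mul_assoc]; gcongr; exact hs v
  growth' := by
    obtain ⟨C, N, hC, h⟩ := ha.growth'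
    refine ⟨|c| * C, N, by positivity, ?_⟩
    filter_upwards [h] with s hs v
    rw [abs_mul, mul_assoc]; gcongr; exact hs v

/-- Differentiation of a moment in time. -/
lemma hasDerivAt_moment (ha : TimeReg a a' t) {q : E3 → ℝ} (hq : ModGrowth q) :
    HasDerivAt (fun s => moment q (a s)) (moment q (a' t)) t := by
  obtain ⟨C, N, hC, hb⟩ := ha.growth'
  obtain ⟨D, M, hD, hqb⟩ := hq.exists_nonneg
  have hbound : Integrable fun v : E3 => (C * (1 + ‖v‖) ^ N) * (D * (1 + ‖v‖) ^ M) * sqrtMaxw v :=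
    ModGrowth.integrable_mul_sqrtMaxw (.of_bound (by fun_prop) (C * D) (N + M) fun v => by
      rw [abs_of_nonneg (by positivity)]; exact le_of_eq (by ring))
  have hqm := hq.1.mul continuous_sqrtMaxw.measurable
  refine (hasDerivAt_integral_of_dominated_loc_of_deriv_le
    (F := fun s v => a s v * (q v * sqrtMaxw v)) (F' := fun s v => a' s v * (q v * sqrtMaxw v))
    (bound := fun v => (C * (1 + ‖v‖) ^ N) * (D * (1 + ‖v‖) ^ M) * sqrtMaxw v)
    (hb.and ha.hasDerivAt) ?_ (integrable_moment ha.modGrowth hq)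
    (ha.measurable'.mul hqm).aestronglyMeasurable (.of_forall fun v s hs => ?_) hbound
    (.of_forall fun v s hs => (hs.2 v).mul_const _)).2
  · filter_upwards [ha.measurable] with s hs using (hs.mul hqm).aestronglyMeasurable
  · rw [norm_mul, norm_mul, Real.norm_of_nonneg (sqrtMaxw_pos v).le, ← mul_assoc]
    have := (sqrtMaxw_pos v).le
    gcongr
    · exact hs.1 v
    · exact hqb v

lemma gamKer_hasDerivAt {s : ℝ} (ha : ∀ v, HasDerivAt (fun r => a r v) (a' s v) s)
    (hb : ∀ v, HasDerivAt (fun r => b r v) (b' s v) s) (v : E3) (p : E3 × S2) :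
    HasDerivAt (fun r => gamKer (a r) (b r) v p)
      (gamKer (a' s) (b s) v p + gamKer (a s) (b' s) v p) s := by
  unfold gamKer
  have h := ((((ha (vPost v p.1 p.2)).fun_mul (hb (wPost v p.1 p.2))).fun_add
    ((hb (vPost v p.1 p.2)).fun_mul (ha (wPost v p.1 p.2)))).fun_sub
    ((ha v).fun_mul (hb p.1))).fun_sub ((hb v).fun_mul (ha p.1))
  exact (h.const_mul (|inner ℝ (v - p.1) (p.2 : E3)| * sqrtMaxw p.1)).congr_deriv (by ring)

/-- Differentiation of `Γ` in time. -/
lemma hasDerivAt_gam (ha : TimeReg a a' t) (hb : TimeReg b b' t) (v : E3) :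
    HasDerivAt (fun s => gam (a s) (b s) v) (gam (a' t) (b t) v + gam (a t) (b' t) v) t := by
  obtain ⟨C, N, hC, h⟩ := ha.growth
  obtain ⟨C', N', hC', h'⟩ := ha.growth'
  obtain ⟨D, K, hD, k⟩ := hb.growth
  obtain ⟨D', K', hD', k'⟩ := hb.growth'
  have meas : ∀ {c d : E3 → ℝ}, Measurable c → Measurable d →
      AEStronglyMeasurable (gamKer c d v) velSphere := fun hc hd =>
    ((measurable_gamKer hc hd).comp (measurable_prodMk_left (x := v))).aestronglyMeasurable
  have i1 := ha.modGrowth'.gamInt hb.modGrowth v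
  have i2 := ha.modGrowth.gamInt hb.modGrowth' v
  have key := (hasDerivAt_integral_of_dominated_loc_of_deriv_le (μ := velSphere)
    (F := fun s p => gamKer (a s) (b s) v p)
    (F' := fun s p => gamKer (a' s) (b s) v p + gamKer (a s) (b' s) v p)
    (bound := fun p => 4 * C' * D * (1 + ‖v‖) ^ (N' + K + 1)
      * ((1 + ‖p.1‖) ^ (N' + K + 1) * sqrtMaxw p.1) + 4 * C * D' * (1 + ‖v‖) ^ (N + K' + 1)
      * ((1 + ‖p.1‖) ^ (N + K' + 1) * sqrtMaxw p.1))
    ((h.and h').and ((k.and k').and (ha.hasDerivAt.and hb.hasDerivAt))) ?_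
    (ha.modGrowth.gamInt hb.modGrowth v)
    ((meas ha.measurable' hb.modGrowth.1).add (meas ha.modGrowth.1 hb.measurable'))
    (.of_forall fun p s hs => ?_)
    (((integrable_weight _).const_mul _).add ((integrable_weight _).const_mul _))
    (.of_forall fun p s hs => gamKer_hasDerivAt hs.2.2.1 hs.2.2.2 v p)).2
  · have e : (fun s => gam (a s) (b s) v) =ᶠ[nhds t]
        fun s => 1 / 2 * ∫ p, gamKer (a s) (b s) v p ∂velSphere := by
      filter_upwards [ha.measurable, hb.measurable, h, k] with s ms ns hs ks
      exact ((ModGrowth.of_bound ms C N hs).gamInt (.of_bound ns D K ks) v).gam_eq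
    refine ((key.const_mul (1 / 2)).congr_of_eventuallyEq e).congr_deriv ?_
    rw [integral_add i1 i2, i1.gam_eq, i2.gam_eq]; ring
  · filter_upwards [ha.measurable, hb.measurable] with s ms ns using meas ms ns
  · exact (norm_add_le _ _).trans (add_le_add (abs_gamKer_le hC' hD hs.1.2 hs.2.1.1 v p)
      (abs_gamKer_le hC hD' hs.1.1 hs.2.1.2 v p))

end TimeReg

section kinetic

variable {T : ℝ} {Ω : Set E3} {f : ℝ → E3 → E3 → ℝ} {t : ℝ} {x : E3}

lemma PolyGrowth.eventually_time {G : Type*} [NormedAddCommGroup G] {g : ℝ → E3 → E3 → G}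
    (hg : PolyGrowth T Ω g) (hΩ : IsOpen Ω) (ht : t ∈ Ioo 0 T) (hx : x ∈ Ω) :
    ∃ (C : ℝ) (N : ℕ), 0 ≤ C ∧ ∀ᶠ s in nhds t, ∀ v, ‖g s x v‖ ≤ C * (1 + ‖v‖) ^ N := by
  obtain ⟨r, C, N, hr, hC, h⟩ := hg.exists_bound hΩ ht hx
  refine ⟨C, N, hC, ?_⟩
  filter_upwards [Metric.ball_mem_nhds t hr] with s hs
  exact (h s hs x (Metric.mem_ball_self hr)).2.2

lemma KinRegular.timeReg (hf : KinRegular T Ω f) (hf' : KinRegular T Ω (dt f)) (hΩ : IsOpen Ω)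
    (ht : t ∈ Ioo 0 T) (hx : x ∈ Ω) : TimeReg (fun s => f s x) (fun s => dt f s x) t where
  measurable := by
    filter_upwards [isOpen_Ioo.mem_nhds ht] with s hs using hf.measurable s hs x hx
  measurable' := hf'.measurable t ht x hx
  hasDerivAt := by
    filter_upwards [isOpen_Ioo.mem_nhds ht] with s hs v
    exact (hf.differentiableAt_time hΩ hs hx v).hasDerivAt
  growth := hf.growth.eventually_time hΩ ht hx
  growth' := hf'.growth.eventually_time hΩ ht hx

lemma KinRegular.hasDerivAt_transport (hf : KinRegular T Ω f) (hf' : KinRegular T Ω (dt f))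
    (hΩ : IsOpen Ω) (ht : t ∈ Ioo 0 T) (hx : x ∈ Ω) (v : E3) :
    HasDerivAt (fun s => transport f s x v) (transport (dt f) t x v) t :=
  (hasDerivAt_fderiv_time (f := fun s y => f s y v) hΩ (hf.contDiff v) (hf'.contDiff v) ht
    hx).clm_apply (hasDerivAt_const t v) |>.congr_deriv (by simp [transport, dt])

lemma growth_transport {f : ℝ → E3 → E3 → ℝ}
    (hf : PolyGrowth T Ω fun t x v => fderiv ℝ (fun y => f t y v) x) (hΩ : IsOpen Ω)
    (ht : t ∈ Ioo 0 T) (hx : x ∈ Ω) :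
    ∃ (C : ℝ) (N : ℕ), 0 ≤ C ∧ ∀ᶠ s in nhds t, ∀ v, |transport f s x v| ≤ C * (1 + ‖v‖) ^ N := by
  obtain ⟨C, N, hC, h⟩ := hf.eventually_time hΩ ht hx
  refine ⟨C, N + 1, hC, ?_⟩
  filter_upwards [h] with s hs v
  calc _ ≤ ‖fderiv ℝ (fun y => f s y v) x‖ * ‖v‖ := ContinuousLinearMap.le_opNorm _ _
    _ ≤ C * (1 + ‖v‖) ^ N * (1 + ‖v‖) := by gcongr; exacts [hs v, by linarith]
    _ = _ := by ring

lemma KinRegularGrad.timeReg_transport (hf : KinRegularGrad T Ω f) (hf' : KinRegularGrad T Ω (dt f))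
    (hΩ : IsOpen Ω) (ht : t ∈ Ioo 0 T) (hx : x ∈ Ω) :
    TimeReg (fun s => transport f s x) (fun s => transport (dt f) s x) t where
  measurable := by
    filter_upwards [isOpen_Ioo.mem_nhds ht] with s hs using (hf.modGrowth_transport hΩ hs hx).1
  measurable' := (hf'.modGrowth_transport hΩ ht hx).1
  hasDerivAt := by
    filter_upwards [isOpen_Ioo.mem_nhds ht] with s hs v
    exact hf.toKinRegular.hasDerivAt_transport hf'.toKinRegular hΩ hs hx v
  growth := growth_transport hf.growth_grad hΩ ht hx
  growth' := growth_transport hf'.growth_grad hΩ ht hx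

lemma TimeReg.hasDerivAt_projP {a a' : ℝ → E3 → ℝ} (ha : TimeReg a a' t) (v : E3) :
    HasDerivAt (fun s => projP (a s) v) (projP (a' t) v) t := by
  simp only [projP_eq]
  refine (HasDerivAt.fun_sum fun j _ => ?_).mul_const _
  exact ((ha.hasDerivAt_moment (ModGrowth.nullPoly' j)).div_const _).mul_const _

lemma TimeReg.hasDerivAt_linL {a a' : ℝ → E3 → ℝ} (ha : TimeReg a a' t) (v : E3) :
    HasDerivAt (fun s => linL (a s) v) (linL (a' t) v) t := by
  simp only [linL_eq_gam]
  have h := ((TimeReg.const .sqrtMaxw' t).hasDerivAt_gam ha v).const_mul (-2)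
  have e : gam (fun _ => 0) (a t) v = 0 := by
    have := gam_const_mul_left (a t) (fun _ => 0) 0 v
    simpa using this
  rwa [e, zero_add] at h

end kinetic

/-! ### Time regularity of the hydrodynamic part -/

lemma abs_hydroPoly_mul_le (r : ℝ) (b : E3) (τ : ℝ) (v : E3) :
    |hydroPoly r b τ v * sqrtMaxw v| ≤ (|r| + ‖b‖ + 2 * |τ|) * (1 + ‖v‖) ^ 2 := by
  rw [abs_mul, abs_of_pos (sqrtMaxw_pos v)]
  have h1 := abs_real_inner_le_norm b v
  have h2 : |(‖v‖ ^ 2 - 3) / 2| ≤ 2 * (1 + ‖v‖) ^ 2 := by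
    rw [abs_le]; constructor <;> nlinarith [norm_nonneg v]
  have h3 : |hydroPoly r b τ v| ≤ |r| + |inner ℝ b v| + |τ| * |(‖v‖ ^ 2 - 3) / 2| := by
    rw [← abs_mul]; exact (abs_add_le _ _).trans (by gcongr; exact abs_add_le _ _)
  have h4 : 1 ≤ (1 + ‖v‖) ^ 2 := by nlinarith [norm_nonneg v]
  have h5 : ‖v‖ ≤ (1 + ‖v‖) ^ 2 := by nlinarith [norm_nonneg v]
  calc |hydroPoly r b τ v| * sqrtMaxw v ≤ |hydroPoly r b τ v| :=
        mul_le_of_le_one_right (abs_nonneg _) (sqrtMaxw_le_one v)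
    _ ≤ |r| + ‖b‖ * ‖v‖ + |τ| * (2 * (1 + ‖v‖) ^ 2) := h3.trans (by gcongr)
    _ ≤ |r| * (1 + ‖v‖) ^ 2 + ‖b‖ * (1 + ‖v‖) ^ 2 + |τ| * (2 * (1 + ‖v‖) ^ 2) := by
        gcongr
        exact le_mul_of_one_le_right (abs_nonneg r) h4
    _ = _ := by ring

lemma growth_hydroPoly {r : ℝ → ℝ} {b : ℝ → E3} {τ : ℝ → ℝ} {t : ℝ} (hr : ContinuousAt r t)
    (hb : ContinuousAt b t) (hτ : ContinuousAt τ t) :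
    ∃ (C : ℝ) (N : ℕ), 0 ≤ C ∧ ∀ᶠ s in nhds t, ∀ v,
      |hydroPoly (r s) (b s) (τ s) v * sqrtMaxw v| ≤ C * (1 + ‖v‖) ^ N := by
  have hc : ContinuousAt (fun s => |r s| + ‖b s‖ + 2 * |τ s|) t :=
    (hr.abs.add hb.norm).add (continuousAt_const.mul hτ.abs)
  refine ⟨|r t| + ‖b t‖ + 2 * |τ t| + 1, 2, by positivity, ?_⟩
  filter_upwards [hc.eventually_le_const (lt_add_one _)] with s hs v
  exact (abs_hydroPoly_mul_le _ _ _ v).trans (by gcongr)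

lemma continuousAt_deriv {G : Type*} [NormedAddCommGroup G] [NormedSpace ℝ G] {g : ℝ → G} {t : ℝ}
    (hg : ContDiffAt ℝ 2 g t) : ContinuousAt (deriv g) t := by
  have h : ContinuousAt (fderiv ℝ g) t := (hg.fderiv_right (m := 1) (by norm_num)).continuousAt
  have := h.clm_apply (continuousAt_const (y := (1 : ℝ)))
  simpa using this

lemma IsNSF.timeReg {T : ℝ} {Ω : Set E3} {κ : ℝ} {ρ : ℝ → E3 → ℝ} {u : ℝ → E3 → E3}
    {θ p : ℝ → E3 → ℝ} {t : ℝ} {x : E3} (h : IsNSF T Ω κ ρ u θ p) (hΩ : IsOpen Ω)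
    (ht : t ∈ Ioo 0 T) (hx : x ∈ Ω) :
    TimeReg (fun s => hydro ρ u θ s x) (fun s => dt (hydro ρ u θ) s x) t where
  measurable := .of_forall fun s => (ModGrowth.hydro' ρ u θ s x).1
  measurable' := by
    rw [h.dt_hydro_eq hΩ ht hx]
    exact ((ModGrowth.hydroPoly' _ _ _).mul .sqrtMaxw').1
  hasDerivAt := by
    filter_upwards [isOpen_Ioo.mem_nhds ht] with s hs v
    have dθ := (contDiffAt_time hΩ h.contDiff_theta hs hx).differentiableAt (by norm_num)
    have dρ := (contDiffAt_time hΩ h.contDiff_rho hs hx).differentiableAt (by norm_num)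
    have du := (contDiffAt_time hΩ h.contDiff_u hs hx).differentiableAt (by norm_num)
    have : DifferentiableAt ℝ (fun r => hydro ρ u θ r x v) s :=
      ((dρ.fun_add (du.inner ℝ (differentiableAt_const v))).fun_add (dθ.mul_const _)).mul_const _
    exact this.hasDerivAt
  growth := growth_hydroPoly (contDiffAt_time hΩ h.contDiff_rho ht hx).continuousAt
    (contDiffAt_time hΩ h.contDiff_u ht hx).continuousAt
    (contDiffAt_time hΩ h.contDiff_theta ht hx).continuousAt
  growth' := by
    obtain ⟨C, N, hC, hb⟩ := growth_hydroPoly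
      (continuousAt_deriv (contDiffAt_time hΩ h.contDiff_rho ht hx))
      (continuousAt_deriv (contDiffAt_time hΩ h.contDiff_u ht hx))
      (continuousAt_deriv (contDiffAt_time hΩ h.contDiff_theta ht hx))
    refine ⟨C, N, hC, ?_⟩
    filter_upwards [hb, isOpen_Ioo.mem_nhds ht] with s hs hsT v
    rw [h.dt_hydro_eq hΩ hsT hx]
    exact hs v

/-- Differentiating the remainder equation in time. -/
theorem remainderEqDt {T : ℝ} {Ω : Set E3} {ε κ : ℝ} {ρ : ℝ → E3 → ℝ} {u : ℝ → E3 → E3}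
    {θ p : ℝ → E3 → ℝ} {f₂ fR : ℝ → E3 → E3 → ℝ} (hN : IsNSF T Ω κ ρ u θ p) (hΩ : IsOpen Ω)
    (hf : KinRegularGrad T Ω f₂) (hf' : KinRegularGrad T Ω (dt f₂)) (hR : KinRegular T Ω fR)
    (hR' : KinRegular T Ω (dt fR)) (h : RemainderEq T Ω ε κ (hydro ρ u θ) f₂ fR) :
    RemainderEqDt T Ω ε κ (hydro ρ u θ) f₂ fR := by
  intro t ht x hx v
  have r1 := hN.timeReg hΩ ht hx
  have r2 := hf.toKinRegular.timeReg hf'.toKinRegular hΩ ht hx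
  have r3 := hR.timeReg hR' hΩ ht hx
  have dL := (((hR'.differentiableAt_time hΩ ht hx v).hasDerivAt).fun_add
    ((hR.hasDerivAt_transport hR' hΩ ht hx v).const_mul (1 / ε))).fun_add
    ((r3.hasDerivAt_linL v).const_mul (1 / (ε ^ 2 * κ)))
  have dA := (((hf.toKinRegular.hasDerivAt_transport hf'.toKinRegular hΩ ht hx v).fun_sub
    ((hf.timeReg_transport hf' hΩ ht hx).hasDerivAt_projP v)).fun_sub
    ((r1.hasDerivAt_gam r2 v).const_mul (2 / κ))).const_mul (-(1 / ε ^ (1 / 2 : ℝ)))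
  have dB := (((hf'.toKinRegular.differentiableAt_time hΩ ht hx v).hasDerivAt.fun_neg).fun_add
    ((r2.hasDerivAt_gam r2 v).const_mul (1 / κ))).const_mul (ε ^ (1 / 2 : ℝ))
  have dC := ((r1.add (r2.const_mul ε)).hasDerivAt_gam r3 v).const_mul (2 / (ε * κ))
  have dD := (r3.hasDerivAt_gam r3 v).const_mul (1 / (ε ^ (1 / 2 : ℝ) * κ))
  have dRHS := ((dA.fun_add dB).fun_add dC).fun_add dD
  -- Both sides of the remainder equation agree for all times near `t`, so their derivatives at `t`
  -- coincide.
  have e := (dL.congr_of_eventuallyEq (f₁ := _) (by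
    filter_upwards [isOpen_Ioo.mem_nhds ht] with s hs
    exact (h s hs x hx v).symm)).unique dRHS
  -- By symmetry of `Γ` the two terms of the product rule for `Γ(f,f)` merge, which accounts for the
  -- coefficients `2` in the differentiated equation.
  have e2 : gam (f₂ t x) (dt f₂ t x) v = gam (dt f₂ t x) (f₂ t x) v := gam_comm _ _ _
  have e3 : gam (fR t x) (dt fR t x) v = gam (dt fR t x) (fR t x) v := gam_comm _ _ _
  rw [e2, e3] at e
  refine Eq.trans ?_ (e.trans ?_)
  · rfl
  · rw [show deriv (fun s => dt f₂ s x v) t = dt (dt f₂) t x v from rfl]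
    ring

end HilbertExpansion

end

/-! ### Assembly of the four assertions -/

theorem proposition2p1 (T : ℝ) (Ω : Set E3) (hΩ : IsOpen Ω) (ε κ : ℝ) (hε : 0 < ε) (hκ : 0 < κ)
    (ρ : ℝ → E3 → ℝ) (u : ℝ → E3 → E3) (θ p : ℝ → E3 → ℝ)
    (hNSF : IsNSF T Ω κ ρ u θ p)
    (f₁ : ℝ → E3 → E3 → ℝ) (hf₁ : f₁ = hydro ρ u θ) :
    -- the transport coefficients
    (∀ i j k l : Fin 3, pair (tensorA i j) (linL (tensorA k l)) =
      etaV * (kron i k * kron j l + kron i l * kron j k - 2 / 3 * (kron i j * kron k l))) ∧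
    (∀ k j : Fin 3, pair (linL (vectorB k)) (vectorB j) = 5 / 2 * etaC * kron k j) ∧
    -- the argument of `L⁻¹` lies in `𝒩^⊥`
    (∀ t ∈ Set.Ioo 0 T, ∀ x ∈ Ω, InNullPerp (microSource κ f₁ t x)) ∧
    ∀ (ρ₂ : ℝ → E3 → ℝ) (u₂ : ℝ → E3 → E3) (θ₂ : ℝ → E3 → ℝ) (f₂ : ℝ → E3 → E3 → ℝ),
      KinRegularGrad T Ω f₂ →
      IsSecondCorrector T Ω κ ρ u p f₁ ρ₂ u₂ θ₂ f₂ →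
      -- the singular orders cancel
      (∀ t ∈ Set.Ioo 0 T, ∀ x ∈ Ω, ∀ v : E3,
        linL (f₁ t x) v = 0 ∧
        transport f₁ t x v - 1 / κ * gam (f₁ t x) (f₁ t x) v + 1 / κ * linL (f₂ t x) v = 0 ∧
        projP (fun w => dt f₁ t x w + transport f₂ t x w
          - 2 / κ * gam (f₁ t x) (f₂ t x) w) v = 0) ∧
      ∀ F fR : ℝ → E3 → E3 → ℝ,
        KinRegular T Ω fR →
        (∀ t ∈ Set.Ioo 0 T, ∀ x ∈ Ω, ∀ v : E3,
          F t x v = maxw v + ε * f₁ t x v * sqrtMaxw v + ε ^ 2 * f₂ t x v * sqrtMaxw v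
            + ε ^ (3 / 2 : ℝ) * fR t x v * sqrtMaxw v) →
        SolvesBoltzmann T Ω ε (κ * ε) F →
        RemainderEq T Ω ε κ f₁ f₂ fR ∧
        (KinRegularGrad T Ω (dt f₂) → KinRegular T Ω (dt fR) →
          RemainderEqDt T Ω ε κ f₁ f₂ fR) := by
  subst hf₁
  refine ⟨pair_tensorA, pair_vectorB, fun t ht x hx => ?_, fun ρ₂ u₂ θ₂ f₂ hf hC => ⟨?_, ?_⟩⟩
  · rw [hNSF.microSource_eq hΩ ht hx]
    exact inNullPerp_microSum _ _ _ _ _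
  · exact fun t ht x hx v => ⟨linL_hydro ρ u θ t x v, order_two hκ.ne' hC ht hx v,
      projP_solvability hΩ hf hC ht hx hNSF hκ.ne' v⟩
  · intro F fR hR hF hB
    have h := remainderEq hNSF hΩ hε hκ hf hC hR hF hB
    exact ⟨h, fun hf' hR' => remainderEqDt hNSF hΩ hf hf' hR hR' h⟩
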